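/- **Setting.** Let $n\ge 2$, let $X$ be a compact connected complex manifold of dimension $n$, $D\subset X$ a smooth complex hypersurface, $M=X\setminus D$, $0<\beta\le 1$ and $0<\alpha<1$. A *Kähler cone metric* (of angle $2\pi\beta$ along $D$) is a smooth Kähler form on $M$ which, in holomorphic coordinates with $D=\{z^1=0\}$, is locally quasi-isometric to $\sqrt{-1}\,\bigl(\beta^2|z^1|^{2(\beta-1)}dz^1\wedge d\bar z^1+\sum_{j\ge 2}dz^j\wedge d\bar z^j\bigr)$. The space $C^\alpha_\beta$ consists of the functions that are $\alpha$-Hölder with respect to this local cone metric; a form is in $C^\alpha_\beta$ if its components in the frame $|z^1|^{\beta-1}dz^1,dz^2,\dots,dz^n$ are; and $C^{2,\alpha}_\beta=\{f: f,\partial f,\partial\bar\partial f\in C^\alpha_\beta\}$. Fix a background Kähler cone metric $\omega$ of class $C^\alpha_\beta$, put $V=\int_M\omega^n$ and $\omega_\varphi=\omega+\sqrt{-1}\partial\bar\partial\varphi$. A *continuity path* is a curve $\varphi(t)$, $t\in[0,1]$, continuous in $C^{2,\alpha}_\beta$, such that every $\omega_{\varphi(t)}$ is a Kähler cone metric and $$\mathrm{Ric}(\omega_{\varphi(t)})=t\,\omega_{\varphi(t)}+(1-t)\,\omega+2\pi(1-\beta)[D]$$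 as currents on $X$. Let $I(\omega,\omega_\varphi)=\frac1V\int_M\varphi(\omega^n-\omega_\varphi^n)$ and $\mathrm{osc}(\varphi)=\sup_M\varphi-\inf_M\varphi$. For a Kähler cone metric $\theta$ let $\|\cdot\|_p$ be the $L^p$ norm of the measure $\theta^n/\int_M\theta^n$, and let $|\partial w|^2=\theta^{i\bar j}w_iw_{\bar j}$. A number $C_S$ is a Sobolev constant of $\theta$ if $\|w\|^2_{2n/(n-1)}\le C_S(\|\partial w\|_2^2+\|w\|_2^2)$ for all real $w\in W^{1,2}(\theta)$, and $C_P$ is a Poincaré constant of $\theta$ if $\|w-\bar w\|_2^2\le C_P\|\partial w\|_2^2$ for all real $w\in W^{1,2}(\theta)$, where $\bar w$ is the mean of $w$ for $\theta^n/\int_M\theta^n$. **Proposition (zero order estimate).** For every $n\ge2$ there is a function $C=C(V,A,P,S)$ such that for all data as above and every continuity path $\varphi(t)$ there is $\tau_0\in(0,1)$ with the following property. Let $0<\tau<1$, let $A$ and $P$ be a Sobolev and a Poincaré constant of $\omega$, and let $S$ be a Sobolev constant of $\omega_{\varphi(t)}$ for all $t\in(\tau,1]$. Then $$\mathrm{osc}(\varphi(t))\le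 C(V,A,P,S)\,\bigl(I(\omega,\omega_{\varphi(t)})+1\bigr)$$ for all $t\in[\tau,1]$, and, if $\tau\le\tau_0$, for all $t\in[0,1]$. -/

import Mathlib

open Set Filter Topology MeasureTheory
open scoped Manifold ContDiff ENNReal Matrix ComplexOrder

noncomputable section

namespace KahlerCone

/-- The model space `ℂⁿ`. Its norm is only used through its topology, and up to equivalence. -/
abbrev Cn (n : ℕ) : Type := Fin n → ℂ

section Wirtinger

variable {n : ℕ}

/-- The Wirtinger derivative `∂f/∂zᵢ = ½ (∂/∂xᵢ - √-1 ∂/∂yᵢ) f`. -/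
def dz (i : Fin n) (f : Cn n → ℂ) (z : Cn n) : ℂ :=
  (1 / 2) * (fderiv ℝ f z (Pi.single i 1) - Complex.I * fderiv ℝ f z (Pi.single i Complex.I))

/-- The Wirtinger derivative `∂f/∂z̄ᵢ = ½ (∂/∂xᵢ + √-1 ∂/∂yᵢ) f`. -/
def dzbar (i : Fin n) (f : Cn n → ℂ) (z : Cn n) : ℂ :=
  (1 / 2) * (fderiv ℝ f z (Pi.single i 1) + Complex.I * fderiv ℝ f z (Pi.single i Complex.I))

/-- `∂²f/∂zᵢ∂z̄ⱼ`. -/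
def ddbar (i j : Fin n) (f : Cn n → ℂ) (z : Cn n) : ℂ := dz i (dzbar j f) z

/-- The coordinates `(|z_k|^(β-1) z_k, zⱼ (j ≠ k))`. They identify the cone metric of angle `2πβ`
along `{z_k = 0}` with the Euclidean metric up to a bi-Lipschitz map, so that the distance of the
cone metric is comparable to the Euclidean distance of these coordinates. -/
def coneCoord (β : ℝ) (k : Fin n) (z : Cn n) : Cn n :=
  Function.update z k (((‖z k‖ ^ (β - 1) : ℝ) : ℂ) * z k)

/-- The factor that turns the `dzᵢ`-component of a form into its component in the frame
`|z_k|^(β-1) dz_k, dzⱼ (j ≠ k)`, which is uniformly comparable to a unitary frame of the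
cone metric. -/
def coneWeight (β : ℝ) (k i : Fin n) (z : Cn n) : ℂ :=
  if i = k then ((‖z k‖ ^ (1 - β) : ℝ) : ℂ) else 1

/-- On `U`, away from `{z_k = 0}`, the function `f` and its `α`-Hölder quotients with respect to
the cone metric of angle `2πβ` along `{z_k = 0}` are bounded by `N`. -/
def HolderLE (β α : ℝ) (k : Fin n) (U : Set (Cn n)) (N : ℝ) (f : Cn n → ℂ) : Prop :=
  (∀ z ∈ U, z k ≠ 0 → ‖f z‖ ≤ N) ∧
  ∀ z ∈ U, ∀ w ∈ U, z k ≠ 0 → w k ≠ 0 →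
    ‖f z - f w‖ ≤ N * ‖coneCoord β k z - coneCoord β k w‖ ^ α

/-- On `U` the function `f` and the components of `∂f` and `∂∂̄f` in the cone frame have
`C^α_β`-norms at most `N`. -/
def Holder2LE (β α : ℝ) (k : Fin n) (U : Set (Cn n)) (N : ℝ) (f : Cn n → ℂ) : Prop :=
  HolderLE β α k U N f ∧
  (∀ i, HolderLE β α k U N fun z => coneWeight β k i z * dz i f z) ∧
  ∀ i j, HolderLE β α k U N fun z => coneWeight β k i z * coneWeight β k j z * ddbar i j f z

/-- The squared length of the vector `v` at `z` for the flat cone metric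
`β² |z_k|^(2(β-1)) |dz_k|² + ∑_{j ≠ k} |dzⱼ|²`. -/
def flatCone (β : ℝ) (k : Fin n) (z v : Cn n) : ℝ :=
  ∑ i, (if i = k then β ^ 2 * ‖z k‖ ^ (2 * (β - 1)) else 1) * ‖v i‖ ^ 2

/-- The `(i, j)` coefficient of the current of integration along `{z_k = 0}`, written as
`[D] = √-1 ∑ᵢⱼ [D]ᵢⱼ dzᵢ ∧ dz̄ⱼ`, evaluated on the test function `χ`. As `√-1 dz_k ∧ dz̄_k` is
twice the Lebesgue measure of `ℂ`, the only nonzero coefficient `[D]_kk` is `½` times the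
integral over the slice. -/
def divisorCurrent (k i j : Fin n) (χ : Cn n → ℂ) : ℂ :=
  if i = k ∧ j = k then
    (1 / 2) * ∫ w : {l : Fin n // l ≠ k} → ℂ, χ (fun l => if h : l = k then 0 else w ⟨l, h⟩)
  else 0

end Wirtinger

section Manifold

variable {n : ℕ} {X : Type*} [TopologicalSpace X] [ChartedSpace (Cn n) X]

/-- The holomorphic charts of `X`. -/
def IsHolChart (e : OpenPartialHomeomorph X (Cn n)) : Prop :=
  e ∈ IsManifold.maximalAtlas 𝓘(ℂ, Cn n) ω X

/-- A holomorphic chart in whose domain `D` is `{z_k = 0}` (possibly empty there). -/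
def IsDivisorChart (D : Set X) (e : OpenPartialHomeomorph X (Cn n)) (k : Fin n) : Prop :=
  IsHolChart e ∧ ∀ x ∈ e.source, x ∈ D ↔ e x k = 0

variable (n) in
/-- `D` is a smooth complex hypersurface of `X`. -/
def IsSmoothHypersurface (D : Set X) : Prop :=
  IsClosed D ∧ ∀ p ∈ D, ∃ (e : OpenPartialHomeomorph X (Cn n)) (k : Fin n),
    IsDivisorChart D e k ∧ p ∈ e.source

/-- The part of the range of a chart that corresponds to the regular part `M = X \ D`. -/
def regTarget (D : Set X) (e : OpenPartialHomeomorph X (Cn n)) : Set (Cn n) :=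
  e.target ∩ e.symm ⁻¹' Dᶜ

/-- The complex Jacobian matrix `∂wₐ/∂zᵢ` of the change of coordinates from `z = e` to `w = e'`. -/
def jac (e e' : OpenPartialHomeomorph X (Cn n)) (z : Cn n) : Matrix (Fin n) (Fin n) ℂ :=
  Matrix.of fun a i => fderiv ℂ (fun y => e' (e.symm y)) z (Pi.single i 1) a

/-- A real function on `X` in the coordinates of a chart, as a complex-valued function. -/
def inChart (e : OpenPartialHomeomorph X (Cn n)) (f : X → ℝ) (z : Cn n) : ℂ := (f (e.symm z) : ℂ)

variable (n X) in
/-- Coefficients `g_{i j̄}` of a form `√-1 ∑ g_{i j̄} dzᵢ ∧ dz̄ⱼ` in the charts of `X`; the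
transformation law is part of the predicates below. Only the values on `M = X \ D` in holomorphic
charts matter. -/
abbrev Coeffs11 := OpenPartialHomeomorph X (Cn n) → Cn n → Matrix (Fin n) (Fin n) ℂ

variable (n X) in
/-- Coefficients `ηᵢ` of a form `∑ ηᵢ dzᵢ` in the charts of `X`. -/
abbrev Coeffs10 := OpenPartialHomeomorph X (Cn n) → Cn n → Fin n → ℂ

/-- The coefficients transform as those of a `(1,1)`-form on `M`. -/
def IsForm11 (D : Set X) (g : Coeffs11 n X) : Prop :=
  ∀ e e' : OpenPartialHomeomorph X (Cn n), IsHolChart e → IsHolChart e' →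
    ∀ z ∈ regTarget D e, e.symm z ∈ e'.source → ∀ i j,
      g e z i j = ∑ a, ∑ b,
        jac e e' z a i * starRingEnd ℂ (jac e e' z b j) * g e' (e' (e.symm z)) a b

/-- The coefficients transform as those of a `(1,0)`-form on `M`. -/
def IsForm10 (D : Set X) (η : Coeffs10 n X) : Prop :=
  ∀ e e' : OpenPartialHomeomorph X (Cn n), IsHolChart e → IsHolChart e' →
    ∀ z ∈ regTarget D e, e.symm z ∈ e'.source → ∀ i,
      η e z i = ∑ a, jac e e' z a i * η e' (e' (e.symm z)) a

/-- `√-1 ∑ g_{i j̄} dzᵢ ∧ dz̄ⱼ` is a Kähler cone metric of cone angle `2πβ` along `D`: a smooth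
Kähler form on `M = X \ D` which near every point of `X` is quasi-isometric to the flat cone
metric in the coordinates of a divisor chart (which away from `D` is no condition). -/
structure IsKahlerConeMetric (D : Set X) (β : ℝ) (g : Coeffs11 n X) : Prop where
  isForm : IsForm11 D g
  smooth : ∀ e : OpenPartialHomeomorph X (Cn n), IsHolChart e → ∀ i j,
    ContDiffOn ℝ ∞ (fun z => g e z i j) (regTarget D e)
  posDef : ∀ e : OpenPartialHomeomorph X (Cn n), IsHolChart e → ∀ z ∈ regTarget D e,
    (g e z).PosDef
  closed : ∀ e : OpenPartialHomeomorph X (Cn n), IsHolChart e → ∀ z ∈ regTarget D e, ∀ i j l,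
    dz l (fun y => g e y i j) z = dz i (fun y => g e y l j) z
  quasiIsometric : ∀ (e : OpenPartialHomeomorph X (Cn n)) (k : Fin n), IsDivisorChart D e k →
    ∀ p ∈ e.target, ∃ U ∈ 𝓝 p, ∃ c : ℝ, 0 < c ∧ ∀ z ∈ U ∩ regTarget D e, ∀ v : Cn n,
      c⁻¹ * flatCone β k z v ≤ (∑ i, ∑ j, g e z i j * v i * starRingEnd ℂ (v j)).re ∧
      (∑ i, ∑ j, g e z i j * v i * starRingEnd ℂ (v j)).re ≤ c * flatCone β k z v

/-- The metric is of class `C^α_β`: its components in the cone frame are locally Hölder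
continuous with respect to the cone metric, up to `D`. -/
def MetricHolder (D : Set X) (β α : ℝ) (g : Coeffs11 n X) : Prop :=
  ∀ p : X, ∃ (e : OpenPartialHomeomorph X (Cn n)) (k : Fin n), IsDivisorChart D e k ∧
    p ∈ e.source ∧ ∃ U ∈ 𝓝 (e p), ∃ N : ℝ, ∀ i j,
      HolderLE β α k (U ∩ e.target) N
        fun z => coneWeight β k i z * coneWeight β k j z * g e z i j

variable (n) in
/-- `f ∈ C^{2,α}_β`: the function `f` is of class `C²` on `M`, and `f`, `∂f`, `∂∂̄f` are in
`C^α_β` up to `D`. -/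
def MemHolder2 (D : Set X) (β α : ℝ) (f : X → ℝ) : Prop :=
  (∀ e : OpenPartialHomeomorph X (Cn n), IsHolChart e →
    ContDiffOn ℝ 2 (inChart e f) (regTarget D e)) ∧
  ∀ p : X, ∃ (e : OpenPartialHomeomorph X (Cn n)) (k : Fin n), IsDivisorChart D e k ∧
    p ∈ e.source ∧ ∃ U ∈ 𝓝 (e p), ∃ N : ℝ, Holder2LE β α k (U ∩ e.target) N (inChart e f)

variable (n) in
/-- The curve `t ↦ φ t`, `t ∈ [0,1]`, is continuous for the `C^{2,α}_β`-topology, i.e. for the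
convergence of the `C^{2,α}_β`-norms near every point (`X` is compact in the application). -/
def ContinuousHolder2 (D : Set X) (β α : ℝ) (φ : ℝ → X → ℝ) : Prop :=
  ∀ s ∈ Icc (0 : ℝ) 1, ∀ p : X, ∃ (e : OpenPartialHomeomorph X (Cn n)) (k : Fin n),
    IsDivisorChart D e k ∧ p ∈ e.source ∧ ∃ U ∈ 𝓝 (e p), ∀ ε > 0,
      ∀ᶠ t in 𝓝[Icc 0 1] s,
        Holder2LE β α k (U ∩ e.target) ε (inChart e fun x => φ t x - φ s x)

/-- The coefficients of `ω_φ = ω + √-1 ∂∂̄φ`. -/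
def withPotential (g : Coeffs11 n X) (φ : X → ℝ) : Coeffs11 n X := fun e z =>
  Matrix.of fun i j => g e z i j + ddbar i j (inChart e φ) z

/-- The equation of currents `Ric(ω') = t ω' + (1 - t) ω + 2π (1 - β) [D]` on `X`, for the metrics
`ω`, `ω'` with coefficients `g`, `g'`. Here `Ric(ω') = -√-1 ∂∂̄ log det g'`. -/
def RicciPathEq (D : Set X) (β t : ℝ) (g g' : Coeffs11 n X) : Prop :=
  ∀ (e : OpenPartialHomeomorph X (Cn n)) (k : Fin n), IsDivisorChart D e k →
    ∀ χ : Cn n → ℂ, ContDiff ℝ ∞ χ → HasCompactSupport χ → tsupport χ ⊆ e.target → ∀ i j,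
      -∫ z, (Real.log (g' e z).det.re : ℂ) * ddbar i j χ z =
        (∫ z, ((t : ℂ) * g' e z i j + (1 - (t : ℂ)) * g e z i j) * χ z) +
          2 * Real.pi * (1 - β) * divisorCurrent k i j χ

/-- The continuity path of the background metric `ω` with coefficients `g`: a continuous curve of
potentials `φ t ∈ C^{2,α}_β`, `0 ≤ t ≤ 1`, such that `ω_{φ t}` is a Kähler cone metric and
`Ric(ω_{φ t}) = t ω_{φ t} + (1 - t) ω + 2π (1 - β) [D]`. -/
structure IsContinuityPath (D : Set X) (β α : ℝ) (g : Coeffs11 n X) (φ : ℝ → X → ℝ) :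
    Prop where
  memHolder : ∀ t ∈ Icc (0 : ℝ) 1, MemHolder2 n D β α (φ t)
  isMetric : ∀ t ∈ Icc (0 : ℝ) 1, IsKahlerConeMetric D β (withPotential g (φ t))
  ricci : ∀ t ∈ Icc (0 : ℝ) 1, RicciPathEq D β t g (withPotential g (φ t))
  continuous : ContinuousHolder2 n D β α φ

/-- The oscillation of a function over `M = X \ D`. -/
def osc (D : Set X) (f : X → ℝ) : ℝ := sSup (f '' Dᶜ) - sInf (f '' Dᶜ)

section Volume

variable (n X) in
theorem exists_chart_cover [CompactSpace X] [Nonempty X] :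
    ∃ c : ℕ → X, ⋃ m, (chartAt (Cn n) (c m)).source = univ := by
  obtain ⟨s, hs, hcov⟩ := countable_cover_nhds_of_sigmaCompact
    (fun x : X => (chartAt (Cn n) x).open_source.mem_nhds (mem_chart_source (Cn n) x))
  have hne : s.Nonempty := by
    rcases s.eq_empty_or_nonempty with h | h
    · rw [h] at hcov
      simp at hcov
      exact absurd hcov.symm (by simp)
    · exact h
  obtain ⟨c, hc⟩ := hs.exists_eq_range hne
  refine ⟨c, ?_⟩
  rw [← hcov, hc]
  simp

variable (n X) in
/-- Centres of countably many preferred charts that cover `X`. -/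
def chartCover [CompactSpace X] [Nonempty X] : ℕ → X := Classical.choose (exists_chart_cover n X)

variable [MeasurableSpace X]

/-- The measure `ωⁿ = n! 2ⁿ det(g) dx₁dy₁⋯dxₙdyₙ` on the domain of a chart. -/
def chartVolume (g : Coeffs11 n X) (e : OpenPartialHomeomorph X (Cn n)) : Measure X :=
  Measure.map e.symm ((volume.restrict e.target).withDensity
    fun z => ENNReal.ofReal (n.factorial * 2 ^ n * (g e z).det.re))

variable [CompactSpace X] [Nonempty X]

/-- The measure `ωⁿ` on `X`, glued from a countable cover by charts; by the transformation law it
coincides with `chartVolume g e` on the domain of any holomorphic chart. The set `D` is null. -/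
def vol (g : Coeffs11 n X) : Measure X :=
  Measure.sum fun m => (chartVolume g (chartAt (Cn n) (chartCover n X m))).restrict
    (disjointed (fun l => (chartAt (Cn n) (chartCover n X l)).source) m)

/-- The total volume `V`. -/
def totalVol (g : Coeffs11 n X) : ℝ := (vol g univ).toReal

/-- The probability measure `ωⁿ / V`. -/
def normVol (g : Coeffs11 n X) : Measure X := (vol g univ)⁻¹ • vol g

/-- The pointwise squared norm `g^{i j̄} ηᵢ η̄ⱼ` of a `(1,0)`-form, computed in the preferred chart
at the point; by the transformation laws any other holomorphic chart gives the same value. -/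
def normSq10 (g : Coeffs11 n X) (η : Coeffs10 n X) (x : X) : ℝ :=
  (∑ i, ∑ j, (g (chartAt (Cn n) x) (chartAt (Cn n) x x))⁻¹ j i *
    η (chartAt (Cn n) x) (chartAt (Cn n) x x) i *
      starRingEnd ℂ (η (chartAt (Cn n) x) (chartAt (Cn n) x x) j)).re

/-- The real function `w` is in `W^{1,2}(ω)`, and `η` is its weak differential `∂w` on `M`. -/
structure IsSobolev12 (D : Set X) (g : Coeffs11 n X) (w : X → ℝ) (η : Coeffs10 n X) : Prop where
  memLp : MemLp w 2 (normVol g)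
  isForm : IsForm10 D η
  locInt : ∀ e : OpenPartialHomeomorph X (Cn n), IsHolChart e →
    LocallyIntegrableOn (inChart e w) (regTarget D e) ∧
      ∀ i, LocallyIntegrableOn (fun z => η e z i) (regTarget D e)
  weak : ∀ e : OpenPartialHomeomorph X (Cn n), IsHolChart e → ∀ χ : Cn n → ℂ,
    ContDiff ℝ ∞ χ → HasCompactSupport χ → tsupport χ ⊆ regTarget D e → ∀ i,
      ∫ z, inChart e w z * dz i χ z = -∫ z, η e z i * χ z
  energy : ∫⁻ x, ENNReal.ofReal (normSq10 g η x) ∂(normVol g) < ⊤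

/-- The Sobolev inequality `‖w‖²_{2*} ≤ A (‖∂w‖²₂ + ‖w‖²₂)` for all `w ∈ W^{1,2}(ω)`, with
`2* = 2n/(n-1)` and the norms of `ωⁿ/V`: the number `A` is a Sobolev constant of `ω`. -/
def HasSobolevConst (D : Set X) (g : Coeffs11 n X) (A : ℝ) : Prop :=
  ∀ (w : X → ℝ) (η : Coeffs10 n X), IsSobolev12 D g w η →
    eLpNorm w (ENNReal.ofReal (2 * n / (n - 1))) (normVol g) ^ 2 ≤
      ENNReal.ofReal A * ((∫⁻ x, ENNReal.ofReal (normSq10 g η x) ∂(normVol g)) +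
        eLpNorm w 2 (normVol g) ^ 2)

/-- The Poincaré inequality `‖w - w̄‖²₂ ≤ P ‖∂w‖²₂` for all `w ∈ W^{1,2}(ω)`, where `w̄` is the
mean of `w`: the number `P` is a Poincaré constant of `ω`. -/
def HasPoincareConst (D : Set X) (g : Coeffs11 n X) (P : ℝ) : Prop :=
  ∀ (w : X → ℝ) (η : Coeffs10 n X), IsSobolev12 D g w η →
    eLpNorm (fun x => w x - ∫ y, w y ∂(normVol g)) 2 (normVol g) ^ 2 ≤
      ENNReal.ofReal P * ∫⁻ x, ENNReal.ofReal (normSq10 g η x) ∂(normVol g)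

/-- Aubin's functional `I(ω, ω_φ) = (1/V) ∫ φ (ωⁿ - ω_φⁿ)`. -/
def aubinI (g : Coeffs11 n X) (φ : X → ℝ) : ℝ :=
  (1 / totalVol g) * ((∫ x, φ x ∂(vol g)) - ∫ x, φ x ∂(vol (withPotential g φ)))

end Volume

end Manifold

end KahlerCone

end

/-! Two one-sided Laplacian bounds drive the estimate. The form √-1∂∂̄φ = ω_φ - ω has trace at least
-n with respect to ω and at most n with respect to ω_φ, because the trace of a positive form is
nonnegative. Moser iteration (`sup_le_of_sobolev`) bounds the supremum of a function v ≥ 1 with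
Laplacian bounded below by its L² norm, with a constant that depends only on n, the lower bound and
a Sobolev constant.

On the side of ω (`sub_average_le`), the iteration is applied to a smooth convex substitute for the
positive part of φ minus its mean. It bounds sup φ minus the mean by the variance of φ. The Poincaré
inequality bounds the variance by the Dirichlet energy, and the energy is at most n·I
(`energy_le_aubinI`): with ω_s = ω + s√-1∂∂̄φ, the derivative of ∫φ ω_sⁿ is -∫|∂φ|² ω_sⁿ (norm of
ω_s), and ω_s ≥ (1-s)ω compares this with the energy for ω.

On the side of ω_φ (`sup_sub_le`), the iteration is applied to v = sup φ - φ + 1. Since ∫v² ≤ sup v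
· ∫v, the supremum of v is bounded by its integral, so only a Sobolev constant of ω_φ enters. The
means of φ for ω and ω_φ differ by exactly I, because the total volumes agree
(`totalVol_withPotential`). Together the two sides give `osc_le_aubinI` for a single potential.

The analytic point is that D contributes nothing to integrations by parts. They all reduce to ∫Δf ωⁿ
= 0 (`IsC2Cone.integral_traceAt_hessForm`) for functions f such that f, ∂f and ∂∂̄f are bounded in
the cone frame. Locally, the adjugate of the matrix of a Kähler form is divergence free
(`sum_dz_adjugate_eq_zero`), so the Laplacian is a divergence. A cutoff near z_k = 0 costs an error
of size |z_k|^(β-2), which is integrable over ℂ because β > 0 (`integral_adjugate_ddbar_eq_zero`).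
The class of such functions is stable under multiplication by smooth functions and under composition
with C² functions; this provides the partition of unity, the powers in Moser's iteration and the
admissible test functions of the Sobolev and Poincaré inequalities.

Along the path, osc and I are continuous in t (`tendsto_osc`, `tendsto_aubinI`). This carries the
estimate from t > τ to t = τ. Near t = 0 both quantities vary by less than 1, so the estimate at a
small τ implies the one on [0, τ] with a larger constant. -/

namespace KahlerCone

/-! ### Calculus of Wirtinger derivatives -/

section WirtingerCalculus

variable {n : ℕ} {f g : Cn n → ℂ} {z : Cn n}

theorem dz_congr (h : f =ᶠ[𝓝 z] g) (i : Fin n) : dz i f z = dz i g z := by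
  simp only [dz, h.fderiv_eq]

theorem dzbar_congr (h : f =ᶠ[𝓝 z] g) (i : Fin n) : dzbar i f z = dzbar i g z := by
  simp only [dzbar, h.fderiv_eq]

theorem ddbar_congr (h : f =ᶠ[𝓝 z] g) (i j : Fin n) : ddbar i j f z = ddbar i j g z :=
  dz_congr (h.eventuallyEq_nhds.mono fun _ hy => dzbar_congr hy j) i

theorem dzbar_const (i : Fin n) (c : ℂ) (z : Cn n) : dzbar i (fun _ => c) z = 0 := by simp [dzbar]

theorem dz_const (i : Fin n) (c : ℂ) (z : Cn n) : dz i (fun _ => c) z = 0 := by simp [dz]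

theorem dz_add (hf : DifferentiableAt ℝ f z) (hg : DifferentiableAt ℝ g z) (i : Fin n) :
    dz i (fun y => f y + g y) z = dz i f z + dz i g z := by
  simp only [dz, fderiv_fun_add hf hg, add_apply]
  ring

theorem dz_mul (hf : DifferentiableAt ℝ f z) (hg : DifferentiableAt ℝ g z) (i : Fin n) :
    dz i (fun y => f y * g y) z = dz i f z * g z + f z * dz i g z := by
  simp only [dz, fderiv_fun_mul hf hg, add_apply, smul_apply, smul_eq_mul]
  ring

theorem dzbar_mul (hf : DifferentiableAt ℝ f z) (hg : DifferentiableAt ℝ g z) (i : Fin n) :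
    dzbar i (fun y => f y * g y) z = dzbar i f z * g z + f z * dzbar i g z := by
  simp only [dzbar, fderiv_fun_mul hf hg, add_apply, smul_apply, smul_eq_mul]
  ring

theorem dz_const_mul (c : ℂ) (hf : DifferentiableAt ℝ f z) (i : Fin n) :
    dz i (fun y => c * f y) z = c * dz i f z := by
  rw [dz_mul (differentiableAt_const c) hf, dz_const]
  ring

theorem dz_sum {ι : Type*} (s : Finset ι) {F : ι → Cn n → ℂ}
    (hF : ∀ a ∈ s, DifferentiableAt ℝ (F a) z) (i : Fin n) :
    dz i (fun y => ∑ a ∈ s, F a y) z = ∑ a ∈ s, dz i (F a) z := by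
  simp only [dz, fderiv_fun_sum hF, sum_apply]
  rw [Finset.mul_sum, ← Finset.sum_sub_distrib, Finset.mul_sum]

theorem dzbar_sum {ι : Type*} (s : Finset ι) {F : ι → Cn n → ℂ}
    (hF : ∀ a ∈ s, DifferentiableAt ℝ (F a) z) (i : Fin n) :
    dzbar i (fun y => ∑ a ∈ s, F a y) z = ∑ a ∈ s, dzbar i (F a) z := by
  simp only [dzbar, fderiv_fun_sum hF, sum_apply]
  rw [Finset.mul_sum, ← Finset.sum_add_distrib, Finset.mul_sum]

/-- The splitting df = ∂f + ∂̄f, evaluated on a real tangent vector written as a complex one. Both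
chain rules for holomorphic maps follow from it. -/
theorem fderiv_eq_dz_dzbar (f : Cn n → ℂ) (z v : Cn n) :
    fderiv ℝ f z v = ∑ a, (v a * dz a f z + starRingEnd ℂ (v a) * dzbar a f z) := by
  have hv : v = ∑ a, ((v a).re • (Pi.single a 1 : Cn n) +
      (v a).im • (Pi.single a Complex.I : Cn n)) := by
    ext b
    simp only [Finset.sum_apply, Pi.add_apply, Pi.smul_apply, Pi.single_apply]
    rw [Finset.sum_eq_single b] <;> simp +contextual [eq_comm]
  conv_lhs => rw [hv]
  rw [map_sum]
  refine Finset.sum_congr rfl fun a _ => ?_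
  rw [map_add, map_smul, map_smul]
  have h : v a = (v a).re + (v a).im * Complex.I := (Complex.re_add_im _).symm
  have h' : starRingEnd ℂ (v a) = (v a).re - (v a).im * Complex.I := by
    apply Complex.ext <;> simp
  rw [h']
  nth_rw 3 [h]
  simp only [dz, dzbar, Complex.real_smul]
  linear_combination ((v a).im * fderiv ℝ f z (Pi.single a Complex.I)) * Complex.I_sq

/-- The derivative of Φ is complex linear, so the two directions 1 and √-1 give the same vector up
to the factor √-1, and the ∂̄-part of f cancels. -/
theorem dz_comp {Φ : Cn n → Cn n} (hf : DifferentiableAt ℝ f (Φ z))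
    (hΦ : DifferentiableAt ℂ Φ z) (i : Fin n) :
    dz i (fun y => f (Φ y)) z = ∑ a, fderiv ℂ Φ z (Pi.single i 1) a * dz a f (Φ z) := by
  have hI : (Pi.single i Complex.I : Cn n) = Complex.I • Pi.single i 1 := by
    rw [← Pi.single_smul]; simp
  have h : fderiv ℝ (fun y => f (Φ y)) z =
      (fderiv ℝ f (Φ z)).comp ((fderiv ℂ Φ z).restrictScalars ℝ) :=
    (hf.hasFDerivAt.comp z (hΦ.hasFDerivAt.restrictScalars ℝ)).fderiv
  rw [dz, h]
  simp only [ContinuousLinearMap.comp_apply, ContinuousLinearMap.coe_restrictScalars', hI,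
    map_smul]
  rw [fderiv_eq_dz_dzbar f (Φ z), fderiv_eq_dz_dzbar f (Φ z), Finset.mul_sum,
    ← Finset.sum_sub_distrib, Finset.mul_sum]
  refine Finset.sum_congr rfl fun a _ => ?_
  simp only [Pi.smul_apply, smul_eq_mul, map_mul, Complex.conj_I]
  linear_combination (-(1 / 2) * (fderiv ℂ Φ z (Pi.single i 1) a) * dz a f (Φ z) +
    (1 / 2) * starRingEnd ℂ (fderiv ℂ Φ z (Pi.single i 1) a) * dzbar a f (Φ z)) * Complex.I_sq

theorem dzbar_comp {Φ : Cn n → Cn n} (hf : DifferentiableAt ℝ f (Φ z))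
    (hΦ : DifferentiableAt ℂ Φ z) (i : Fin n) :
    dzbar i (fun y => f (Φ y)) z =
      ∑ a, starRingEnd ℂ (fderiv ℂ Φ z (Pi.single i 1) a) * dzbar a f (Φ z) := by
  have hI : (Pi.single i Complex.I : Cn n) = Complex.I • Pi.single i 1 := by
    rw [← Pi.single_smul]; simp
  have h : fderiv ℝ (fun y => f (Φ y)) z =
      (fderiv ℝ f (Φ z)).comp ((fderiv ℂ Φ z).restrictScalars ℝ) :=
    (hf.hasFDerivAt.comp z (hΦ.hasFDerivAt.restrictScalars ℝ)).fderiv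
  rw [dzbar, h]
  simp only [ContinuousLinearMap.comp_apply, ContinuousLinearMap.coe_restrictScalars', hI,
    map_smul]
  rw [fderiv_eq_dz_dzbar f (Φ z), fderiv_eq_dz_dzbar f (Φ z), Finset.mul_sum,
    ← Finset.sum_add_distrib, Finset.mul_sum]
  refine Finset.sum_congr rfl fun a _ => ?_
  simp only [Pi.smul_apply, smul_eq_mul, map_mul, Complex.conj_I]
  linear_combination ((1 / 2) * (fderiv ℂ Φ z (Pi.single i 1) a) * dz a f (Φ z) -
    (1 / 2) * starRingEnd ℂ (fderiv ℂ Φ z (Pi.single i 1) a) * dzbar a f (Φ z)) * Complex.I_sq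

theorem dz_conj (hf : DifferentiableAt ℝ f z) (i : Fin n) :
    dz i (fun y => starRingEnd ℂ (f y)) z = starRingEnd ℂ (dzbar i f z) := by
  have h : fderiv ℝ (fun y => starRingEnd ℂ (f y)) z =
      (Complex.conjCLE : ℂ →L[ℝ] ℂ).comp (fderiv ℝ f z) :=
    ((Complex.conjCLE : ℂ →L[ℝ] ℂ).hasFDerivAt.comp z hf.hasFDerivAt).fderiv
  simp [dz, dzbar, h, sub_eq_add_neg, Complex.conj_ofNat]

theorem dzbar_conj (hf : DifferentiableAt ℝ f z) (i : Fin n) :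
    dzbar i (fun y => starRingEnd ℂ (f y)) z = starRingEnd ℂ (dz i f z) := by
  have h : fderiv ℝ (fun y => starRingEnd ℂ (f y)) z =
      (Complex.conjCLE : ℂ →L[ℝ] ℂ).comp (fderiv ℝ f z) :=
    ((Complex.conjCLE : ℂ →L[ℝ] ℂ).hasFDerivAt.comp z hf.hasFDerivAt).fderiv
  simp [dz, dzbar, h, sub_eq_add_neg, Complex.conj_ofNat]

theorem dzbar_ofReal {u : Cn n → ℝ} (hu : DifferentiableAt ℝ (fun y => (u y : ℂ)) z) (i : Fin n) :
    dzbar i (fun y => (u y : ℂ)) z = starRingEnd ℂ (dz i (fun y => (u y : ℂ)) z) := by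
  rw [← dzbar_conj hu]
  simp

theorem dzbar_holomorphic (hf : DifferentiableAt ℂ f z) (i : Fin n) : dzbar i f z = 0 := by
  have hI : (Pi.single i Complex.I : Cn n) = Complex.I • Pi.single i 1 := by
    rw [← Pi.single_smul]; simp
  simp only [dzbar, hf.fderiv_restrictScalars ℝ, ContinuousLinearMap.coe_restrictScalars', hI,
    map_smul, smul_eq_mul]
  linear_combination (1 / 2) * fderiv ℂ f z (Pi.single i 1) * Complex.I_sq

theorem fderiv_ofReal_comp {u : Cn n → ℝ} {h : ℝ → ℝ} {h' : ℝ} (hu : DifferentiableAt ℝ u z)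
    (hh : HasDerivAt h h' (u z)) (v : Cn n) :
    fderiv ℝ (fun y => ((h (u y) : ℝ) : ℂ)) z v = h' * fderiv ℝ (fun y => (u y : ℂ)) z v := by
  have h1 : HasFDerivAt (fun y => (u y : ℂ)) (Complex.ofRealCLM.comp (fderiv ℝ u z)) z :=
    Complex.ofRealCLM.hasFDerivAt.comp z hu.hasFDerivAt
  have h2 : HasFDerivAt (fun y => ((h (u y) : ℝ) : ℂ))
      (Complex.ofRealCLM.comp (h' • fderiv ℝ u z)) z :=
    Complex.ofRealCLM.hasFDerivAt.comp z (hh.comp_hasFDerivAt z hu.hasFDerivAt)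
  rw [h1.fderiv, h2.fderiv]
  simp

theorem dz_ofReal_comp {u : Cn n → ℝ} {h : ℝ → ℝ} {h' : ℝ} (hu : DifferentiableAt ℝ u z)
    (hh : HasDerivAt h h' (u z)) (i : Fin n) :
    dz i (fun y => ((h (u y) : ℝ) : ℂ)) z = h' * dz i (fun y => (u y : ℂ)) z := by
  simp only [dz, fderiv_ofReal_comp hu hh]
  ring

theorem dzbar_ofReal_comp {u : Cn n → ℝ} {h : ℝ → ℝ} {h' : ℝ} (hu : DifferentiableAt ℝ u z)
    (hh : HasDerivAt h h' (u z)) (i : Fin n) :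
    dzbar i (fun y => ((h (u y) : ℝ) : ℂ)) z = h' * dzbar i (fun y => (u y : ℂ)) z := by
  simp only [dzbar, fderiv_ofReal_comp hu hh]
  ring

theorem contDiffOn_fderiv_apply {s : Set (Cn n)} {m k : WithTop ℕ∞} (hs : IsOpen s)
    (hf : ContDiffOn ℝ k f s) (hmk : m + 1 ≤ k) (v : Cn n) :
    ContDiffOn ℝ m (fun y => fderiv ℝ f y v) s :=
  (hf.fderiv_of_isOpen hs hmk).clm_apply contDiffOn_const

theorem contDiffOn_dz {s : Set (Cn n)} {m k : WithTop ℕ∞} (hs : IsOpen s)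
    (hf : ContDiffOn ℝ k f s) (hmk : m + 1 ≤ k) (i : Fin n) : ContDiffOn ℝ m (dz i f) s :=
  contDiffOn_const.mul ((contDiffOn_fderiv_apply hs hf hmk _).sub
    (contDiffOn_const.mul (contDiffOn_fderiv_apply hs hf hmk _)))

theorem contDiffOn_dzbar {s : Set (Cn n)} {m k : WithTop ℕ∞} (hs : IsOpen s)
    (hf : ContDiffOn ℝ k f s) (hmk : m + 1 ≤ k) (i : Fin n) : ContDiffOn ℝ m (dzbar i f) s :=
  contDiffOn_const.mul ((contDiffOn_fderiv_apply hs hf hmk _).add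
    (contDiffOn_const.mul (contDiffOn_fderiv_apply hs hf hmk _)))

theorem continuousOn_ddbar {s : Set (Cn n)} (hs : IsOpen s)
    (hf : ContDiffOn ℝ 2 f s) (i j : Fin n) : ContinuousOn (ddbar i j f) s :=
  (contDiffOn_dz (m := 0) hs (contDiffOn_dzbar (m := 1) hs hf (by norm_num) j)
    (by norm_num) i).continuousOn

theorem ddbar_mul {s : Set (Cn n)} (hs : IsOpen s) (hf : ContDiffOn ℝ 2 f s)
    (hg : ContDiffOn ℝ 2 g s) (hz : z ∈ s) (i j : Fin n) :
    ddbar i j (fun y => f y * g y) z = ddbar i j f z * g z + dzbar j f z * dz i g z +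
      dz i f z * dzbar j g z + f z * ddbar i j g z := by
  have hf1 : ∀ y ∈ s, DifferentiableAt ℝ f y := fun y hy =>
    (hf.differentiableOn (by norm_num)).differentiableAt (hs.mem_nhds hy)
  have hg1 : ∀ y ∈ s, DifferentiableAt ℝ g y := fun y hy =>
    (hg.differentiableOn (by norm_num)).differentiableAt (hs.mem_nhds hy)
  have hf2 : DifferentiableAt ℝ (dzbar j f) z :=
    ((contDiffOn_dzbar (m := 1) hs hf (by norm_num) j).differentiableOn
      (by norm_num)).differentiableAt (hs.mem_nhds hz)
  have hg2 : DifferentiableAt ℝ (dzbar j g) z :=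
    ((contDiffOn_dzbar (m := 1) hs hg (by norm_num) j).differentiableOn
      (by norm_num)).differentiableAt (hs.mem_nhds hz)
  have h : dzbar j (fun y => f y * g y) =ᶠ[𝓝 z]
      fun y => dzbar j f y * g y + f y * dzbar j g y :=
    Filter.eventually_of_mem (hs.mem_nhds hz) fun y hy => dzbar_mul (hf1 y hy) (hg1 y hy) j
  unfold ddbar
  rw [dz_congr h, dz_add (hf2.fun_mul (hg1 z hz)) ((hf1 z hz).fun_mul hg2), dz_mul hf2 (hg1 z hz),
    dz_mul (hf1 z hz) hg2]
  ring

theorem ddbar_ofReal_comp {s : Set (Cn n)} (hs : IsOpen s) {u : Cn n → ℝ} {h h' h'' : ℝ → ℝ}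
    (hu : ContDiffOn ℝ 2 (fun y => (u y : ℂ)) s)
    (hh : ∀ y ∈ s, HasDerivAt h (h' (u y)) (u y))
    (hh' : ∀ y ∈ s, HasDerivAt h' (h'' (u y)) (u y)) (hz : z ∈ s) (i j : Fin n) :
    ddbar i j (fun y => ((h (u y) : ℝ) : ℂ)) z = h' (u z) * ddbar i j (fun y => (u y : ℂ)) z +
      h'' (u z) * dz i (fun y => (u y : ℂ)) z *
        starRingEnd ℂ (dz j (fun y => (u y : ℂ)) z) := by
  have hu1 : ∀ y ∈ s, DifferentiableAt ℝ (fun y => (u y : ℂ)) y := fun y hy =>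
    (hu.differentiableOn (by norm_num)).differentiableAt (hs.mem_nhds hy)
  have hu0 : ∀ y ∈ s, DifferentiableAt ℝ u y := fun y hy => by
    have h := Complex.reCLM.differentiableAt.comp y (hu1 y hy)
    exact h
  have hu2 : DifferentiableAt ℝ (dzbar j (fun y => (u y : ℂ))) z :=
    ((contDiffOn_dzbar (m := 1) hs hu (by norm_num) j).differentiableOn
      (by norm_num)).differentiableAt (hs.mem_nhds hz)
  have hd : DifferentiableAt ℝ (fun y => ((h' (u y) : ℝ) : ℂ)) z :=
    Complex.ofRealCLM.differentiableAt.comp z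
      ((hh' z hz).differentiableAt.comp z (hu0 z hz))
  have he : dzbar j (fun y => ((h (u y) : ℝ) : ℂ)) =ᶠ[𝓝 z]
      fun y => ((h' (u y) : ℝ) : ℂ) * dzbar j (fun y => (u y : ℂ)) y :=
    Filter.eventually_of_mem (hs.mem_nhds hz) fun y hy => dzbar_ofReal_comp (hu0 y hy) (hh y hy) j
  unfold ddbar
  rw [dz_congr he, dz_mul hd hu2, dz_ofReal_comp (hu0 z hz) (hh' z hz), dzbar_ofReal (hu1 z hz)]
  ring

/-- After the chain rule for ∂̄, the conjugate Jacobian is antiholomorphic and is killed by ∂. No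
second derivative of Φ appears, which is why ∂∂̄f transforms as a (1,1)-form. -/
theorem ddbar_comp {Φ : Cn n → Cn n} {s t : Set (Cn n)} (hs : IsOpen s) (ht : IsOpen t)
    (hf : ContDiffOn ℝ 2 f t) (hΦ : ContDiffOn ℂ 2 Φ s) (hst : MapsTo Φ s t) (hz : z ∈ s)
    (i j : Fin n) :
    ddbar i j (fun y => f (Φ y)) z = ∑ a, ∑ b, fderiv ℂ Φ z (Pi.single i 1) a *
      starRingEnd ℂ (fderiv ℂ Φ z (Pi.single j 1) b) * ddbar a b f (Φ z) := by
  have hf1 : ∀ y ∈ t, DifferentiableAt ℝ f y := fun y hy =>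
    (hf.differentiableOn (by norm_num)).differentiableAt (ht.mem_nhds hy)
  have hΦ1 : ∀ y ∈ s, DifferentiableAt ℂ Φ y := fun y hy =>
    (hΦ.differentiableOn (by norm_num)).differentiableAt (hs.mem_nhds hy)
  have hf2 : ∀ b, DifferentiableAt ℝ (dzbar b f) (Φ z) := fun b =>
    ((contDiffOn_dzbar (m := 1) ht hf (by norm_num) b).differentiableOn
      (by norm_num)).differentiableAt (ht.mem_nhds (hst hz))
  have hJ : ∀ b, DifferentiableAt ℂ (fun y => fderiv ℂ Φ y (Pi.single j 1) b) z := fun b =>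
    differentiableAt_pi.1 ((((hΦ.fderiv_of_isOpen (m := 1) hs (by norm_num)).clm_apply
      contDiffOn_const).differentiableOn (by norm_num)).differentiableAt (hs.mem_nhds hz)) b
  have hJ' : ∀ b, DifferentiableAt ℝ
      (fun y => starRingEnd ℂ (fderiv ℂ Φ y (Pi.single j 1) b)) z := fun b =>
    Complex.conjCLE.differentiableAt.comp z ((hJ b).restrictScalars ℝ)
  have hfΦ : ∀ b, DifferentiableAt ℝ (fun y => dzbar b f (Φ y)) z := fun b =>
    (hf2 b).comp z ((hΦ1 z hz).restrictScalars ℝ)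
  have he : dzbar j (fun y => f (Φ y)) =ᶠ[𝓝 z] fun y =>
      ∑ b, starRingEnd ℂ (fderiv ℂ Φ y (Pi.single j 1) b) * dzbar b f (Φ y) :=
    Filter.eventually_of_mem (hs.mem_nhds hz) fun y hy =>
      dzbar_comp (hf1 _ (hst hy)) (hΦ1 y hy) j
  unfold ddbar
  rw [dz_congr he, dz_sum _ fun b _ => (hJ' b).fun_mul (hfΦ b), Finset.sum_comm]
  refine Finset.sum_congr rfl fun b _ => ?_
  rw [dz_mul (hJ' b) (hfΦ b), dz_conj ((hJ b).restrictScalars ℝ), dzbar_holomorphic (hJ b),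
    dz_comp (hf2 b) (hΦ1 z hz), map_zero, zero_mul, zero_add, Finset.mul_sum]
  exact Finset.sum_congr rfl fun a _ => by ring

/-- Integration by parts against the constant function 1. -/
theorem integral_fderiv_apply_eq_zero (hf : ContDiff ℝ 1 f) (hc : HasCompactSupport f)
    (v : Cn n) : ∫ z, fderiv ℝ f z v = 0 := by
  have h1 : Integrable (fun z => fderiv ℝ f z v) :=
    ((hf.continuous_fderiv (by norm_num)).clm_apply
      continuous_const).integrable_of_hasCompactSupport (hc.fderiv_apply ℝ v)
  have := integral_mul_fderiv_eq_neg_fderiv_mul_of_integrable (𝕜 := ℂ) (f := fun _ => (1 : ℂ))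
    (g := f) (v := v) (μ := volume) (by simp) (by simpa using h1)
    (by simpa using hf.continuous.integrable_of_hasCompactSupport hc) (fun x _ => by fun_prop)
    (fun x _ => (hf.differentiable (by norm_num)) x)
  simpa using this

theorem integral_dz_eq_zero (hf : ContDiff ℝ 1 f) (hc : HasCompactSupport f) (i : Fin n) :
    ∫ z, dz i f z = 0 := by
  have h : ∀ v : Cn n, Integrable (fun z => fderiv ℝ f z v) := fun v =>
    ((hf.continuous_fderiv (by norm_num)).clm_apply
      continuous_const).integrable_of_hasCompactSupport (hc.fderiv_apply ℝ v)
  unfold dz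
  rw [integral_const_mul, integral_sub (h _) ((h _).const_mul _), integral_const_mul,
    integral_fderiv_apply_eq_zero hf hc, integral_fderiv_apply_eq_zero hf hc]
  simp

end WirtingerCalculus

end KahlerCone

namespace KahlerCone

/-! ### Derivatives of determinants and the divergence of the adjugate -/

section AdjugateDivergence

variable {n : ℕ}

theorem contDiffOn_det {s : Set (Cn n)} {m : WithTop ℕ∞} {G : Cn n → Matrix (Fin n) (Fin n) ℂ}
    (hG : ∀ i j, ContDiffOn ℝ m (fun z => G z i j) s) :
    ContDiffOn ℝ m (fun z => (G z).det) s := by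
  simp only [Matrix.det_apply, Units.smul_def, zsmul_eq_mul]
  exact ContDiffOn.sum fun σ _ => contDiffOn_const.mul (contDiffOn_prod fun i _ => hG _ _)

theorem contDiffOn_adjugate {s : Set (Cn n)} {m : WithTop ℕ∞}
    {G : Cn n → Matrix (Fin n) (Fin n) ℂ} (hG : ∀ i j, ContDiffOn ℝ m (fun z => G z i j) s)
    (i j : Fin n) : ContDiffOn ℝ m (fun z => (G z).adjugate i j) s := by
  simp only [Matrix.adjugate_apply]
  refine contDiffOn_det fun a b => ?_
  simp only [Matrix.updateRow_apply]
  split_ifs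
  · exact contDiffOn_const
  · exact hG a b

/-- Jacobi's formula. The determinant is multilinear in the rows, and Cramer's rule expands the
determinant with one row replaced by its derivative into entries of the adjugate. -/
theorem fderiv_det {G : Cn n → Matrix (Fin n) (Fin n) ℂ} {z : Cn n}
    (hG : ∀ i j, DifferentiableAt ℝ (fun z => G z i j) z) (v : Cn n) :
    fderiv ℝ (fun y => (G y).det) z v =
      ∑ a, ∑ b, (G z).adjugate b a * fderiv ℝ (fun y => G y a b) z v := by
  let L : ContinuousMultilinearMap ℂ (fun _ : Fin n => Fin n → ℂ) ℂ :=
    { (Matrix.detRowAlternating : (Fin n → ℂ) [⋀^Fin n]→ₗ[ℂ] ℂ).toMultilinearMap with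
      cont := (continuous_id (X := Matrix (Fin n) (Fin n) ℂ)).matrix_det }
  have hG' : HasFDerivAt (fun y => (fun a b => G y a b : Fin n → Fin n → ℂ))
      (ContinuousLinearMap.pi fun a => ContinuousLinearMap.pi fun b =>
        fderiv ℝ (fun y => G y a b) z) z :=
    hasFDerivAt_pi.2 fun a => hasFDerivAt_pi.2 fun b => (hG a b).hasFDerivAt
  have h := ((L.hasFDerivAt (x := fun a b => G z a b)).restrictScalars ℝ).comp z hG'
  have h2 : fderiv ℝ (fun y => (G y).det) z = _ := h.fderiv
  rw [h2]
  simp only [ContinuousLinearMap.comp_apply, ContinuousLinearMap.coe_restrictScalars',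
    ContinuousMultilinearMap.linearDeriv_apply]
  refine Finset.sum_congr rfl fun a _ => ?_
  have h3 := Matrix.cramer_transpose_apply (A := G z)
    (b := fun b => fderiv ℝ (fun y => G y a b) z v) a
  rw [Matrix.cramer_eq_adjugate_mulVec, ← Matrix.adjugate_transpose] at h3
  exact h3.symm

theorem dz_det {G : Cn n → Matrix (Fin n) (Fin n) ℂ} {z : Cn n}
    (hG : ∀ i j, DifferentiableAt ℝ (fun z => G z i j) z) (i : Fin n) :
    dz i (fun y => (G y).det) z =
      ∑ a, ∑ b, (G z).adjugate b a * dz i (fun y => G y a b) z := by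
  simp only [dz, fderiv_det hG, Finset.mul_sum, ← Finset.sum_sub_distrib]
  exact Finset.sum_congr rfl fun a _ => Finset.sum_congr rfl fun b _ => by ring

/-- For a Kähler form the adjugate of the coefficient matrix is divergence free. -/
theorem sum_dz_adjugate_eq_zero {s : Set (Cn n)} (hs : IsOpen s)
    {G : Cn n → Matrix (Fin n) (Fin n) ℂ} (hG : ∀ i j, ContDiffOn ℝ 1 (fun z => G z i j) s)
    {z : Cn n} (hz : z ∈ s) (hdet : (G z).det ≠ 0)
    (hcl : ∀ i j l, dz l (fun y => G y i j) z = dz i (fun y => G y l j) z) (j : Fin n) :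
    ∑ i, dz i (fun y => (G y).adjugate j i) z = 0 := by
  have hd : ∀ {f : Cn n → ℂ}, ContDiffOn ℝ 1 f s → DifferentiableAt ℝ f z := fun hf =>
    (hf.differentiableOn (by norm_num)).differentiableAt (hs.mem_nhds hz)
  have hGd := fun i j => hd (hG i j)
  have hAd := fun i j => hd (contDiffOn_adjugate hG i j)
  have hDd := hd (contDiffOn_det hG)
  -- This differentiates the identity adj(G)·G = det(G)·1 entrywise. Multiplying by adj(G) on the
  -- right then isolates det(G) times the divergence.
  have key : ∀ i b, ∑ a, dz i (fun y => (G y).adjugate j a) z * G z a b =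
      dz i (fun y => (G y).det) z * (1 : Matrix (Fin n) (Fin n) ℂ) j b -
        ∑ a, (G z).adjugate j a * dz i (fun y => G y a b) z := by
    intro i b
    have h : (fun y => ∑ a, (G y).adjugate j a * G y a b) =
        fun y => (G y).det * (1 : Matrix (Fin n) (Fin n) ℂ) j b := by
      funext y
      have := congrFun (congrFun (Matrix.adjugate_mul (G y)) j) b
      simpa [Matrix.mul_apply] using this
    have h2 := congrArg (fun f => dz i f z) h
    beta_reduce at h2
    rw [dz_sum _ fun a _ => (hAd j a).fun_mul (hGd a b),
      dz_mul hDd (differentiableAt_const _), dz_const, mul_zero, add_zero] at h2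
    rw [← h2, ← Finset.sum_sub_distrib]
    exact Finset.sum_congr rfl fun a _ => by rw [dz_mul (hAd j a) (hGd a b)]; ring
  have hinv : ∀ a i, ∑ b, G z a b * (G z).adjugate b i =
      (G z).det * (1 : Matrix (Fin n) (Fin n) ℂ) a i := by
    intro a i
    have := congrFun (congrFun (Matrix.mul_adjugate (G z)) a) i
    simpa [Matrix.mul_apply] using this
  have h1 : (G z).det * ∑ i, dz i (fun y => (G y).adjugate j i) z =
      ∑ i, ∑ b, (∑ a, dz i (fun y => (G y).adjugate j a) z * G z a b) *
        (G z).adjugate b i := by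
    rw [Finset.mul_sum]
    refine Finset.sum_congr rfl fun i _ => ?_
    simp only [Finset.sum_mul]
    rw [Finset.sum_comm]
    simp only [mul_assoc, ← Finset.mul_sum, hinv]
    simp [Matrix.one_apply, mul_comm]
  have h2 : ∑ i, ∑ b, dz i (fun y => (G y).det) z * (1 : Matrix (Fin n) (Fin n) ℂ) j b *
      (G z).adjugate b i = ∑ i, dz i (fun y => (G y).det) z * (G z).adjugate j i := by
    refine Finset.sum_congr rfl fun i _ => ?_
    simp [Matrix.one_apply]
  -- Closedness exchanges the differentiation index with the row index of G; Jacobi's formula then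
  -- recognises the derivative of det G. The result equals the other term, so the two cancel.
  have h3 : ∑ i, ∑ b, (∑ a, (G z).adjugate j a * dz i (fun y => G y a b) z) *
      (G z).adjugate b i = ∑ i, dz i (fun y => (G y).det) z * (G z).adjugate j i := by
    simp only [Finset.sum_mul]
    have : ∀ i : Fin n, ∑ b, ∑ a, (G z).adjugate j a * dz i (fun y => G y a b) z *
        (G z).adjugate b i = ∑ a, ∑ b, (G z).adjugate j a * dz a (fun y => G y i b) z *
        (G z).adjugate b i := by
      intro i
      rw [Finset.sum_comm]
      exact Finset.sum_congr rfl fun a _ => Finset.sum_congr rfl fun b _ => by rw [hcl a b i]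
    rw [Finset.sum_congr rfl fun i _ => this i, Finset.sum_comm]
    refine Finset.sum_congr rfl fun a _ => ?_
    rw [dz_det hGd, Finset.sum_mul]
    refine Finset.sum_congr rfl fun i _ => ?_
    rw [Finset.sum_mul]
    exact Finset.sum_congr rfl fun b _ => by ring
  have h4 : (G z).det * ∑ i, dz i (fun y => (G y).adjugate j i) z = 0 := by
    rw [h1]
    simp only [key, sub_mul, Finset.sum_sub_distrib]
    rw [h2, h3, sub_self]
  exact (mul_eq_zero.1 h4).resolve_left hdet

end AdjugateDivergence

/-! ### Weights of the cone frame and integrability of powers of |z_k| -/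

section WeightBounds

variable {n : ℕ} {β : ℝ} {k : Fin n}

theorem coneWeight_self (β : ℝ) (k : Fin n) (z : Cn n) :
    coneWeight β k k z = ((‖z k‖ ^ (1 - β) : ℝ) : ℂ) := by simp [coneWeight]

theorem coneWeight_of_ne {i : Fin n} (h : i ≠ k) (z : Cn n) : coneWeight β k i z = 1 := by
  simp [coneWeight, h]

theorem coneWeight_ne_zero {z : Cn n} (hz : z k ≠ 0) (i : Fin n) : coneWeight β k i z ≠ 0 := by
  unfold coneWeight
  split_ifs
  · exact_mod_cast (Real.rpow_pos_of_pos (norm_pos_iff.2 hz) _).ne'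
  · exact one_ne_zero

theorem prod_coneWeight (z : Cn n) : ∏ i, coneWeight β k i z = coneWeight β k k z := by
  rw [Finset.prod_eq_single k]
  · intro b _ hb
    exact coneWeight_of_ne hb z
  · simp

/-- The coefficients of a `(1,1)`-form in the cone frame. -/
noncomputable def frameMatrix (β : ℝ) (k : Fin n) (z : Cn n) (M : Matrix (Fin n) (Fin n) ℂ) :
    Matrix (Fin n) (Fin n) ℂ :=
  Matrix.of fun i j => coneWeight β k i z * coneWeight β k j z * M i j

theorem frameMatrix_eq (z : Cn n) (M : Matrix (Fin n) (Fin n) ℂ) :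
    frameMatrix β k z M = Matrix.diagonal (fun i => coneWeight β k i z) * M *
      Matrix.diagonal (fun i => coneWeight β k i z) := by
  ext i j
  rw [Matrix.mul_diagonal, Matrix.diagonal_mul]
  simp only [frameMatrix, Matrix.of_apply]
  ring

theorem det_frameMatrix (z : Cn n) (M : Matrix (Fin n) (Fin n) ℂ) :
    (frameMatrix β k z M).det = coneWeight β k k z ^ 2 * M.det := by
  rw [frameMatrix_eq, Matrix.det_mul, Matrix.det_mul, Matrix.det_diagonal, prod_coneWeight]
  ring

/-- The adjugate of the diagonal weight matrix has i-th entry equal to the product of the other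
weights, so its product with the i-th weight is the k-th weight, the only nontrivial one. Keeping
the weights as factors avoids any division. -/
theorem adjugate_frameMatrix (z : Cn n) (M : Matrix (Fin n) (Fin n) ℂ)
    (i j : Fin n) :
    coneWeight β k i z * coneWeight β k j z * (frameMatrix β k z M).adjugate i j =
      coneWeight β k k z ^ 2 * M.adjugate i j := by
  have h : ∀ i, coneWeight β k i z *
      (Matrix.diagonal (fun i => coneWeight β k i z)).adjugate i i = coneWeight β k k z := by
    intro i
    have := congrFun (congrFun (Matrix.mul_adjugate
      (Matrix.diagonal (fun i => coneWeight β k i z))) i) i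
    rw [Matrix.diagonal_mul, Matrix.det_diagonal, prod_coneWeight] at this
    simpa using this
  rw [frameMatrix_eq, Matrix.adjugate_mul_distrib, Matrix.adjugate_mul_distrib]
  simp only [Matrix.adjugate_diagonal] at h ⊢
  rw [Matrix.diagonal_mul, Matrix.mul_diagonal]
  have hi := h i
  have hj := h j
  simp only [Matrix.diagonal_apply_eq] at hi hj
  linear_combination (coneWeight β k j z *
    (∏ l ∈ Finset.univ.erase j, coneWeight β k l z) * M.adjugate i j) * hi +
      coneWeight β k k z * M.adjugate i j * hj

variable (n) in
-- The matrices with entries bounded by N form a compact set, on which the determinant and the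
-- adjugate are continuous.
theorem exists_det_adjugate_bound (N : ℝ) : ∃ C : ℝ, 0 ≤ C ∧
    ∀ M : Matrix (Fin n) (Fin n) ℂ, (∀ i j, ‖M i j‖ ≤ N) →
      ‖M.det‖ ≤ C ∧ ∀ i j, ‖M.adjugate i j‖ ≤ C := by
  have hK : IsCompact {M : Matrix (Fin n) (Fin n) ℂ | ∀ i j, ‖M i j‖ ≤ N} := by
    have h := isCompact_univ_pi fun _ : Fin n => isCompact_univ_pi fun _ : Fin n =>
      isCompact_closedBall (0 : ℂ) N
    convert! h using 1
    ext M
    exact ⟨fun h i _ j _ => mem_closedBall_zero_iff.2 (h i j),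
      fun h i j => mem_closedBall_zero_iff.1 (h i trivial j trivial)⟩
  obtain ⟨C₁, h₁⟩ := hK.exists_bound_of_continuousOn
    (f := fun M => M.det) (continuous_id.matrix_det).continuousOn
  have h₂ : ∀ i j : Fin n, ∃ C, ∀ M ∈ {M : Matrix (Fin n) (Fin n) ℂ | ∀ i j, ‖M i j‖ ≤ N},
      ‖M.adjugate i j‖ ≤ C := fun i j => hK.exists_bound_of_continuousOn
    (f := fun M => M.adjugate i j)
    ((continuous_id.matrix_adjugate).matrix_elem i j).continuousOn
  choose C₂ h₂ using h₂
  refine ⟨|C₁| + ∑ i, ∑ j, |C₂ i j|, by positivity, fun M hM => ⟨?_, fun i j => ?_⟩⟩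
  · have : 0 ≤ ∑ i, ∑ j, |C₂ i j| := by positivity
    linarith [h₁ M hM, le_abs_self C₁]
  · have h3 : |C₂ i j| ≤ ∑ i, ∑ j, |C₂ i j| :=
      (Finset.single_le_sum (f := fun j => |C₂ i j|) (fun _ _ => abs_nonneg _)
        (Finset.mem_univ j)).trans
      (Finset.single_le_sum (f := fun i => ∑ j, |C₂ i j|)
        (fun _ _ => Finset.sum_nonneg fun _ _ => abs_nonneg _) (Finset.mem_univ i))
    linarith [h₂ i j M hM, le_abs_self (C₂ i j), abs_nonneg C₁]

theorem norm_coneWeight_self (z : Cn n) : ‖coneWeight β k k z‖ = ‖z k‖ ^ (1 - β) := by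
  rw [coneWeight_self, Complex.norm_real, Real.norm_of_nonneg (by positivity)]

theorem norm_coneWeight_self_inv (z : Cn n) :
    ‖coneWeight β k k z‖⁻¹ = ‖z k‖ ^ (β - 1) := by
  rw [norm_coneWeight_self, ← Real.rpow_neg (norm_nonneg _), neg_sub]

theorem norm_coneWeight_self_sq_inv (z : Cn n) :
    (‖coneWeight β k k z‖ ^ 2)⁻¹ = ‖z k‖ ^ (2 * β - 2) := by
  rw [← inv_pow, norm_coneWeight_self_inv, ← Real.rpow_natCast, ← Real.rpow_mul (norm_nonneg _)]
  congr 1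
  push_cast
  ring

theorem measure_coord_eq_zero (k : Fin n) : volume {z : Cn n | z k = 0} = 0 :=
  Measure.pi_hyperplane (fun _ : Fin n => (volume : Measure ℂ)) k 0

/-- The threshold -2 is minus the real dimension of the z_k-line; the other coordinates contribute
bounded factors by Fubini on a product of discs. -/
theorem integrableOn_norm_coord_rpow {s : ℝ} (hs : -2 < s) (k : Fin n) {K : Set (Cn n)}
    (hK : Bornology.IsBounded K) : IntegrableOn (fun z => ‖z k‖ ^ s) K := by
  obtain ⟨R, hR⟩ := hK.subset_closedBall 0
  set B : Set ℂ := Metric.closedBall 0 R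
  have h1 : LocallyIntegrable (fun x : ℂ => ‖x‖ ^ s) := by
    refine locallyIntegrable_of_norm_le_rpow (C := 1) (α := -s) ?_ ?_ ?_ ?_
    · simp [Complex.finrank_real_complex]
    · rw [Complex.finrank_real_complex]; push_cast; linarith
    · refine ae_of_all _ fun x => ?_
      rw [neg_neg, one_mul, Real.norm_of_nonneg (by positivity)]
    · exact (measurable_norm.pow_const s).aestronglyMeasurable
  have h2 : ∀ i : Fin n, Integrable
      (B.indicator fun x : ℂ => if i = k then ‖x‖ ^ s else (1 : ℝ)) := by
    intro i
    rw [integrable_indicator_iff Metric.isClosed_closedBall.measurableSet]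
    split_ifs
    · exact h1.integrableOn_isCompact (isCompact_closedBall _ _)
    · exact continuous_const.locallyIntegrable.integrableOn_isCompact (isCompact_closedBall _ _)
  have h3 := Integrable.fintype_prod (μ := fun _ => volume) h2
  refine (IntegrableOn.congr_fun h3.integrableOn (fun z hz => ?_)
    Metric.isClosed_closedBall.measurableSet).mono_set hR
  have hzB : ∀ i, z i ∈ B := fun i => by
    rw [mem_closedBall_zero_iff] at hz ⊢
    exact (norm_le_pi_norm z i).trans hz
  rw [Finset.prod_eq_single k]
  · rw [indicator_of_mem (hzB k), if_pos rfl]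
  · intro i _ hi
    rw [indicator_of_mem (hzB i), if_neg hi]
  · simp

end WeightBounds

end KahlerCone

namespace KahlerCone

/-! ### Stokes' theorem in a divisor chart -/

section LocalStokes

variable {n : ℕ} {β : ℝ} {k : Fin n}

theorem deriv_smoothTransition_eq_zero {x : ℝ} (hx : x < 0 ∨ 1 < x) :
    deriv Real.smoothTransition x = 0 := by
  rcases hx with hx | hx
  · have : Real.smoothTransition =ᶠ[𝓝 x] fun _ => 0 :=
      Filter.eventually_of_mem (Iio_mem_nhds hx) fun y hy =>
        Real.smoothTransition.zero_of_nonpos (le_of_lt hy)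
    rw [this.deriv_eq, deriv_const]
  · have : Real.smoothTransition =ᶠ[𝓝 x] fun _ => 1 :=
      Filter.eventually_of_mem (Ioi_mem_nhds hx) fun y hy =>
        Real.smoothTransition.one_of_one_le (le_of_lt hy)
    rw [this.deriv_eq, deriv_const]

theorem exists_deriv_smoothTransition_bound :
    ∃ C : ℝ, 0 ≤ C ∧ ∀ x, |deriv Real.smoothTransition x| ≤ C := by
  have hc : Continuous (deriv Real.smoothTransition) :=
    (Real.smoothTransition.contDiff (n := 1)).continuous_deriv (by norm_num)
  obtain ⟨C, hC⟩ := (isCompact_Icc (a := (0 : ℝ)) (b := 1)).exists_bound_of_continuousOn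
    hc.continuousOn
  refine ⟨|C|, abs_nonneg C, fun x => ?_⟩
  by_cases hx : x ∈ Icc (0 : ℝ) 1
  · exact (hC x hx).trans (le_abs_self C)
  · rw [deriv_smoothTransition_eq_zero, abs_zero]
    · exact abs_nonneg C
    · rw [mem_Icc, not_and_or, not_le, not_le] at hx
      exact hx

theorem ddbar_const (i j : Fin n) (c : ℂ) (z : Cn n) : ddbar i j (fun _ => c) z = 0 := by
  have h : dzbar j (fun _ : Cn n => c) = fun _ => 0 := funext fun y => dzbar_const j c y
  rw [ddbar, h, dz_const]

theorem dz_coord (i k : Fin n) (z : Cn n) :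
    dz i (fun y => y k) z = if i = k then 1 else 0 := by
  have h : ∀ v : Cn n, fderiv ℝ (fun y : Cn n => y k) z v = v k := fun v => by
    rw [(hasFDerivAt_apply k z).fderiv]
    rfl
  simp only [dz, h]
  split_ifs with hik
  · subst hik
    simp
    norm_num
  · rw [Pi.single_eq_of_ne (Ne.symm hik), Pi.single_eq_of_ne (Ne.symm hik)]
    simp

theorem dz_norm_sq_coord (i k : Fin n) (z : Cn n) :
    dz i (fun y => ((‖y k‖ ^ 2 : ℝ) : ℂ)) z = if i = k then starRingEnd ℂ (z k) else 0 := by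
  have h : (fun y : Cn n => ((‖y k‖ ^ 2 : ℝ) : ℂ)) = fun y => y k * starRingEnd ℂ (y k) := by
    funext y
    rw [Complex.mul_conj, Complex.normSq_eq_norm_sq]
  have hd : DifferentiableAt ℂ (fun y : Cn n => y k) z := by fun_prop
  have hd' : DifferentiableAt ℝ (fun y : Cn n => starRingEnd ℂ (y k)) z :=
    Complex.conjCLE.differentiableAt.comp z (hd.restrictScalars ℝ)
  rw [h, dz_mul (hd.restrictScalars ℝ) hd', dz_coord,
    dz_conj (hd.restrictScalars ℝ), dzbar_holomorphic hd]
  split_ifs <;> simp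

/-- Cutoff functions that vanish near the hyperplane `z_k = 0` and tend to `1` away from it. -/
theorem exists_cutoff (k : Fin n) : ∃ (C : ℝ) (χ : ℕ → Cn n → ℂ), 0 ≤ C ∧
    (∀ m, ContDiff ℝ 1 (χ m)) ∧ (∀ m z, z k = 0 → χ m =ᶠ[𝓝 z] fun _ => 0) ∧
    (∀ z, z k ≠ 0 → ∀ᶠ m in atTop, χ m =ᶠ[𝓝 z] fun _ => 1) ∧ (∀ m z, ‖χ m z‖ ≤ 1) ∧
    (∀ m z i, i ≠ k → dz i (χ m) z = 0) ∧
    ∀ m z, z k ≠ 0 → ‖dz k (χ m) z‖ ≤ C * ‖z k‖⁻¹ := by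
  obtain ⟨C, hC0, hC⟩ := exists_deriv_smoothTransition_bound
  -- Evaluated at |z_k|², this vanishes for (m+1)|z_k| ≤ 1 and equals 1 once (m+1)²|z_k|² ≥ 2.
  let h : ℕ → ℝ → ℝ := fun m x => Real.smoothTransition ((m + 1 : ℝ) ^ 2 * x - 1)
  have hh : ∀ m x, HasDerivAt (h m)
      (deriv Real.smoothTransition ((m + 1 : ℝ) ^ 2 * x - 1) * (m + 1 : ℝ) ^ 2) x := by
    intro m x
    have h1 : HasDerivAt (fun x : ℝ => (m + 1 : ℝ) ^ 2 * x - 1) ((m + 1 : ℝ) ^ 2) x := by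
      simpa using ((hasDerivAt_id x).const_mul ((m + 1 : ℝ) ^ 2)).sub_const 1
    exact ((Real.smoothTransition.contDiff (n := 1)).differentiable
      (by norm_num) _).hasDerivAt.comp x h1
  have hu : ContDiff ℝ 1 (fun z : Cn n => ‖z k‖ ^ 2) := (contDiff_apply ℝ ℂ k).norm_sq ℝ
  have hdz : ∀ m z i, dz i (fun y => ((h m (‖y k‖ ^ 2) : ℝ) : ℂ)) z =
      ((deriv Real.smoothTransition ((m + 1 : ℝ) ^ 2 * ‖z k‖ ^ 2 - 1) * (m + 1 : ℝ) ^ 2 : ℝ) : ℂ) *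
        if i = k then starRingEnd ℂ (z k) else 0 := by
    intro m z i
    rw [← dz_norm_sq_coord, dz_ofReal_comp (hu.differentiable (by norm_num) z) (hh m _)]
  refine ⟨2 * C, fun m z => ((h m (‖z k‖ ^ 2) : ℝ) : ℂ), by positivity, fun m => ?_,
    fun m z hz => ?_, fun z hz => ?_, fun m z => ?_, fun m z i hi => ?_, fun m z hz => ?_⟩
  · exact Complex.ofRealCLM.contDiff.comp
      ((Real.smoothTransition.contDiff).comp ((contDiff_const.mul hu).sub contDiff_const))
  · have hm : (m + 1 : ℝ) ^ 2 * ‖z k‖ ^ 2 - 1 < 0 := by simp [hz]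
    have hcont : ContinuousAt (fun y : Cn n => (m + 1 : ℝ) ^ 2 * ‖y k‖ ^ 2 - 1) z :=
      ((continuous_const.mul hu.continuous).sub continuous_const).continuousAt
    filter_upwards [hcont.eventually (gt_mem_nhds hm)] with y hy
    simp [h, Real.smoothTransition.zero_of_nonpos (le_of_lt hy)]
  · have hpos : 0 < ‖z k‖ := norm_pos_iff.2 hz
    obtain ⟨M, hM⟩ := exists_nat_gt (2 * ‖z k‖⁻¹)
    filter_upwards [eventually_ge_atTop M] with m hm
    have h1 : (2 : ℝ) < (m + 1) * ‖z k‖ := by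
      have h2 : (2 : ℝ) * ‖z k‖⁻¹ < m + 1 := by
        have : (M : ℝ) ≤ m := by exact_mod_cast hm
        linarith
      calc (2 : ℝ) = 2 * ‖z k‖⁻¹ * ‖z k‖ := by field_simp
        _ < _ := by gcongr
    have h2 : (1 : ℝ) < (m + 1 : ℝ) ^ 2 * ‖z k‖ ^ 2 - 1 := by nlinarith
    have hcont : ContinuousAt (fun y : Cn n => (m + 1 : ℝ) ^ 2 * ‖y k‖ ^ 2 - 1) z :=
      ((continuous_const.mul hu.continuous).sub continuous_const).continuousAt
    filter_upwards [hcont.eventually (lt_mem_nhds h2)] with y hy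
    simp [h, Real.smoothTransition.one_of_one_le (le_of_lt hy)]
  · rw [Complex.norm_real, Real.norm_of_nonneg (Real.smoothTransition.nonneg _)]
    exact Real.smoothTransition.le_one _
  · rw [hdz, if_neg hi, mul_zero]
  · have hpos : 0 < ‖z k‖ := norm_pos_iff.2 hz
    rw [hdz, if_pos rfl, norm_mul, RCLike.norm_conj, Complex.norm_real, norm_mul,
      Real.norm_eq_abs, Real.norm_eq_abs, abs_of_nonneg (by positivity : (0 : ℝ) ≤ (m + 1) ^ 2)]
    -- Wherever the derivative of the cutoff is nonzero, (m+1)²|z_k|² ≤ 2. Hence the factor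
    -- (m+1)²|z_k| is at most 2/|z_k|, uniformly in m.
    by_cases hx : 1 < (m + 1 : ℝ) ^ 2 * ‖z k‖ ^ 2 - 1
    · rw [deriv_smoothTransition_eq_zero (Or.inr hx), abs_zero, zero_mul, zero_mul]
      positivity
    · rw [not_lt] at hx
      have h1 := hC ((m + 1 : ℝ) ^ 2 * ‖z k‖ ^ 2 - 1)
      calc _ = |deriv Real.smoothTransition ((m + 1 : ℝ) ^ 2 * ‖z k‖ ^ 2 - 1)| *
            ((m + 1 : ℝ) ^ 2 * ‖z k‖ ^ 2) * ‖z k‖⁻¹ := by field_simp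
        _ ≤ C * 2 * ‖z k‖⁻¹ := by gcongr; linarith
        _ = 2 * C * ‖z k‖⁻¹ := by ring

/-- Undoes the weights in `adjugate_frameMatrix`, so that bounds in the cone frame become bounds for
the adjugate in coordinates. -/
theorem norm_adjugate_le {N C : ℝ} (hC : ∀ M : Matrix (Fin n) (Fin n) ℂ, (∀ i j, ‖M i j‖ ≤ N) →
      ‖M.det‖ ≤ C ∧ ∀ i j, ‖M.adjugate i j‖ ≤ C)
    {z : Cn n} (hz : z k ≠ 0) {M : Matrix (Fin n) (Fin n) ℂ}
    (hM : ∀ i j, ‖coneWeight β k i z * coneWeight β k j z * M i j‖ ≤ N) (i j : Fin n) :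
    ‖M.adjugate i j‖ ≤ C * (‖coneWeight β k i z‖ * ‖coneWeight β k j z‖) *
      (‖coneWeight β k k z‖ ^ 2)⁻¹ := by
  have h := congrArg norm (adjugate_frameMatrix (β := β) (k := k) z M i j)
  rw [norm_mul, norm_mul, norm_mul, norm_pow] at h
  have h1 := ((hC (frameMatrix β k z M) hM).2 i j)
  have h2 : 0 < ‖coneWeight β k k z‖ ^ 2 := by
    have := norm_pos_iff.2 (coneWeight_ne_zero (β := β) hz k)
    positivity
  rw [← div_eq_mul_inv, le_div_iff₀ h2, mul_comm, ← h, mul_comm]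
  gcongr

/-- Stokes' theorem `∫ √-1 ∂∂̄F ∧ ωⁿ⁻¹ = 0` in a divisor chart, for functions with compact
support whose derivatives are bounded in the cone frame. -/
theorem integral_adjugate_ddbar_eq_zero (hβ : 0 < β) (k : Fin n) {s K : Set (Cn n)}
    (hs : IsOpen s) (hK : IsCompact K) (hKs : K ⊆ s) {G : Cn n → Matrix (Fin n) (Fin n) ℂ}
    {F : Cn n → ℂ} {N : ℝ}
    (hG : ∀ i j, ContDiffOn ℝ 1 (fun z => G z i j) (s ∩ {z | z k ≠ 0}))
    (hdet : ∀ z ∈ s ∩ {z | z k ≠ 0}, (G z).det ≠ 0)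
    (hcl : ∀ z ∈ s ∩ {z | z k ≠ 0}, ∀ i j l,
      dz l (fun y => G y i j) z = dz i (fun y => G y l j) z)
    (hGb : ∀ z ∈ K, z k ≠ 0 → ∀ i j, ‖coneWeight β k i z * coneWeight β k j z * G z i j‖ ≤ N)
    (hF : ContDiffOn ℝ 2 F {z | z k ≠ 0}) (hFK : ∀ z ∉ K, F z = 0)
    (hFb : ∀ z ∈ K, z k ≠ 0 → ∀ j, ‖coneWeight β k j z * dzbar j F z‖ ≤ N)
    (hFb2 : ∀ z ∈ K, z k ≠ 0 → ∀ i j,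
      ‖coneWeight β k i z * coneWeight β k j z * ddbar i j F z‖ ≤ N) :
    ∫ z, ∑ i, ∑ j, (G z).adjugate j i * ddbar i j F z = 0 := by
  have hko : IsOpen {z : Cn n | z k ≠ 0} := isOpen_ne_fun (continuous_apply k) continuous_const
  have hsk : IsOpen (s ∩ {z : Cn n | z k ≠ 0}) := hs.inter hko
  have hF0 : ∀ z ∉ K, F =ᶠ[𝓝 z] fun _ => 0 := fun z hz =>
    Filter.eventually_of_mem (hK.isClosed.isOpen_compl.mem_nhds hz) fun y hy => hFK y hy
  -- W is the vector field whose divergence is the Laplacian density `L`: the adjugate is divergence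
  -- free, so only the derivatives of ∂̄F remain.
  let W : Fin n → Cn n → ℂ := fun i z => ∑ j, (G z).adjugate j i * dzbar j F z
  have hW : ∀ i, ContDiffOn ℝ 1 (W i) (s ∩ {z | z k ≠ 0}) := fun i =>
    ContDiffOn.sum fun j _ => (contDiffOn_adjugate hG j i).mul
      ((contDiffOn_dzbar (m := 1) hko hF (by norm_num) j).mono inter_subset_right)
  have hW0 : ∀ i, ∀ z ∉ K, W i z = 0 := fun i z hz => by
    refine Finset.sum_eq_zero fun j _ => ?_
    rw [dzbar_congr (hF0 z hz), dzbar_const, mul_zero]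
  have hW0' : ∀ i, ∀ z ∉ K, W i =ᶠ[𝓝 z] fun _ => 0 := fun i z hz =>
    Filter.eventually_of_mem (hK.isClosed.isOpen_compl.mem_nhds hz) fun y hy => hW0 i y hy
  have hWd : ∀ i, ∀ z, z k ≠ 0 → ContDiffAt ℝ 1 (W i) z := by
    intro i z hz
    by_cases hzK : z ∈ K
    · exact (hW i).contDiffAt (hsk.mem_nhds ⟨hKs hzK, hz⟩)
    · exact contDiffAt_const.congr_of_eventuallyEq (hW0' i z hzK)
  let L : Cn n → ℂ := fun z => ∑ i, ∑ j, (G z).adjugate j i * ddbar i j F z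
  have hL0 : ∀ z ∉ K, L z = 0 := fun z hz =>
    Finset.sum_eq_zero fun i _ => Finset.sum_eq_zero fun j _ => by
      rw [ddbar_congr (hF0 z hz), ddbar_const, mul_zero]
  have hLW : ∀ z, z k ≠ 0 → ∑ i, dz i (W i) z = L z := by
    intro z hz
    by_cases hzK : z ∈ K
    · have hzs : z ∈ s ∩ {z : Cn n | z k ≠ 0} := ⟨hKs hzK, hz⟩
      have hA : ∀ i j, DifferentiableAt ℝ (fun y => (G y).adjugate j i) z := fun i j =>
        ((contDiffOn_adjugate hG j i).differentiableOn (by norm_num)).differentiableAt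
          (hsk.mem_nhds hzs)
      have hd : ∀ j, DifferentiableAt ℝ (dzbar j F) z := fun j =>
        ((contDiffOn_dzbar (m := 1) hko hF (by norm_num) j).differentiableOn
          (by norm_num)).differentiableAt (hko.mem_nhds hz)
      have h1 : ∀ i, dz i (W i) z = ∑ j, dz i (fun y => (G y).adjugate j i) z * dzbar j F z +
          ∑ j, (G z).adjugate j i * ddbar i j F z := by
        intro i
        rw [dz_sum _ fun j _ => (hA i j).fun_mul (hd j), ← Finset.sum_add_distrib]
        exact Finset.sum_congr rfl fun j _ => dz_mul (hA i j) (hd j) i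
      simp only [h1, Finset.sum_add_distrib]
      rw [Finset.sum_comm]
      simp only [← Finset.sum_mul, sum_dz_adjugate_eq_zero hsk hG hzs (hdet z hzs) (hcl z hzs)]
      simp [L]
    · rw [hL0 z hzK]
      refine Finset.sum_eq_zero fun i _ => ?_
      rw [dz_congr (hW0' i z hzK), dz_const]
  obtain ⟨C, hC0, hC⟩ := exists_det_adjugate_bound n N
  obtain ⟨C', χ, hC'0, hχs, hχ0, hχ1, hχb, hχi, hχk⟩ := exists_cutoff k
  -- The field W may be singular on z_k = 0, but χ_m vanishes near that hyperplane, so the cut-off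
  -- field is C¹ and compactly supported and its divergence integrates to zero.
  have hχW : ∀ m i, ContDiff ℝ 1 (fun z => χ m z * W i z) := by
    intro m i
    rw [contDiff_iff_contDiffAt]
    intro z
    by_cases hz : z k = 0
    · refine (contDiffAt_const (c := (0 : ℂ))).congr_of_eventuallyEq ?_
      filter_upwards [hχ0 m z hz] with y hy
      rw [hy, zero_mul]
    · exact (hχs m).contDiffAt.mul (hWd i z hz)
  have hχWc : ∀ m i, HasCompactSupport (fun z => χ m z * W i z) := fun m i =>
    HasCompactSupport.intro hK fun z hz => by rw [hW0 i z hz, mul_zero]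
  have hint : ∀ m, ∫ z, ∑ i, dz i (fun y => χ m y * W i y) z = 0 := by
    intro m
    rw [integral_finsetSum]
    · exact Finset.sum_eq_zero fun i _ => integral_dz_eq_zero (hχW m i) (hχWc m i) i
    · intro i _
      have h := contDiffOn_dz (m := 0) isOpen_univ (hχW m i).contDiffOn (by norm_num) i
      refine (continuousOn_univ.1 h.continuousOn).integrable_of_hasCompactSupport ?_
      refine HasCompactSupport.intro hK fun z hz => ?_
      have : (fun y => χ m y * W i y) =ᶠ[𝓝 z] fun _ => 0 := by
        filter_upwards [hW0' i z hz] with y hy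
        rw [hy, mul_zero]
      rw [dz_congr this, dz_const]
  have hexp : ∀ m z, z k ≠ 0 → ∑ i, dz i (fun y => χ m y * W i y) z =
      dz k (χ m) z * W k z + χ m z * L z := by
    intro m z hz
    have h1 : ∀ i, dz i (fun y => χ m y * W i y) z =
        dz i (χ m) z * W i z + χ m z * dz i (W i) z := fun i =>
      dz_mul ((hχs m).differentiable (by norm_num) z) ((hWd i z hz).differentiableAt
        (by norm_num)) i
    simp only [h1, Finset.sum_add_distrib, ← Finset.mul_sum, hLW z hz]
    rw [Finset.sum_eq_single k (fun i _ hi => by rw [hχi m z i hi, zero_mul]) (by simp)]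
  have hae : ∀ᵐ z : Cn n, z k ≠ 0 := by
    rw [ae_iff]
    simpa using measure_coord_eq_zero k
  have hwpos : ∀ z : Cn n, z k ≠ 0 → ∀ i, 0 < ‖coneWeight β k i z‖ := fun z hz i =>
    norm_pos_iff.2 (coneWeight_ne_zero hz i)
  -- Only the component W_k meets the derivative of the cutoff. Its weights leave a single power
  -- |z_k|^(β-1), one factor of the k-th weight having been cancelled.
  have hterm : ∀ z ∈ K, z k ≠ 0 → ‖W k z‖ ≤ n * (C * N) * ‖z k‖ ^ (β - 1) := by
    intro z hzK hz
    have hN : 0 ≤ N := (norm_nonneg _).trans (hFb z hzK hz k)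
    refine (norm_sum_le _ _).trans ?_
    have : ∀ j ∈ Finset.univ, ‖(G z).adjugate j k * dzbar j F z‖ ≤
        C * N * ‖z k‖ ^ (β - 1) := by
      intro j _
      have hj := hwpos z hz j
      have hk := hwpos z hz k
      rw [norm_mul]
      have h1 := norm_adjugate_le hC hz (hGb z hzK hz) j k
      have h2 := hFb z hzK hz j
      rw [norm_mul] at h2
      calc _ ≤ C * (‖coneWeight β k j z‖ * ‖coneWeight β k k z‖) *
            (‖coneWeight β k k z‖ ^ 2)⁻¹ * ‖dzbar j F z‖ := by gcongr
        _ = C * (‖coneWeight β k j z‖ * ‖dzbar j F z‖) * ‖coneWeight β k k z‖⁻¹ := by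
            field_simp
        _ ≤ C * N * ‖coneWeight β k k z‖⁻¹ := by gcongr
        _ = _ := by rw [norm_coneWeight_self_inv]
    refine (Finset.sum_le_sum this).trans ?_
    rw [Finset.sum_const, Finset.card_univ, Fintype.card_fin, nsmul_eq_mul, ← mul_assoc]
  have hLb : ∀ z ∈ K, z k ≠ 0 → ‖L z‖ ≤ n * (n * (C * N * ‖z k‖ ^ (2 * β - 2))) := by
    intro z hzK hz
    have hN : 0 ≤ N := (norm_nonneg _).trans (hFb z hzK hz k)
    have : ∀ i j, ‖(G z).adjugate j i * ddbar i j F z‖ ≤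
        C * N * ‖z k‖ ^ (2 * β - 2) := by
      intro i j
      have hj := hwpos z hz j
      have hi := hwpos z hz i
      have hk := hwpos z hz k
      rw [norm_mul]
      have h1 := norm_adjugate_le hC hz (hGb z hzK hz) j i
      have h2 := hFb2 z hzK hz i j
      rw [norm_mul, norm_mul] at h2
      calc _ ≤ C * (‖coneWeight β k j z‖ * ‖coneWeight β k i z‖) *
            (‖coneWeight β k k z‖ ^ 2)⁻¹ * ‖ddbar i j F z‖ := by gcongr
        _ = C * (‖coneWeight β k i z‖ * ‖coneWeight β k j z‖ * ‖ddbar i j F z‖) *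
            (‖coneWeight β k k z‖ ^ 2)⁻¹ := by ring
        _ ≤ C * N * (‖coneWeight β k k z‖ ^ 2)⁻¹ := by gcongr
        _ = _ := by rw [norm_coneWeight_self_sq_inv]
    refine (norm_sum_le _ _).trans ((Finset.sum_le_sum fun i _ => (norm_sum_le _ _).trans
      (Finset.sum_le_sum fun j _ => this i j)).trans ?_)
    simp
  -- The cutoff term is of order |z_k|⁻¹·|z_k|^(β-1), and the Laplacian term of order |z_k|^(2β-2).
  -- Both exponents exceed -2 precisely because β > 0.
  let bound : Cn n → ℝ := K.indicator fun z =>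
    C' * (n * (C * N)) * ‖z k‖ ^ (β - 2) + n * (n * (C * N)) * ‖z k‖ ^ (2 * β - 2)
  have hbound : Integrable bound := by
    rw [integrable_indicator_iff hK.isClosed.measurableSet]
    exact ((integrableOn_norm_coord_rpow (by linarith) k hK.isBounded).const_mul _).add
      ((integrableOn_norm_coord_rpow (by linarith) k hK.isBounded).const_mul _)
  have hlim : Tendsto (fun m : ℕ => ∫ z, ∑ i, dz i (fun y => χ m y * W i y) z) atTop
      (𝓝 (∫ z, L z)) := by
    refine tendsto_integral_of_dominated_convergence bound (fun m => ?_) hbound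
      (fun m => ?_) ?_
    · refine Continuous.aestronglyMeasurable (continuous_finsetSum _ fun i _ => ?_)
      exact continuousOn_univ.1 (contDiffOn_dz (m := 0) isOpen_univ (hχW m i).contDiffOn
        (by norm_num) i).continuousOn
    · filter_upwards [hae] with z hz
      rw [hexp m z hz]
      by_cases hzK : z ∈ K
      · rw [show bound z = _ from indicator_of_mem hzK _]
        have hpos : 0 < ‖z k‖ := norm_pos_iff.2 hz
        have hN : 0 ≤ N := (norm_nonneg _).trans (hFb z hzK hz k)
        refine (norm_add_le _ _).trans (add_le_add ?_ ?_)
        · rw [norm_mul]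
          calc _ ≤ C' * ‖z k‖⁻¹ * (n * (C * N) * ‖z k‖ ^ (β - 1)) := by
                gcongr
                · exact hχk m z hz
                · exact hterm z hzK hz
            _ = C' * (n * (C * N)) * ‖z k‖ ^ (β - 2) := by
                have : ‖z k‖ ^ (β - 2) = ‖z k‖⁻¹ * ‖z k‖ ^ (β - 1) := by
                  rw [← Real.rpow_neg_one, ← Real.rpow_add hpos]
                  congr 1
                  ring
                rw [this]
                ring
        · rw [norm_mul]
          calc _ ≤ 1 * (n * (n * (C * N * ‖z k‖ ^ (2 * β - 2)))) := by
                gcongr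
                · exact hχb m z
                · exact hLb z hzK hz
            _ = _ := by ring
      · rw [show bound z = _ from indicator_of_notMem hzK _, hW0 k z hzK, hL0 z hzK]
        simp
    · filter_upwards [hae] with z hz
      refine tendsto_const_nhds.congr' ?_
      filter_upwards [hχ1 z hz] with m hm
      rw [hexp m z hz, dz_congr hm, dz_const, hm.eq_of_nhds]
      ring
  simp only [hint] at hlim
  exact tendsto_nhds_unique hlim tendsto_const_nhds

end LocalStokes

end KahlerCone

namespace KahlerCone

/-! ### Linear algebra of Hermitian forms -/

section HermitianForms

variable {n : ℕ}

/-- The real quadratic form `∑ Mᵢⱼ vᵢ v̄ⱼ`. -/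
noncomputable def quadForm (M : Matrix (Fin n) (Fin n) ℂ) (v : Fin n → ℂ) : ℝ :=
  (∑ i, ∑ j, M i j * v i * starRingEnd ℂ (v j)).re

/-- The trace of the form `H` with respect to the metric `G`. -/
noncomputable def traceWith (G H : Matrix (Fin n) (Fin n) ℂ) : ℝ := (G⁻¹ * H).trace.re

/-- The coefficients of `η ∧ η̄`. -/
noncomputable def sqForm (η : Fin n → ℂ) : Matrix (Fin n) (Fin n) ℂ :=
  Matrix.of fun i j => η i * starRingEnd ℂ (η j)

theorem traceWith_sqForm (G : Matrix (Fin n) (Fin n) ℂ) (η : Fin n → ℂ) :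
    traceWith G (sqForm η) = (∑ i, ∑ j, G⁻¹ j i * η i * starRingEnd ℂ (η j)).re := by
  simp only [traceWith, Matrix.trace, Matrix.diag, Matrix.mul_apply, sqForm, Matrix.of_apply]
  rw [Finset.sum_comm]
  simp only [mul_assoc]

theorem quadForm_sqForm (η v : Fin n → ℂ) :
    quadForm (sqForm η) v = ‖∑ i, η i * v i‖ ^ 2 := by
  have h : ∑ i, ∑ j, sqForm η i j * v i * starRingEnd ℂ (v j) =
      (∑ i, η i * v i) * starRingEnd ℂ (∑ i, η i * v i) := by
    rw [map_sum, Finset.sum_mul_sum]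
    refine Finset.sum_congr rfl fun i _ => Finset.sum_congr rfl fun j _ => ?_
    simp only [sqForm, Matrix.of_apply, map_mul]
    ring
  rw [quadForm, h, Complex.mul_conj, Complex.ofReal_re, Complex.normSq_eq_norm_sq]

theorem quadForm_add (A B : Matrix (Fin n) (Fin n) ℂ) (v : Fin n → ℂ) :
    quadForm (A + B) v = quadForm A v + quadForm B v := by
  simp only [quadForm, ← Complex.add_re, ← Finset.sum_add_distrib, Matrix.add_apply, add_mul]

theorem quadForm_smul (c : ℝ) (A : Matrix (Fin n) (Fin n) ℂ) (v : Fin n → ℂ) :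
    quadForm ((c : ℂ) • A) v = c * quadForm A v := by
  simp only [quadForm, Matrix.smul_apply, smul_eq_mul, mul_assoc, ← Finset.mul_sum,
    Complex.re_ofReal_mul]

theorem quadForm_eq_dotProduct (M : Matrix (Fin n) (Fin n) ℂ) (v : Fin n → ℂ) :
    quadForm M v = (star (star v) ⬝ᵥ (M *ᵥ star v)).re := by
  simp only [quadForm, dotProduct, Matrix.mulVec, Finset.mul_sum, Pi.star_apply,
    RCLike.star_def, Complex.conj_conj]
  congr 1
  exact Finset.sum_congr rfl fun i _ => Finset.sum_congr rfl fun j _ => by ring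

theorem quadForm_nonneg {M : Matrix (Fin n) (Fin n) ℂ} (hM : M.PosSemidef) (v : Fin n → ℂ) :
    0 ≤ quadForm M v := by
  rw [quadForm_eq_dotProduct]
  exact hM.re_dotProduct_nonneg _

/-- Pull back of a form under the linear map with matrix `J`. -/
def pullForm (J M : Matrix (Fin n) (Fin n) ℂ) : Matrix (Fin n) (Fin n) ℂ :=
  Jᵀ * M * J.map (starRingEnd ℂ)

theorem pullForm_apply (J M : Matrix (Fin n) (Fin n) ℂ) (i j : Fin n) :
    pullForm J M i j = ∑ a, ∑ b, J a i * starRingEnd ℂ (J b j) * M a b := by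
  simp only [pullForm, Matrix.mul_apply, Finset.sum_mul, Matrix.transpose_apply, Matrix.map_apply]
  rw [Finset.sum_comm]
  exact Finset.sum_congr rfl fun a _ => Finset.sum_congr rfl fun b _ => by ring

theorem quadForm_pullForm (J M : Matrix (Fin n) (Fin n) ℂ) (v : Fin n → ℂ) :
    quadForm (pullForm J M) v = quadForm M (J *ᵥ v) := by
  rw [quadForm_eq_dotProduct, quadForm_eq_dotProduct, star_star, star_star]
  have h : star (J *ᵥ v) = J.map (starRingEnd ℂ) *ᵥ star v := by
    ext i
    simp [Matrix.mulVec, dotProduct]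
  rw [h, pullForm, ← Matrix.mulVec_mulVec, ← Matrix.mulVec_mulVec, Matrix.dotProduct_mulVec,
    Matrix.vecMul_transpose]

theorem det_map_conj (J : Matrix (Fin n) (Fin n) ℂ) :
    (J.map (starRingEnd ℂ)).det = starRingEnd ℂ J.det :=
  (RingHom.map_det (starRingEnd ℂ) J).symm

theorem det_pullForm (J M : Matrix (Fin n) (Fin n) ℂ) :
    (pullForm J M).det = ((‖J.det‖ ^ 2 : ℝ) : ℂ) * M.det := by
  rw [pullForm, Matrix.det_mul, Matrix.det_mul, Matrix.det_transpose, det_map_conj,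
    ← Complex.normSq_eq_norm_sq, ← Complex.mul_conj]
  ring

theorem traceWith_pullForm {J : Matrix (Fin n) (Fin n) ℂ} (hJ : IsUnit J.det)
    (G H : Matrix (Fin n) (Fin n) ℂ) :
    traceWith (pullForm J G) (pullForm J H) = traceWith G H := by
  have hJ' : IsUnit (J.map (starRingEnd ℂ)).det := by
    rw [det_map_conj]
    exact hJ.map _
  have hJt : IsUnit (Jᵀ).det := by rwa [Matrix.det_transpose]
  rw [traceWith, traceWith, pullForm, pullForm, Matrix.mul_inv_rev, Matrix.mul_inv_rev,
    show (J.map (starRingEnd ℂ))⁻¹ * (G⁻¹ * Jᵀ⁻¹) * (Jᵀ * H * J.map (starRingEnd ℂ)) =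
      (J.map (starRingEnd ℂ))⁻¹ * (G⁻¹ * (Jᵀ⁻¹ * Jᵀ) * H * J.map (starRingEnd ℂ)) by
      simp only [Matrix.mul_assoc], Matrix.nonsing_inv_mul _ hJt, Matrix.mul_one,
    Matrix.trace_mul_comm, Matrix.mul_assoc, Matrix.mul_nonsing_inv _ hJ', Matrix.mul_one]

theorem pullForm_sqForm (J : Matrix (Fin n) (Fin n) ℂ) (η : Fin n → ℂ) :
    pullForm J (sqForm η) = sqForm fun i => ∑ a, J a i * η a := by
  ext i j
  rw [pullForm_apply]
  simp only [sqForm, Matrix.of_apply, map_sum, Finset.sum_mul_sum, map_mul]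
  exact Finset.sum_congr rfl fun a _ => Finset.sum_congr rfl fun b _ => by ring

/-- The Hermitian matrix that is diagonal with entries `d` in the frame `R`. -/
noncomputable def diagForm (R : Matrix (Fin n) (Fin n) ℂ) (d : Fin n → ℝ) :
    Matrix (Fin n) (Fin n) ℂ :=
  R * Matrix.diagonal (fun i => (d i : ℂ)) * Rᴴ

theorem diagForm_add (R : Matrix (Fin n) (Fin n) ℂ) (d d' : Fin n → ℝ) :
    diagForm R d + diagForm R d' = diagForm R (d + d') := by
  simp only [diagForm, ← Matrix.add_mul, ← Matrix.mul_add, Matrix.diagonal_add, Pi.add_apply,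
    Complex.ofReal_add]

theorem diagForm_smul (R : Matrix (Fin n) (Fin n) ℂ) (s : ℝ) (d : Fin n → ℝ) :
    (s : ℂ) • diagForm R d = diagForm R (s • d) := by
  rw [diagForm, diagForm, ← Matrix.smul_mul, ← Matrix.mul_smul]
  congr 2
  ext i j
  rw [Matrix.smul_apply, Matrix.diagonal_apply, Matrix.diagonal_apply]
  split_ifs <;> simp

theorem diagForm_apply (R : Matrix (Fin n) (Fin n) ℂ) (d : Fin n → ℝ) (i j : Fin n) :
    diagForm R d i j = ∑ l, R i l * d l * starRingEnd ℂ (R j l) := by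
  rw [diagForm, Matrix.mul_apply]
  refine Finset.sum_congr rfl fun l _ => ?_
  rw [Matrix.mul_diagonal, Matrix.conjTranspose_apply, RCLike.star_def]

theorem exists_unitary_diagForm {T : Matrix (Fin n) (Fin n) ℂ} (hT : T.IsHermitian) :
    ∃ (U : Matrix (Fin n) (Fin n) ℂ) (d : Fin n → ℝ), U * Uᴴ = 1 ∧ T = diagForm U d := by
  refine ⟨hT.eigenvectorUnitary, hT.eigenvalues,
    Unitary.coe_mul_star_self hT.eigenvectorUnitary, ?_⟩
  conv_lhs => rw [hT.spectral_theorem, Unitary.conjStarAlgAut_apply]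
  rfl

/-- Simultaneous diagonalisation: write G = S Sᴴ and diagonalise S⁻¹G'S⁻ᴴ by a unitary U; the common
frame is R = SU. -/
theorem exists_diagForm {G G' : Matrix (Fin n) (Fin n) ℂ} (hG : G.PosDef)
    (hG' : G'.IsHermitian) : ∃ (R : Matrix (Fin n) (Fin n) ℂ) (d : Fin n → ℝ),
      IsUnit R.det ∧ G = diagForm R 1 ∧ G' = diagForm R d := by
  obtain ⟨S, hS⟩ : ∃ S : Matrix (Fin n) (Fin n) ℂ, G = S * Sᴴ := by
    open scoped MatrixOrder in
    obtain ⟨Y, hY⟩ := CStarAlgebra.nonneg_iff_eq_star_mul_self.mp hG.posSemidef.nonneg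
    exact ⟨Yᴴ, by rw [hY, Matrix.conjTranspose_conjTranspose]; rfl⟩
  have hSu : IsUnit S.det := by
    have h := (Matrix.isUnit_iff_isUnit_det _).1 hG.isUnit
    rw [hS, Matrix.det_mul] at h
    exact isUnit_of_mul_isUnit_left h
  have hSu' : IsUnit (Sᴴ).det := by
    rw [Matrix.det_conjTranspose]
    exact hSu.star
  obtain ⟨U, d, hUU, hU⟩ := exists_unitary_diagForm
    (Matrix.isHermitian_mul_mul_conjTranspose S⁻¹ hG')
  refine ⟨S * U, d, ?_, ?_, ?_⟩
  · rw [Matrix.det_mul]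
    refine hSu.mul ?_
    have h := congrArg Matrix.det hUU
    rw [Matrix.det_mul, Matrix.det_one] at h
    exact IsUnit.of_mul_eq_one _ h
  · simp only [diagForm, Pi.one_apply, Complex.ofReal_one, Matrix.diagonal_one, Matrix.mul_one,
      Matrix.conjTranspose_mul]
    rw [hS, Matrix.mul_assoc, ← Matrix.mul_assoc U, hUU, Matrix.one_mul]
  · have h1 : G' = S * (S⁻¹ * G' * (S⁻¹)ᴴ) * Sᴴ := by
      rw [Matrix.conjTranspose_nonsing_inv]
      simp only [Matrix.mul_assoc, Matrix.nonsing_inv_mul _ hSu', Matrix.mul_one]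
      rw [← Matrix.mul_assoc, Matrix.mul_nonsing_inv _ hSu, Matrix.one_mul]
    rw [h1, hU]
    simp only [diagForm, Matrix.conjTranspose_mul, Matrix.mul_assoc]

section Diag

variable {R : Matrix (Fin n) (Fin n) ℂ} {d d' : Fin n → ℝ}

theorem det_diagForm (R : Matrix (Fin n) (Fin n) ℂ) (d : Fin n → ℝ) :
    (diagForm R d).det.re = ‖R.det‖ ^ 2 * ∏ i, d i := by
  have h : (diagForm R d).det = ((‖R.det‖ ^ 2 * ∏ i, d i : ℝ) : ℂ) := by
    rw [diagForm, Matrix.det_mul, Matrix.det_mul, Matrix.det_conjTranspose, Matrix.det_diagonal,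
      Complex.ofReal_mul, ← Complex.normSq_eq_norm_sq, ← Complex.mul_conj, Complex.ofReal_prod]
    simp only [RCLike.star_def]
    ring
  rw [h, Complex.ofReal_re]

theorem quadForm_diagForm (R : Matrix (Fin n) (Fin n) ℂ) (d : Fin n → ℝ) (v : Fin n → ℂ) :
    quadForm (diagForm R d) v = ∑ l, d l * ‖∑ i, R i l * v i‖ ^ 2 := by
  have h : ∑ i, ∑ j, diagForm R d i j * v i * starRingEnd ℂ (v j) =
      ((∑ l, d l * ‖∑ i, R i l * v i‖ ^ 2 : ℝ) : ℂ) := by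
    have h1 : ∀ l, ((‖∑ i, R i l * v i‖ ^ 2 : ℝ) : ℂ) =
        ∑ i, ∑ j, R i l * v i * (starRingEnd ℂ (R j l) * starRingEnd ℂ (v j)) := by
      intro l
      rw [← Complex.normSq_eq_norm_sq, ← Complex.mul_conj, map_sum, Finset.sum_mul_sum]
      simp only [map_mul]
    rw [Complex.ofReal_sum]
    simp only [Complex.ofReal_mul, h1, Finset.mul_sum]
    rw [Finset.sum_comm]
    conv_rhs => rw [Finset.sum_comm]
    rw [Finset.sum_comm]
    refine Finset.sum_congr rfl fun i _ => ?_
    conv_rhs => rw [Finset.sum_comm]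
    refine Finset.sum_congr rfl fun j _ => ?_
    simp only [diagForm_apply, Finset.sum_mul]
    exact Finset.sum_congr rfl fun l _ => by ring
  rw [quadForm, h, Complex.ofReal_re]

theorem sum_frame_inv (hR : IsUnit R.det) (l m : Fin n) :
    ∑ i, R i l * R⁻¹ m i = if l = m then 1 else 0 := by
  have h := congrArg (fun M : Matrix (Fin n) (Fin n) ℂ => M m l) (Matrix.nonsing_inv_mul R hR)
  simp only [Matrix.mul_apply, Matrix.one_apply] at h
  rw [← (Finset.sum_congr rfl fun i _ => mul_comm (R⁻¹ m i) (R i l)), h]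
  simp [eq_comm]

/-- The rows of R⁻¹ are the vectors dual to the frame, so evaluating on them reads off the
eigenvalues. Bounds on quadratic forms thereby become bounds on eigenvalues. -/
theorem quadForm_diagForm_frame (hR : IsUnit R.det) (d : Fin n → ℝ) (m : Fin n) :
    quadForm (diagForm R d) (fun i => R⁻¹ m i) = d m := by
  rw [quadForm_diagForm, Finset.sum_eq_single m]
  · simp [sum_frame_inv hR]
  · intro l _ hl
    simp [sum_frame_inv hR, hl]
  · simp

theorem traceWith_diagForm (hR : IsUnit R.det) (hd : ∀ i, d i ≠ 0)
    (H : Matrix (Fin n) (Fin n) ℂ) :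
    traceWith (diagForm R d) H = ∑ l, (d l)⁻¹ * quadForm H (fun i => R⁻¹ l i) := by
  have hR' : IsUnit (Rᴴ).det := by
    rw [Matrix.det_conjTranspose]
    exact hR.star
  have hinv : (diagForm R d)⁻¹ =
      (R⁻¹)ᴴ * Matrix.diagonal (fun i => (((d i)⁻¹ : ℝ) : ℂ)) * R⁻¹ := by
    refine Matrix.inv_eq_left_inv ?_
    have h1 : Matrix.diagonal (fun i => (((d i)⁻¹ : ℝ) : ℂ)) *
        Matrix.diagonal (fun i => (d i : ℂ)) = 1 := by
      rw [Matrix.diagonal_mul_diagonal, ← Matrix.diagonal_one]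
      congr 1
      funext i
      rw [← Complex.ofReal_mul, inv_mul_cancel₀ (hd i), Complex.ofReal_one]
    rw [diagForm, Matrix.conjTranspose_nonsing_inv,
      show Rᴴ⁻¹ * Matrix.diagonal (fun i => (((d i)⁻¹ : ℝ) : ℂ)) * R⁻¹ *
        (R * Matrix.diagonal (fun i => (d i : ℂ)) * Rᴴ) =
        Rᴴ⁻¹ * (Matrix.diagonal (fun i => (((d i)⁻¹ : ℝ) : ℂ)) * (R⁻¹ * R) *
          Matrix.diagonal (fun i => (d i : ℂ))) * Rᴴ by simp only [Matrix.mul_assoc],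
      Matrix.nonsing_inv_mul _ hR, Matrix.mul_one, h1, Matrix.mul_one,
      Matrix.nonsing_inv_mul _ hR']
  rw [traceWith, hinv, Matrix.mul_assoc, Matrix.mul_assoc, Matrix.trace_mul_comm, Matrix.mul_assoc]
  simp only [Matrix.trace, Matrix.diag, Matrix.diagonal_mul, Complex.re_sum,
    Complex.re_ofReal_mul]
  refine Finset.sum_congr rfl fun l _ => ?_
  congr 1
  simp only [quadForm, Matrix.mul_apply, Matrix.conjTranspose_apply, RCLike.star_def,
    Finset.sum_mul]
  rw [Finset.sum_comm]
  congr 1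
  exact Finset.sum_congr rfl fun i _ => Finset.sum_congr rfl fun j _ => by ring

end Diag

theorem det_re_pos {G : Matrix (Fin n) (Fin n) ℂ} (hG : G.PosDef) : 0 < G.det.re :=
  (Complex.pos_iff.1 hG.det_pos).1

theorem traceWith_nonneg {G : Matrix (Fin n) (Fin n) ℂ} (hG : G.PosDef) (η : Fin n → ℂ) :
    0 ≤ traceWith G (sqForm η) := by
  obtain ⟨R, d, hR, rfl, -⟩ := exists_diagForm hG hG.1
  rw [traceWith_diagForm hR (by simp)]
  refine Finset.sum_nonneg fun l _ => ?_
  rw [quadForm_sqForm]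
  simp only [Pi.one_apply]
  positivity

theorem abs_traceWith_le {G H : Matrix (Fin n) (Fin n) ℂ} {C : ℝ} (hG : G.PosDef)
    (hH : ∀ v, |quadForm H v| ≤ C * quadForm G v) : |traceWith G H| ≤ n * C := by
  obtain ⟨R, d, hR, rfl, -⟩ := exists_diagForm hG hG.1
  rw [traceWith_diagForm hR (by simp)]
  refine (Finset.abs_sum_le_sum_abs _ _).trans ?_
  have : ∀ l ∈ Finset.univ,
      |((1 : Fin n → ℝ) l)⁻¹ * quadForm H (fun i => R⁻¹ l i)| ≤ C := by
    intro l _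
    have h := hH fun i => R⁻¹ l i
    rw [quadForm_diagForm_frame hR] at h
    simpa using h
  simpa using Finset.sum_le_sum this

/-- In a common frame the eigenvalues of G' are nonnegative and those of G equal 1, so each summand
of the trace is at least -1. -/
theorem neg_le_traceWith_sub {G G' : Matrix (Fin n) (Fin n) ℂ} (hG : G.PosDef)
    (hG' : G'.PosDef) : -(n : ℝ) ≤ traceWith G (G' - G) := by
  obtain ⟨R, d, hR, hGR, hGR'⟩ := exists_diagForm hG hG'.1
  have hd : ∀ l, 0 ≤ d l := fun l => by
    have := quadForm_nonneg hG'.posSemidef fun i => R⁻¹ l i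
    rwa [hGR', quadForm_diagForm_frame hR] at this
  have h : G' - G = diagForm R (d + (-1 : ℝ) • (1 : Fin n → ℝ)) := by
    rw [← diagForm_add, ← diagForm_smul, ← hGR, ← hGR']
    simp [sub_eq_add_neg]
  rw [h, hGR, traceWith_diagForm hR (by simp)]
  simp only [quadForm_diagForm_frame hR]
  have : ∀ l ∈ Finset.univ, (-1 : ℝ) ≤
      ((1 : Fin n → ℝ) l)⁻¹ * (d + (-1 : ℝ) • (1 : Fin n → ℝ)) l := fun l _ => by
    have := hd l
    simp
    linarith
  simpa using Finset.sum_le_sum this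

theorem traceWith_sub_le {G G' : Matrix (Fin n) (Fin n) ℂ} (hG : G.PosDef)
    (hG' : G'.PosDef) : traceWith G' (G' - G) ≤ n := by
  have h1 := neg_le_traceWith_sub hG' hG
  have h2 : traceWith G' (G' - G) = -traceWith G' (G - G') := by
    rw [← neg_sub, traceWith, traceWith, Matrix.mul_neg, Matrix.trace_neg, Complex.neg_re]
  linarith

/-- Relative to G, the eigenvalues of G + H lie between 1-ε and 1+ε; since ε ≤ 1 the lower bounds
are nonnegative and can be multiplied. -/
theorem det_add_bounds {G H : Matrix (Fin n) (Fin n) ℂ} {ε : ℝ} (hG : G.PosDef)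
    (hH : H.IsHermitian) (hε1 : ε ≤ 1) (hb : ∀ v, |quadForm H v| ≤ ε * quadForm G v) :
    (1 - ε) ^ n * G.det.re ≤ (G + H).det.re ∧ (G + H).det.re ≤ (1 + ε) ^ n * G.det.re := by
  obtain ⟨R, d, hR, rfl, rfl⟩ := exists_diagForm hG hH
  have hd : ∀ l, |d l| ≤ ε := fun l => by
    have := hb fun i => R⁻¹ l i
    rw [quadForm_diagForm_frame hR, quadForm_diagForm_frame hR] at this
    simpa using this
  rw [diagForm_add, det_diagForm, det_diagForm]
  have h1 : ∏ i : Fin n, (1 - ε) ≤ ∏ i, (1 + d) i :=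
    Finset.prod_le_prod (fun _ _ => by linarith) fun i _ => by
      simp only [Pi.add_apply, Pi.one_apply]
      linarith [neg_abs_le (d i), hd i]
  have h2 : ∏ i, (1 + d) i ≤ ∏ i : Fin n, (1 + ε) :=
    Finset.prod_le_prod (fun i _ => by
      simp only [Pi.add_apply, Pi.one_apply]
      linarith [neg_abs_le (d i), hd i]) fun i _ => by
      simp only [Pi.add_apply, Pi.one_apply]
      linarith [le_abs_self (d i), hd i]
  have h3 : 0 ≤ ‖R.det‖ ^ 2 := by positivity
  simp only [Finset.prod_const, Finset.card_univ, Fintype.card_fin] at h1 h2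
  simp only [Pi.one_apply, Finset.prod_const_one, mul_one]
  constructor
  · rw [mul_comm]
    gcongr
  · rw [mul_comm ((1 + ε) ^ n)]
    gcongr

/-! ### Determinants and traces along a segment of positive matrices -/

section Segment

variable {G H : Matrix (Fin n) (Fin n) ℂ}

/-- One frame serves the whole segment: the eigenvalues relative to G are 1 + s·d_i, and positivity
at the far end gives d_i > -1. -/
theorem segment_diagForm (hG : G.PosDef) (hG' : (G + H).PosDef) :
    ∃ (R : Matrix (Fin n) (Fin n) ℂ) (d : Fin n → ℝ), IsUnit R.det ∧ (∀ i, 0 < 1 + d i) ∧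
      H = diagForm R d ∧ ∀ s : ℝ, G + (s : ℂ) • H = diagForm R fun i => 1 + s * d i := by
  have hH : H.IsHermitian := by
    have := hG'.1.sub hG.1
    rwa [add_sub_cancel_left] at this
  obtain ⟨R, d, hR, hGR, hHR⟩ := exists_diagForm hG hH
  refine ⟨R, d, hR, fun i => ?_, hHR, fun s => ?_⟩
  · have h1 : 0 < quadForm (G + H) fun l => R⁻¹ i l := by
      rw [quadForm_eq_dotProduct]
      refine hG'.re_dotProduct_pos fun h0 => ?_
      have h2 := quadForm_diagForm_frame hR 1 i
      rw [star_eq_zero] at h0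
      rw [h0] at h2
      simp [quadForm] at h2
    rw [hGR, hHR, diagForm_add, quadForm_diagForm_frame hR] at h1
    simpa using h1
  · rw [hGR, hHR, diagForm_smul, diagForm_add]
    congr 1

theorem segment_pos {s a : ℝ} (hs : s ∈ Icc (0 : ℝ) 1) (ha : 0 < 1 + a) : 0 < 1 + s * a := by
  rcases eq_or_lt_of_le hs.1 with h0 | h0
  · simp [← h0]
  · nlinarith [mul_pos h0 ha, hs.2]

theorem posDef_segment (hG : G.PosDef) (hG' : (G + H).PosDef) {s : ℝ} (hs : s ∈ Icc (0 : ℝ) 1) :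
    (G + (s : ℂ) • H).PosDef := by
  rcases eq_or_lt_of_le hs.1 with h0 | h0
  · rw [← h0]
    simpa using hG
  have h : G + (s : ℂ) • H = ((1 - s : ℝ) : ℂ) • G + (s : ℂ) • (G + H) := by
    push_cast
    module
  rw [h]
  refine Matrix.PosDef.posSemidef_add (hG.posSemidef.smul ?_) (hG'.smul ?_)
  · exact_mod_cast sub_nonneg.2 hs.2
  · exact_mod_cast h0

theorem hasDerivAt_det_segment (hG : G.PosDef) (hG' : (G + H).PosDef) {s : ℝ}
    (hs : s ∈ Icc (0 : ℝ) 1) :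
    HasDerivAt (fun r : ℝ => (G + (r : ℂ) • H).det.re)
      (traceWith (G + (s : ℂ) • H) H * (G + (s : ℂ) • H).det.re) s := by
  obtain ⟨R, d, hR, hd, hHR, hseg⟩ := segment_diagForm hG hG'
  have hpos : ∀ i, 1 + s * d i ≠ 0 := fun i => (segment_pos hs (hd i)).ne'
  simp only [hseg, det_diagForm]
  rw [traceWith_diagForm hR hpos]
  have h1 : ∀ i ∈ Finset.univ, HasDerivAt (fun r : ℝ => 1 + r * d i) (d i) s := fun i _ => by
    simpa using ((hasDerivAt_id s).mul_const (d i)).const_add 1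
  have h2 := (HasDerivAt.fun_finsetProd h1).const_mul (‖R.det‖ ^ 2)
  convert! h2 using 1
  rw [Finset.sum_mul, Finset.mul_sum]
  refine Finset.sum_congr rfl fun l _ => ?_
  rw [hHR, quadForm_diagForm_frame hR, ← Finset.mul_prod_erase _ _ (Finset.mem_univ l), smul_eq_mul]
  have := hpos l
  field_simp

/-- The trace contains the inverse eigenvalues 1/(1 + s·d_l), which the determinant cancels. The
bound is therefore uniform in s and needs no lower bound for the far end of the segment. -/
theorem abs_traceWith_mul_det_segment_le (hG : G.PosDef) (hG' : (G + H).PosDef) {s C : ℝ}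
    (hC : 0 ≤ C) (hs : s ∈ Icc (0 : ℝ) 1) (hb : ∀ v, |quadForm H v| ≤ C * quadForm G v) :
    |traceWith (G + (s : ℂ) • H) H * (G + (s : ℂ) • H).det.re| ≤
      n * C * (1 + C) ^ n * G.det.re := by
  obtain ⟨R, d, hR, hd, hHR, hseg⟩ := segment_diagForm hG hG'
  have hG1 : G = diagForm R 1 := by
    have := hseg 0
    simp only [Complex.ofReal_zero, zero_smul, add_zero, zero_mul] at this
    exact this
  have hpos : ∀ i, 0 < 1 + s * d i := fun i => segment_pos hs (hd i)
  have hdC : ∀ l, |d l| ≤ C := fun l => by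
    have := hb fun i => R⁻¹ l i
    rw [hHR, hG1, quadForm_diagForm_frame hR, quadForm_diagForm_frame hR] at this
    simpa using this
  have hle : ∀ l, 1 + s * d l ≤ 1 + C := fun l => by
    have h1 : s * d l ≤ |d l| :=
      (mul_le_mul_of_nonneg_left (le_abs_self (d l)) hs.1).trans
        (mul_le_of_le_one_left (abs_nonneg _) hs.2)
    linarith [hdC l]
  rw [hseg, traceWith_diagForm hR fun i => (hpos i).ne', det_diagForm, hG1, det_diagForm,
    Finset.sum_mul]
  refine (Finset.abs_sum_le_sum_abs _ _).trans ?_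
  have : ∀ l ∈ Finset.univ, |(1 + s * d l)⁻¹ * quadForm H (fun i => R⁻¹ l i) *
      (‖R.det‖ ^ 2 * ∏ i, (1 + s * d i))| ≤ C * (1 + C) ^ n * ‖R.det‖ ^ 2 := by
    intro l _
    rw [hHR, quadForm_diagForm_frame hR, ← Finset.mul_prod_erase _ _ (Finset.mem_univ l)]
    have h1 : (1 + s * d l)⁻¹ * d l * (‖R.det‖ ^ 2 * ((1 + s * d l) *
        ∏ i ∈ Finset.univ.erase l, (1 + s * d i))) =
        d l * (∏ i ∈ Finset.univ.erase l, (1 + s * d i)) * ‖R.det‖ ^ 2 := by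
      have := (hpos l).ne'
      field_simp
    have h2 : 0 ≤ ∏ i ∈ Finset.univ.erase l, (1 + s * d i) :=
      Finset.prod_nonneg fun i _ => (hpos i).le
    have h3 : ∏ i ∈ Finset.univ.erase l, (1 + s * d i) ≤ (1 + C) ^ n := by
      calc _ ≤ ∏ i ∈ Finset.univ.erase l, (1 + C) :=
            Finset.prod_le_prod (fun i _ => (hpos i).le) fun i _ => hle i
        _ = (1 + C) ^ (n - 1) := by simp
        _ ≤ (1 + C) ^ n := pow_le_pow_right₀ (by linarith) (Nat.sub_le _ _)
    rw [h1, abs_mul, abs_mul, abs_of_nonneg h2, abs_of_nonneg (by positivity : 0 ≤ ‖R.det‖ ^ 2)]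
    gcongr
    exact hdC l
  refine (Finset.sum_le_sum this).trans (le_of_eq ?_)
  simp
  ring

/-- Every eigenvalue satisfies 1 + s·d_i ≥ 1-s because d_i > -1. One of the n eigenvalues cancels
against the trace, which leaves the power n-1. -/
theorem traceWith_sqForm_segment_ge (hG : G.PosDef) (hG' : (G + H).PosDef) {s : ℝ}
    (hs : s ∈ Icc (0 : ℝ) 1) (η : Fin n → ℂ) :
    (1 - s) ^ (n - 1) * (traceWith G (sqForm η) * G.det.re) ≤
      traceWith (G + (s : ℂ) • H) (sqForm η) * (G + (s : ℂ) • H).det.re := by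
  obtain ⟨R, d, hR, hd, hHR, hseg⟩ := segment_diagForm hG hG'
  have hG1 : G = diagForm R 1 := by
    have := hseg 0
    simp only [Complex.ofReal_zero, zero_smul, add_zero, zero_mul] at this
    exact this
  have hpos : ∀ i, 0 < 1 + s * d i := fun i => segment_pos hs (hd i)
  rw [hseg, hG1, traceWith_diagForm hR (by simp), traceWith_diagForm hR fun i => (hpos i).ne',
    det_diagForm, det_diagForm, Finset.sum_mul, Finset.sum_mul, Finset.mul_sum]
  refine Finset.sum_le_sum fun l _ => ?_
  rw [quadForm_sqForm, ← Finset.mul_prod_erase _ (fun i => 1 + s * d i) (Finset.mem_univ l)]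
  set q := ‖∑ i, η i * R⁻¹ l i‖ ^ 2
  have hq : 0 ≤ q := by positivity
  have h1 : (1 + s * d l)⁻¹ * q * (‖R.det‖ ^ 2 * ((1 + s * d l) *
      ∏ i ∈ Finset.univ.erase l, (1 + s * d i))) =
      (∏ i ∈ Finset.univ.erase l, (1 + s * d i)) * (q * ‖R.det‖ ^ 2) := by
    have := (hpos l).ne'
    field_simp
  have h2 : (1 - s) ^ (n - 1) ≤ ∏ i ∈ Finset.univ.erase l, (1 + s * d i) := by
    calc (1 - s) ^ (n - 1) = ∏ i ∈ Finset.univ.erase l, (1 - s) := by simp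
      _ ≤ _ := Finset.prod_le_prod (fun i _ => by linarith [hs.2]) fun i _ => by
        nlinarith [hd i, hs.1]
  rw [h1]
  simp only [Pi.one_apply, inv_one, one_mul, Finset.prod_const_one, mul_one]
  gcongr

end Segment

/-! ### Quadratic form bounds versus entry bounds in the cone frame -/

section FrameBounds

variable {β : ℝ} {k : Fin n} {z : Cn n}

/-- Coordinate vectors give the diagonal entries, where β² ≤ 1 removes the factor of the flat
metric. Off the diagonal, G = R Rᴴ and the inequality 2xy ≤ x² + y² bound an entry by the two
diagonal ones. -/
theorem norm_frame_le_of_quadForm_le {G : Matrix (Fin n) (Fin n) ℂ} {c : ℝ} (hβ : 0 < β)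
    (hβ1 : β ≤ 1) (hz : z k ≠ 0) (hG : G.PosDef) (hc : 0 ≤ c)
    (h : ∀ v, quadForm G v ≤ c * flatCone β k z v) (i j : Fin n) :
    ‖coneWeight β k i z * coneWeight β k j z * G i j‖ ≤ c := by
  have hpos : 0 < ‖z k‖ := norm_pos_iff.2 hz
  have hdiag : ∀ i, ‖coneWeight β k i z‖ ^ 2 * (G i i).re ≤ c := by
    intro i
    have h1 := h (Pi.single i 1)
    have h2 : quadForm G (Pi.single i 1) = (G i i).re := by
      simp only [quadForm]
      rw [Finset.sum_eq_single i, Finset.sum_eq_single i]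
      · simp
      · intro b _ hb
        simp [hb]
      · simp
      · intro b _ hb
        simp [hb]
      · simp
    have h3 : flatCone β k z (Pi.single i 1) =
        if i = k then β ^ 2 * ‖z k‖ ^ (2 * (β - 1)) else 1 := by
      rw [flatCone, Finset.sum_eq_single i]
      · simp
      · intro b _ hb
        simp [hb]
      · simp
    rw [h2, h3] at h1
    refine (mul_le_mul_of_nonneg_left h1 (by positivity)).trans ?_
    by_cases hik : i = k
    · subst hik
      have h4 : ‖coneWeight β i i z‖ ^ 2 * ‖z i‖ ^ (2 * (β - 1)) = 1 := by
        rw [norm_coneWeight_self, ← Real.rpow_natCast, ← Real.rpow_mul hpos.le,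
          ← Real.rpow_add hpos]
        convert! Real.rpow_zero _ using 2
        push_cast
        ring
      rw [if_pos rfl]
      calc _ = c * β ^ 2 * (‖coneWeight β i i z‖ ^ 2 * ‖z i‖ ^ (2 * (β - 1))) := by ring
        _ = c * β ^ 2 := by rw [h4, mul_one]
        _ ≤ c * 1 := by gcongr; exact pow_le_one₀ hβ.le hβ1
        _ = c := mul_one c
    · rw [if_neg hik, coneWeight_of_ne hik]
      simp
  obtain ⟨R, d, hR, hGR, -⟩ := exists_diagForm hG hG.1
  have hent : ∀ i j, G i j = ∑ l, R i l * starRingEnd ℂ (R j l) := by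
    intro i j
    rw [hGR]
    simp only [diagForm_apply, Pi.one_apply, Complex.ofReal_one, mul_one]
  have hii : ∀ i, (G i i).re = ∑ l, ‖R i l‖ ^ 2 := by
    intro i
    rw [hent, Complex.re_sum]
    refine Finset.sum_congr rfl fun l _ => ?_
    rw [Complex.mul_conj, Complex.ofReal_re, Complex.normSq_eq_norm_sq]
  set a := ‖coneWeight β k i z‖
  set b := ‖coneWeight β k j z‖
  have h5 : ‖G i j‖ ≤ ∑ l, ‖R i l‖ * ‖R j l‖ := by
    rw [hent]
    refine (norm_sum_le _ _).trans (le_of_eq ?_)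
    simp
  have h6 : a * b * ‖G i j‖ ≤ (a ^ 2 * (G i i).re + b ^ 2 * (G j j).re) / 2 := by
    calc a * b * ‖G i j‖ ≤ a * b * ∑ l, ‖R i l‖ * ‖R j l‖ := by gcongr
      _ = ∑ l, (a * ‖R i l‖) * (b * ‖R j l‖) := by
          rw [Finset.mul_sum]
          exact Finset.sum_congr rfl fun l _ => by ring
      _ ≤ ∑ l, ((a * ‖R i l‖) ^ 2 + (b * ‖R j l‖) ^ 2) / 2 :=
          Finset.sum_le_sum fun l _ => by nlinarith [sq_nonneg (a * ‖R i l‖ - b * ‖R j l‖)]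
      _ = _ := by
          rw [hii, hii, ← Finset.sum_div, Finset.sum_add_distrib, Finset.mul_sum, Finset.mul_sum]
          simp only [mul_pow]
  rw [norm_mul, norm_mul]
  linarith [hdiag i, hdiag j]

/-- Dividing each component of v by its weight turns the entry bound into N times the square of a
sum, and Cauchy–Schwarz costs a factor n. The factor β⁻² compensates the β² in `flatCone`. -/
theorem abs_quadForm_le_of_norm_frame_le {H : Matrix (Fin n) (Fin n) ℂ} {N : ℝ} (hβ : 0 < β)
    (hβ1 : β ≤ 1) (hz : z k ≠ 0) (hN : 0 ≤ N)
    (h : ∀ i j, ‖coneWeight β k i z * coneWeight β k j z * H i j‖ ≤ N) (v : Cn n) :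
    |quadForm H v| ≤ N * n * (β ^ 2)⁻¹ * flatCone β k z v := by
  have hpos : 0 < ‖z k‖ := norm_pos_iff.2 hz
  have hw : ∀ i, 0 < ‖coneWeight β k i z‖ := fun i => norm_pos_iff.2 (coneWeight_ne_zero hz i)
  have h1 : |quadForm H v| ≤ N * (∑ i, ‖v i‖ / ‖coneWeight β k i z‖) ^ 2 := by
    rw [quadForm]
    refine (Complex.abs_re_le_norm _).trans ((norm_sum_le _ _).trans
      ((Finset.sum_le_sum fun i _ => norm_sum_le _ _).trans ?_))
    rw [sq, Finset.sum_mul_sum, Finset.mul_sum]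
    refine Finset.sum_le_sum fun i _ => ?_
    rw [Finset.mul_sum]
    refine Finset.sum_le_sum fun j _ => ?_
    have h2 := h i j
    rw [norm_mul, norm_mul] at h2
    rw [norm_mul, norm_mul, RCLike.norm_conj]
    have hi := hw i
    have hj := hw j
    calc ‖H i j‖ * ‖v i‖ * ‖v j‖ =
        (‖coneWeight β k i z‖ * ‖coneWeight β k j z‖ * ‖H i j‖) *
          (‖v i‖ / ‖coneWeight β k i z‖ * (‖v j‖ / ‖coneWeight β k j z‖)) := by field_simp
      _ ≤ _ := by gcongr
  have h2 : (∑ i, ‖v i‖ / ‖coneWeight β k i z‖) ^ 2 ≤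
      n * ∑ i, (‖v i‖ / ‖coneWeight β k i z‖) ^ 2 := by
    simpa using sq_sum_le_card_mul_sum_sq (s := Finset.univ)
      (f := fun i => ‖v i‖ / ‖coneWeight β k i z‖)
  have h3 : ∑ i, (‖v i‖ / ‖coneWeight β k i z‖) ^ 2 ≤ (β ^ 2)⁻¹ * flatCone β k z v := by
    rw [flatCone, Finset.mul_sum]
    refine Finset.sum_le_sum fun i _ => ?_
    by_cases hik : i = k
    · subst hik
      rw [if_pos rfl, div_pow, norm_coneWeight_self, ← Real.rpow_natCast (‖z i‖ ^ (1 - β)),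
        ← Real.rpow_mul hpos.le, div_eq_mul_inv, ← Real.rpow_neg hpos.le]
      have : -((1 - β) * ((2 : ℕ) : ℝ)) = 2 * (β - 1) := by push_cast; ring
      rw [this]
      apply le_of_eq
      field_simp
    · rw [if_neg hik, coneWeight_of_ne hik]
      have : 1 ≤ (β ^ 2)⁻¹ := (one_le_inv₀ (by positivity)).2 (pow_le_one₀ hβ.le hβ1)
      simp only [norm_one, div_one, one_mul]
      nlinarith [sq_nonneg ‖v i‖]
  calc _ ≤ N * (n * ((β ^ 2)⁻¹ * flatCone β k z v)) := h1.trans (by gcongr; exact h2.trans (by gcongr))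
    _ = _ := by ring

end FrameBounds

end HermitianForms

end KahlerCone

set_option linter.unusedSectionVars false

namespace KahlerCone

/-! ### Change of holomorphic charts, and globally defined functions -/

section Charts

variable {n : ℕ} {X : Type*} [TopologicalSpace X] [ChartedSpace (Cn n) X]
  {D : Set X} {e e' : OpenPartialHomeomorph X (Cn n)} {z : Cn n} {x : X}

theorem isOpen_regTarget (hD : IsClosed D) (e : OpenPartialHomeomorph X (Cn n)) :
    IsOpen (regTarget D e) :=
  e.isOpen_inter_preimage_symm hD.isOpen_compl

theorem mem_regTarget (hx : x ∈ e.source) (hxD : x ∉ D) : e x ∈ regTarget D e :=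
  ⟨e.map_source hx, by rwa [mem_preimage, e.left_inv hx]⟩

theorem isOpen_overlap (e e' : OpenPartialHomeomorph X (Cn n)) :
    IsOpen (e.target ∩ e.symm ⁻¹' e'.source) :=
  e.isOpen_inter_preimage_symm e'.open_source

theorem isHolChart_chartAt [IsManifold 𝓘(ℂ, Cn n) ω X] (x : X) : IsHolChart (chartAt (Cn n) x) :=
  IsManifold.chart_mem_maximalAtlas x

theorem contDiffOn_transition (he : IsHolChart e) (he' : IsHolChart e') :
    ContDiffOn ℂ ω (fun y => e' (e.symm y)) (e.target ∩ e.symm ⁻¹' e'.source) := by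
  have h := IsManifold.compatible_of_mem_maximalAtlas he he'
  rw [contDiffGroupoid, mem_groupoid_of_pregroupoid] at h
  simpa [contDiffPregroupoid, OpenPartialHomeomorph.trans_source] using! h.1

theorem differentiableAt_transition (he : IsHolChart e) (he' : IsHolChart e') (hz : z ∈ e.target)
    (hz' : e.symm z ∈ e'.source) : DifferentiableAt ℂ (fun y => e' (e.symm y)) z :=
  ((contDiffOn_transition he he').differentiableOn (by simp)).differentiableAt
    ((isOpen_overlap e e').mem_nhds ⟨hz, hz'⟩)

theorem jac_mul_jac (he : IsHolChart e) (he' : IsHolChart e') (hz : z ∈ e.target)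
    (hz' : e.symm z ∈ e'.source) : jac e' e (e' (e.symm z)) * jac e e' z = 1 := by
  have h1 := differentiableAt_transition he he' hz hz'
  have h2 : DifferentiableAt ℂ (fun y => e (e'.symm y)) (e' (e.symm z)) :=
    differentiableAt_transition he' he (e'.map_source hz')
      (by rw [e'.left_inv hz']; exact e.map_target hz)
  have hid : (fun y => e (e'.symm (e' (e.symm y)))) =ᶠ[𝓝 z] id :=
    Filter.eventually_of_mem ((isOpen_overlap e e').mem_nhds ⟨hz, hz'⟩) fun y hy => by
      simp only [e'.left_inv hy.2, e.right_inv hy.1, id]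
  have h3 := (h2.hasFDerivAt.comp z h1.hasFDerivAt).fderiv
  have h4 : fderiv ℂ ((fun y => e (e'.symm y)) ∘ fun y => e' (e.symm y)) z =
      ContinuousLinearMap.id ℂ (Cn n) := by
    rw [← fderiv_id]
    exact hid.fderiv_eq
  rw [h4] at h3
  ext i j
  have h5 := congrArg (fun L : Cn n →L[ℂ] Cn n => L (Pi.single j 1) i) h3
  simp only [ContinuousLinearMap.comp_apply] at h5
  rw [Matrix.mul_apply]
  have h6 : fderiv ℂ (fun y => e' (e.symm y)) z (Pi.single j 1) =
      ∑ a, fderiv ℂ (fun y => e' (e.symm y)) z (Pi.single j 1) a • (Pi.single a 1 : Cn n) := by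
    ext b
    simp [Finset.sum_apply, Pi.single_apply]
  rw [h6, map_sum, Finset.sum_apply] at h5
  simp only [map_smul, Pi.smul_apply, smul_eq_mul] at h5
  simp only [jac, Matrix.of_apply]
  rw [Finset.sum_congr rfl fun a _ => mul_comm _ _, ← h5]
  simp [Matrix.one_apply, Pi.single_apply]

theorem isUnit_det_jac (he : IsHolChart e) (he' : IsHolChart e') (hz : z ∈ e.target)
    (hz' : e.symm z ∈ e'.source) : IsUnit (jac e e' z).det := by
  have h := congrArg Matrix.det (jac_mul_jac he he' hz hz')
  rw [Matrix.det_mul, Matrix.det_one, mul_comm] at h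
  exact IsUnit.of_mul_eq_one _ h

theorem IsForm11.eq_pullForm {g : Coeffs11 n X} (hg : IsForm11 D g) (he : IsHolChart e)
    (he' : IsHolChart e') (hz : z ∈ regTarget D e) (hz' : e.symm z ∈ e'.source) :
    g e z = pullForm (jac e e' z) (g e' (e' (e.symm z))) := by
  ext i j
  rw [pullForm_apply, hg e e' he he' z hz hz']

variable (D) in
/-- The function is of class `C²` on `M = X \ D`. -/
def IsC2Off (n : ℕ) {X : Type*} [TopologicalSpace X] [ChartedSpace (Cn n) X] (D : Set X)
    (f : X → ℝ) : Prop :=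
  ∀ e : OpenPartialHomeomorph X (Cn n), IsHolChart e →
    ContDiffOn ℝ 2 (inChart e f) (regTarget D e)

/-- The coefficients of `∂f` in a chart. -/
noncomputable def gradIn (e : OpenPartialHomeomorph X (Cn n)) (f : X → ℝ) (z : Cn n) :
    Fin n → ℂ := fun i => dz i (inChart e f) z

/-- The coefficients of `∂∂̄f` in a chart. -/
noncomputable def hessIn (e : OpenPartialHomeomorph X (Cn n)) (f : X → ℝ) (z : Cn n) :
    Matrix (Fin n) (Fin n) ℂ := Matrix.of fun i j => ddbar i j (inChart e f) z

theorem withPotential_apply (g : Coeffs11 n X) (f : X → ℝ)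
    (e : OpenPartialHomeomorph X (Cn n)) (z : Cn n) :
    withPotential g f e z = g e z + hessIn e f z := rfl

theorem inChart_eventuallyEq (f : X → ℝ) (hz : z ∈ e.target) (hz' : e.symm z ∈ e'.source) :
    inChart e f =ᶠ[𝓝 z] fun y => inChart e' f (e' (e.symm y)) :=
  Filter.eventually_of_mem ((isOpen_overlap e e').mem_nhds ⟨hz, hz'⟩) fun y hy => by
    simp only [inChart]
    rw [e'.left_inv hy.2]

theorem mem_regTarget_overlap (hz : z ∈ regTarget D e) (hz' : e.symm z ∈ e'.source) :
    e' (e.symm z) ∈ regTarget D e' :=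
  mem_regTarget hz' hz.2

theorem IsC2Off.differentiableAt {f : X → ℝ} (hf : IsC2Off n D f) (hD : IsClosed D)
    (he : IsHolChart e) (hz : z ∈ regTarget D e) : DifferentiableAt ℝ (inChart e f) z :=
  ((hf e he).differentiableOn (by norm_num)).differentiableAt
    ((isOpen_regTarget hD e).mem_nhds hz)

theorem gradIn_eq {f : X → ℝ} (hf : IsC2Off n D f) (hD : IsClosed D) (he : IsHolChart e)
    (he' : IsHolChart e') (hz : z ∈ regTarget D e) (hz' : e.symm z ∈ e'.source) (i : Fin n) :
    gradIn e f z i = ∑ a, jac e e' z a i * gradIn e' f (e' (e.symm z)) a := by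
  have h1 := differentiableAt_transition he he' hz.1 hz'
  rw [gradIn, dz_congr (inChart_eventuallyEq f hz.1 hz'),
    dz_comp (hf.differentiableAt hD he' (mem_regTarget_overlap hz hz')) h1]
  rfl

theorem hessIn_eq {f : X → ℝ} (hf : IsC2Off n D f) (hD : IsClosed D) (he : IsHolChart e)
    (he' : IsHolChart e') (hz : z ∈ regTarget D e) (hz' : e.symm z ∈ e'.source) :
    hessIn e f z = pullForm (jac e e' z) (hessIn e' f (e' (e.symm z))) := by
  have hs : IsOpen (regTarget D e ∩ (e.target ∩ e.symm ⁻¹' e'.source)) :=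
    (isOpen_regTarget hD e).inter (isOpen_overlap e e')
  ext i j
  rw [pullForm_apply, hessIn, Matrix.of_apply, ddbar_congr (inChart_eventuallyEq f hz.1 hz'),
    ddbar_comp hs (isOpen_regTarget hD e') (hf e' he')
      (((contDiffOn_transition he he').mono inter_subset_right).of_le le_top)
      (fun y hy => mem_regTarget_overlap hy.1 hy.2.2) ⟨hz, hz.1, hz'⟩]
  rfl

theorem isForm10_gradIn {f : X → ℝ} (hf : IsC2Off n D f) (hD : IsClosed D) :
    IsForm10 D fun e => gradIn (n := n) e f :=
  fun _ _ he he' _ hz hz' i => gradIn_eq hf hD he he' hz hz' i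

theorem isForm11_of_eq_pullForm {g : Coeffs11 n X}
    (h : ∀ e e' : OpenPartialHomeomorph X (Cn n), IsHolChart e → IsHolChart e' →
      ∀ z ∈ regTarget D e, e.symm z ∈ e'.source →
        g e z = pullForm (jac e e' z) (g e' (e' (e.symm z)))) : IsForm11 D g := by
  intro e e' he he' z hz hz' i j
  rw [← pullForm_apply, h e e' he he' z hz hz']

/-- The form `∂∂̄f`. -/
noncomputable def hessForm (f : X → ℝ) : Coeffs11 n X := fun e z => hessIn e f z

/-- The form `∂f ∧ ∂̄f`. -/
noncomputable def gradSqForm (f : X → ℝ) : Coeffs11 n X := fun e z => sqForm (gradIn e f z)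

theorem isForm11_hessForm {f : X → ℝ} (hf : IsC2Off n D f) (hD : IsClosed D) :
    IsForm11 D (hessForm (n := n) f) :=
  isForm11_of_eq_pullForm fun _ _ he he' _ hz hz' => hessIn_eq hf hD he he' hz hz'

theorem isForm11_gradSqForm {f : X → ℝ} (hf : IsC2Off n D f) (hD : IsClosed D) :
    IsForm11 D (gradSqForm (n := n) f) :=
  isForm11_of_eq_pullForm fun e e' he he' z hz hz' => by
    rw [gradSqForm, gradSqForm, pullForm_sqForm]
    congr 1
    funext i
    exact gradIn_eq hf hD he he' hz hz' i

/-- The trace of a `(1,1)`-form with respect to a metric. -/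
noncomputable def traceAt (g h : Coeffs11 n X) (x : X) : ℝ :=
  traceWith (g (chartAt (Cn n) x) (chartAt (Cn n) x x)) (h (chartAt (Cn n) x) (chartAt (Cn n) x x))

/-- The quotient of the volume forms of two metrics. -/
noncomputable def volRatio (g g' : Coeffs11 n X) (x : X) : ℝ :=
  (g' (chartAt (Cn n) x) (chartAt (Cn n) x x)).det.re /
    (g (chartAt (Cn n) x) (chartAt (Cn n) x x)).det.re

variable [IsManifold 𝓘(ℂ, Cn n) ω X]

/-- The definition uses the preferred chart at x, which varies discontinuously with x. Chart
independence allows continuity and integrals to be examined in one fixed chart. -/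
theorem traceAt_eq {g h : Coeffs11 n X} (hg : IsForm11 D g) (hh : IsForm11 D h)
    (he : IsHolChart e) (hx : x ∈ e.source) (hxD : x ∉ D) :
    traceAt g h x = traceWith (g e (e x)) (h e (e x)) := by
  have hc := isHolChart_chartAt (n := n) x
  have hz := mem_regTarget (mem_chart_source (Cn n) x) hxD
  have hz' : (chartAt (Cn n) x).symm (chartAt (Cn n) x x) = x :=
    (chartAt (Cn n) x).left_inv (mem_chart_source _ x)
  have hz'' : (chartAt (Cn n) x).symm (chartAt (Cn n) x x) ∈ e.source := by rwa [hz']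
  rw [traceAt, hg.eq_pullForm hc he hz hz'', hh.eq_pullForm hc he hz hz'',
    traceWith_pullForm (isUnit_det_jac hc he hz.1 hz''), hz']

theorem volRatio_eq {g g' : Coeffs11 n X} (hg : IsForm11 D g) (hg' : IsForm11 D g')
    (he : IsHolChart e) (hx : x ∈ e.source) (hxD : x ∉ D) :
    volRatio g g' x = (g' e (e x)).det.re / (g e (e x)).det.re := by
  have hc := isHolChart_chartAt (n := n) x
  have hz := mem_regTarget (mem_chart_source (Cn n) x) hxD
  have hz' : (chartAt (Cn n) x).symm (chartAt (Cn n) x x) = x :=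
    (chartAt (Cn n) x).left_inv (mem_chart_source _ x)
  have hz'' : (chartAt (Cn n) x).symm (chartAt (Cn n) x x) ∈ e.source := by rwa [hz']
  have hJ := (isUnit_det_jac hc he hz.1 hz'').ne_zero
  rw [volRatio, hg.eq_pullForm hc he hz hz'', hg'.eq_pullForm hc he hz hz'', det_pullForm,
    det_pullForm, hz', Complex.re_ofReal_mul, Complex.re_ofReal_mul, mul_div_mul_left]
  have := norm_pos_iff.2 hJ
  positivity

/-- The criterion behind all continuity statements on X \ D for quantities defined through the
preferred charts. -/
theorem continuousOn_of_charts {F : X → ℝ} (hD : IsClosed D)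
    (h : ∀ e : OpenPartialHomeomorph X (Cn n), IsHolChart e →
      ∃ F' : Cn n → ℝ, ContinuousOn F' (regTarget D e) ∧
        ∀ x ∈ e.source, x ∉ D → F x = F' (e x)) : ContinuousOn F Dᶜ := by
  intro x hx
  obtain ⟨F', hF', hF⟩ := h _ (isHolChart_chartAt x)
  refine ContinuousAt.continuousWithinAt ?_
  have h1 : ContinuousAt (fun y => F' (chartAt (Cn n) x y)) x :=
    ((hF'.continuousAt ((isOpen_regTarget hD _).mem_nhds
      (mem_regTarget (mem_chart_source _ x) hx))).comp
      ((chartAt (Cn n) x).continuousAt (mem_chart_source _ x)))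
  refine h1.congr ?_
  filter_upwards [hD.isOpen_compl.mem_nhds hx, (chartAt (Cn n) x).open_source.mem_nhds
    (mem_chart_source _ x)] with y hy hy'
  exact (hF y hy' hy).symm

theorem continuousOn_of_inChart {f : X → ℝ} (hD : IsClosed D) (hf : IsC2Off n D f) :
    ContinuousOn f Dᶜ :=
  continuousOn_of_charts hD fun e he => ⟨fun z => (inChart e f z).re,
    Complex.continuous_re.comp_continuousOn (hf e he).continuousOn,
    fun x hx _ => by simp [inChart, e.left_inv hx]⟩

theorem continuousOn_matrix_inv {s : Set (Cn n)} {G : Cn n → Matrix (Fin n) (Fin n) ℂ}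
    (hG : ∀ i j, ContinuousOn (fun z => G z i j) s) (hdet : ∀ z ∈ s, (G z).det ≠ 0) (i j : Fin n) :
    ContinuousOn (fun z => (G z)⁻¹ i j) s := by
  intro z hz
  have h1 : ContinuousWithinAt G s z := by
    refine tendsto_pi_nhds.2 fun a => tendsto_pi_nhds.2 fun b => hG a b z hz
  have h2 : ContinuousAt (Inv.inv : Matrix (Fin n) (Fin n) ℂ → _) (G z) :=
    continuousAt_matrix_inv _ (NormedRing.inverse_continuousAt (Units.mk0 _ (hdet z hz)))
  have h3 := h2.comp_continuousWithinAt h1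
  exact tendsto_pi_nhds.1 (tendsto_pi_nhds.1 h3 i) j

theorem continuousOn_traceWith {s : Set (Cn n)} {G H : Cn n → Matrix (Fin n) (Fin n) ℂ}
    (hG : ∀ i j, ContinuousOn (fun z => G z i j) s) (hdet : ∀ z ∈ s, (G z).det ≠ 0)
    (hH : ∀ i j, ContinuousOn (fun z => H z i j) s) :
    ContinuousOn (fun z => traceWith (G z) (H z)) s := by
  simp only [traceWith, Matrix.trace, Matrix.diag, Matrix.mul_apply]
  exact Complex.continuous_re.comp_continuousOn (continuousOn_finsetSum _ fun i _ =>
    continuousOn_finsetSum _ fun j _ => (continuousOn_matrix_inv hG hdet i j).mul (hH j i))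

end Charts

end KahlerCone

namespace KahlerCone

/-! ### The volume measure of a metric -/

section Measure

variable {n : ℕ} {X : Type*} [TopologicalSpace X] [ChartedSpace (Cn n) X]
  [MeasurableSpace X] [BorelSpace X]
  {D : Set X} {β : ℝ} {g g' : Coeffs11 n X} {e e' : OpenPartialHomeomorph X (Cn n)} {A : Set X}

/-- The density of the volume form in a chart. -/
noncomputable def chartDensity (g : Coeffs11 n X) (e : OpenPartialHomeomorph X (Cn n))
    (z : Cn n) : ℝ≥0∞ := ENNReal.ofReal (n.factorial * 2 ^ n * (g e z).det.re)

/-- The inverse chart is controlled only on its target, so measurability is proved for the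
restriction to that subtype and then pushed forward. -/
theorem measurableSet_target_inter_preimage (e : OpenPartialHomeomorph X (Cn n))
    (hA : MeasurableSet A) : MeasurableSet (e.target ∩ e.symm ⁻¹' A) := by
  have h1 : Measurable (e.target.domRestrict e.symm) :=
    (continuousOn_iff_continuous_domRestrict.1 e.continuousOn_symm).measurable
  have h2 := MeasurableSet.subtype_image e.open_target.measurableSet (h1 hA)
  convert! h2 using 1
  ext z
  simp only [mem_inter_iff, mem_preimage, mem_image, Subtype.exists, domRestrict_apply,
    exists_and_right, exists_eq_right, exists_prop]

theorem aemeasurable_symm (e : OpenPartialHomeomorph X (Cn n)) (f : Cn n → ℝ≥0∞) :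
    AEMeasurable e.symm ((volume.restrict e.target).withDensity f) :=
  (e.continuousOn_symm.aemeasurable e.open_target.measurableSet).mono_ac
    (withDensity_absolutelyContinuous _ _)

theorem chartVolume_eq (g : Coeffs11 n X) (e : OpenPartialHomeomorph X (Cn n)) :
    chartVolume g e =
      Measure.map e.symm ((volume.restrict e.target).withDensity (chartDensity g e)) := rfl

theorem chartVolume_apply (g : Coeffs11 n X) (e : OpenPartialHomeomorph X (Cn n))
    (hA : MeasurableSet A) :
    chartVolume g e A = ∫⁻ z in e.target ∩ e.symm ⁻¹' A, chartDensity g e z := by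
  rw [chartVolume, Measure.map_apply_of_aemeasurable (aemeasurable_symm e _) hA,
    withDensity_apply', Measure.restrict_restrict' e.open_target.measurableSet, inter_comm]
  rfl

/-- The chart need not be adapted to D. Locally the preimage of D is the image of a piece of a
coordinate hyperplane under a differentiable transition map from a divisor chart, and such maps
preserve null sets. -/
theorem measure_preimage_divisor (hD : IsSmoothHypersurface n D) (he : IsHolChart e) :
    volume (e.target ∩ e.symm ⁻¹' D) = 0 := by
  refine measure_null_of_locally_null _ fun z hz => ?_
  obtain ⟨e', k, ⟨he', hk⟩, hp⟩ := hD.2 _ hz.2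
  refine ⟨(e.target ∩ e.symm ⁻¹' D) ∩ (e.target ∩ e.symm ⁻¹' e'.source),
    inter_mem_nhdsWithin _ ((isOpen_overlap e e').mem_nhds ⟨hz.1, hp⟩), ?_⟩
  set T : Set (Cn n) := (e'.target ∩ e'.symm ⁻¹' e.source) ∩ {w | w k = 0}
  have hT : volume T = 0 := measure_mono_null inter_subset_right (measure_coord_eq_zero k)
  have hd : DifferentiableOn ℝ (fun w => e (e'.symm w)) T := fun w hw =>
    ((differentiableAt_transition he' he hw.1.1 hw.1.2).restrictScalars ℝ).differentiableWithinAt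
  refine measure_mono_null ?_
    (addHaar_image_eq_zero_of_differentiableOn_of_addHaar_eq_zero volume hd hT)
  rintro y ⟨⟨hy1, hy2⟩, -, hy3⟩
  refine ⟨e' (e.symm y), ⟨⟨e'.map_source hy3, ?_⟩, (hk _ hy3).1 hy2⟩, ?_⟩
  · rw [mem_preimage, e'.left_inv hy3]
    exact e.map_target hy1
  · beta_reduce
    rw [e'.left_inv hy3, e.right_inv hy1]

theorem ae_notMem_preimage_divisor (hD : IsSmoothHypersurface n D) (he : IsHolChart e) :
    ∀ᵐ y : Cn n, y ∉ e.target ∩ e.symm ⁻¹' D :=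
  measure_eq_zero_iff_ae_notMem.1 (measure_preimage_divisor hD he)

/-- The real determinant of a complex linear map is the norm of its complex determinant from ℂ to ℝ,
that is, its squared modulus. -/
theorem abs_det_fderiv_transition (e e' : OpenPartialHomeomorph X (Cn n)) (z : Cn n) :
    |((fderiv ℂ (fun y => e' (e.symm y)) z).restrictScalars ℝ).det| = ‖(jac e e' z).det‖ ^ 2 := by
  set L := fderiv ℂ (fun y => e' (e.symm y)) z
  have h1 : (L.restrictScalars ℝ).det =
      LinearMap.det ((L : Cn n →ₗ[ℂ] Cn n).restrictScalars ℝ) := rfl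
  have h2 : jac e e' z = LinearMap.toMatrix' (L : Cn n →ₗ[ℂ] Cn n) := by
    ext a i
    rw [LinearMap.toMatrix'_apply]
    rfl
  rw [h1, LinearMap.det_restrictScalars, Algebra.norm_complex_apply, h2, LinearMap.det_toMatrix',
    Complex.normSq_eq_norm_sq, abs_of_nonneg (by positivity)]

/-- Change of variables: the squared modulus of the complex Jacobian in the volume form is exactly
the real Jacobian. The transformation law holds only off D, which is a null set. -/
theorem chartVolume_apply_eq (hD : IsSmoothHypersurface n D) (hg : IsForm11 D g)
    (he : IsHolChart e) (he' : IsHolChart e') (hA : MeasurableSet A) (hAe : A ⊆ e.source)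
    (hAe' : A ⊆ e'.source) : chartVolume g e A = chartVolume g e' A := by
  have hset : e'.target ∩ e'.symm ⁻¹' A =
      (fun y => e' (e.symm y)) '' (e.target ∩ e.symm ⁻¹' A) := by
    ext w
    constructor
    · rintro ⟨hw, hwA⟩
      refine ⟨e (e'.symm w), ⟨e.map_source (hAe hwA), ?_⟩, ?_⟩
      · rw [mem_preimage, e.left_inv (hAe hwA)]
        exact hwA
      · beta_reduce
        rw [e.left_inv (hAe hwA), e'.right_inv hw]
    · rintro ⟨y, ⟨hy, hyA⟩, rfl⟩
      refine ⟨e'.map_source (hAe' hyA), ?_⟩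
      rw [mem_preimage, e'.left_inv (hAe' hyA)]
      exact hyA
  have hinj : InjOn (fun y => e' (e.symm y)) (e.target ∩ e.symm ⁻¹' A) := by
    intro y hy w hw h
    exact e.symm.injOn hy.1 hw.1 (e'.injOn (hAe' hy.2) (hAe' hw.2) h)
  have hms := measurableSet_target_inter_preimage e hA
  rw [chartVolume_apply g e hA, chartVolume_apply g e' hA, hset,
    lintegral_image_eq_lintegral_abs_det_fderiv_mul volume hms (fun y hy =>
      ((differentiableAt_transition he he' hy.1 (hAe' hy.2)).hasFDerivAt.restrictScalars
        ℝ).hasFDerivWithinAt) hinj]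
  refine setLIntegral_congr_fun_ae hms ?_
  have hnull := ae_notMem_preimage_divisor hD he
  filter_upwards [hnull] with y hyD hy
  have hyr : y ∈ regTarget D e := ⟨hy.1, fun h => hyD ⟨hy.1, h⟩⟩
  rw [abs_det_fderiv_transition, chartDensity, chartDensity,
    ← ENNReal.ofReal_mul (by positivity), hg.eq_pullForm he he' hyr (hAe' hy.2), det_pullForm,
    Complex.re_ofReal_mul]
  congr 1
  ring

theorem chartVolume_restrict_source (g : Coeffs11 n X) (e : OpenPartialHomeomorph X (Cn n)) :
    (chartVolume g e).restrict e.source = chartVolume g e := by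
  ext A hA
  rw [Measure.restrict_apply hA, chartVolume_apply g e (hA.inter e.open_source.measurableSet),
    chartVolume_apply g e hA]
  congr 2
  ext z
  simp only [mem_inter_iff, mem_preimage, and_congr_right_iff, and_iff_left_iff_imp]
  exact fun hz _ => e.map_target hz

section Vol

variable [IsManifold 𝓘(ℂ, Cn n) ω X] [CompactSpace X] [Nonempty X]

/-- Justifies the gluing in `vol`: on each disjoint piece of the cover the preferred chart and `e`
define the same measure, so the pieces add up. -/
theorem vol_restrict_source (hD : IsSmoothHypersurface n D) (hg : IsForm11 D g)
    (he : IsHolChart e) : (vol g).restrict e.source = chartVolume g e := by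
  set c := fun m => chartAt (Cn n) (chartCover n X m)
  have hc : ∀ m, IsHolChart (c m) := fun m => isHolChart_chartAt _
  have hcov : ⋃ m, disjointed (fun l => (c l).source) m = univ := by
    rw [iUnion_disjointed]
    exact Classical.choose_spec (exists_chart_cover n X)
  have hmeas : ∀ m, MeasurableSet (disjointed (fun l => (c l).source) m) :=
    MeasurableSet.disjointed fun l => (c l).open_source.measurableSet
  have hdis := disjoint_disjointed fun l => (c l).source
  ext A hA
  have hAe := hA.inter e.open_source.measurableSet
  rw [Measure.restrict_apply hA, ← chartVolume_restrict_source g e, Measure.restrict_apply hA, vol,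
    Measure.sum_apply _ hAe]
  have h1 : chartVolume g e (A ∩ e.source) =
      ∑' m, chartVolume g e (A ∩ e.source ∩ disjointed (fun l => (c l).source) m) := by
    rw [← measure_iUnion, ← inter_iUnion, hcov, inter_univ]
    · exact fun i j hij => (hdis hij).mono inter_subset_right inter_subset_right
    · exact fun m => hAe.inter (hmeas m)
  rw [h1]
  congr 1
  funext m
  rw [Measure.restrict_apply hAe]
  exact chartVolume_apply_eq hD hg (hc m) he (hAe.inter (hmeas m))
    (inter_subset_right.trans (disjointed_subset _ _))
    (inter_subset_left.trans inter_subset_right)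

theorem measure_eq_of_restrict_chart {μ ν : Measure X}
    (h : ∀ x : X, μ.restrict (chartAt (Cn n) x).source = ν.restrict (chartAt (Cn n) x).source) :
    μ = ν :=
  Measure.ext_of_iUnion_eq_univ (Classical.choose_spec (exists_chart_cover n X)) fun _ => h _

theorem vol_divisor (hD : IsSmoothHypersurface n D) (hg : IsForm11 D g) : vol g D = 0 := by
  have h1 : D ⊆ ⋃ m, D ∩ (chartAt (Cn n) (chartCover n X m)).source := by
    rw [← inter_iUnion, show ⋃ m, (chartAt (Cn n) (chartCover n X m)).source = univ from
      Classical.choose_spec (exists_chart_cover n X), inter_univ]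
  refine measure_mono_null h1 (measure_iUnion_null fun m => ?_)
  rw [← Measure.restrict_apply hD.1.measurableSet,
    vol_restrict_source hD hg (isHolChart_chartAt _), chartVolume_apply _ _ hD.1.measurableSet]
  exact setLIntegral_measure_zero _ _ (measure_preimage_divisor hD (isHolChart_chartAt _))

theorem ae_notMem_divisor (hD : IsSmoothHypersurface n D) (hg : IsForm11 D g) :
    ∀ᵐ x ∂(vol g), x ∉ D := by
  rw [ae_iff]
  simpa using vol_divisor hD hg

theorem aestronglyMeasurable_of_continuousOn (hD : IsSmoothHypersurface n D) (hg : IsForm11 D g)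
    {F : X → ℝ} (hF : ContinuousOn F Dᶜ) : AEStronglyMeasurable F (vol g) := by
  have h : (vol g).restrict Dᶜ = vol g :=
    Measure.restrict_eq_self_of_ae_mem (ae_notMem_divisor hD hg)
  rw [← h]
  exact (hF.aemeasurable hD.1.isOpen_compl.measurableSet).aestronglyMeasurable

theorem aemeasurable_chartDensity (hD : IsSmoothHypersurface n D) (hg : IsKahlerConeMetric D β g)
    (he : IsHolChart e) : AEMeasurable (chartDensity g e) (volume.restrict e.target) := by
  have h1 : volume.restrict e.target = volume.restrict (regTarget D e) := by
    refine Measure.restrict_congr_set ?_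
    have hnull := ae_notMem_preimage_divisor hD he
    filter_upwards [hnull] with y hy
    refine propext ⟨fun h => ⟨h, fun h' => hy ⟨h, h'⟩⟩, fun h => h.1⟩
  rw [h1]
  refine ContinuousOn.aemeasurable ?_ (isOpen_regTarget hD.1 e).measurableSet
  exact ENNReal.continuous_ofReal.comp_continuousOn (continuousOn_const.mul
    (Complex.continuous_re.comp_continuousOn (contDiffOn_det fun i j =>
      hg.smooth e he i j).continuousOn))

theorem integral_vol_of_support (hD : IsSmoothHypersurface n D) (hg : IsKahlerConeMetric D β g)
    (he : IsHolChart e) {F : X → ℝ} (hF : ContinuousOn F Dᶜ) (h0 : ∀ x ∉ e.source, F x = 0) :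
    ∫ x, F x ∂(vol g) =
      ∫ z in e.target, (n.factorial * 2 ^ n * (g e z).det.re) * F (e.symm z) := by
  have hr := vol_restrict_source hD hg.isForm he
  rw [← setIntegral_eq_integral_of_forall_compl_eq_zero h0, hr]
  have hm : AEStronglyMeasurable F (chartVolume g e) := by
    rw [← hr]
    exact (aestronglyMeasurable_of_continuousOn hD hg.isForm hF).restrict
  rw [chartVolume_eq] at hm ⊢
  rw [integral_map (aemeasurable_symm e _) hm,
    integral_withDensity_eq_integral_toReal_smul₀ (aemeasurable_chartDensity hD hg he)
      (ae_of_all _ fun z => ENNReal.ofReal_lt_top)]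
  have hnull := ae_notMem_preimage_divisor hD he
  refine setIntegral_congr_ae e.open_target.measurableSet ?_
  filter_upwards [hnull] with z hz hze
  have := det_re_pos (hg.posDef e he z ⟨hze, fun h => hz ⟨hze, h⟩⟩)
  rw [chartDensity, ENNReal.toReal_ofReal (by positivity), smul_eq_mul]

theorem continuousOn_volRatio (hD : IsClosed D) (hg : IsKahlerConeMetric D β g)
    (hg' : IsKahlerConeMetric D β g') : ContinuousOn (volRatio g g') Dᶜ := by
  refine continuousOn_of_charts (n := n) hD fun e he =>
    ⟨fun z => (g' e z).det.re / (g e z).det.re, ?_, fun x hx hxD =>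
      volRatio_eq hg.isForm hg'.isForm he hx hxD⟩
  refine ContinuousOn.div ?_ ?_ fun z hz => (det_re_pos (hg.posDef e he z hz)).ne'
  · exact Complex.continuous_re.comp_continuousOn (contDiffOn_det fun i j =>
      hg'.smooth e he i j).continuousOn
  · exact Complex.continuous_re.comp_continuousOn (contDiffOn_det fun i j =>
      hg.smooth e he i j).continuousOn

/-- Refers the volumes of different metrics to one fixed measure, so that derivatives and limits of
integrals against moving metrics can be taken under the integral sign. -/
theorem vol_eq_withDensity (hD : IsSmoothHypersurface n D) (hg : IsKahlerConeMetric D β g)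
    (hg' : IsKahlerConeMetric D β g') :
    vol g' = (vol g).withDensity fun x => ENNReal.ofReal (volRatio g g' x) := by
  refine measure_eq_of_restrict_chart (n := n) fun x => ?_
  set e := chartAt (Cn n) x
  have he : IsHolChart e := isHolChart_chartAt x
  have hm : AEMeasurable (fun x => ENNReal.ofReal (volRatio g g' x)) (vol g) :=
    (aestronglyMeasurable_of_continuousOn hD hg.isForm
      (continuousOn_volRatio hD.1 hg hg')).aemeasurable.ennreal_ofReal
  have hm' : AEMeasurable (fun x => ENNReal.ofReal (volRatio g g' x)) (chartVolume g e) := by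
    rw [← vol_restrict_source hD hg.isForm he]
    exact hm.restrict
  rw [restrict_withDensity e.open_source.measurableSet, vol_restrict_source hD hg'.isForm he,
    vol_restrict_source hD hg.isForm he]
  ext A hA
  have hAm := hm'.indicator hA
  rw [withDensity_apply _ hA, chartVolume_apply _ _ hA, ← lintegral_indicator hA]
  rw [chartVolume_eq] at hAm ⊢
  have hAc : AEMeasurable
      (fun a => A.indicator (fun x => ENNReal.ofReal (volRatio g g' x)) (e.symm a))
      ((volume.restrict e.target).withDensity (chartDensity g e)) :=
    hAm.comp_aemeasurable (aemeasurable_symm e _)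
  rw [lintegral_map' hAm (aemeasurable_symm e _),
    lintegral_withDensity_eq_lintegral_mul₀' (aemeasurable_chartDensity hD hg he) hAc,
    ← inter_eq_left.2 (inter_subset_left : e.target ∩ e.symm ⁻¹' A ⊆ e.target),
    ← setLIntegral_indicator (measurableSet_target_inter_preimage e hA)]
  refine setLIntegral_congr_fun_ae e.open_target.measurableSet ?_
  filter_upwards [ae_notMem_preimage_divisor hD he] with z hz hze
  have hzr : z ∈ regTarget D e := ⟨hze, fun h => hz ⟨hze, h⟩⟩
  rw [Pi.mul_apply]
  by_cases hzA : e.symm z ∈ A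
  · have hzA' : z ∈ e.target ∩ e.symm ⁻¹' A := ⟨hze, hzA⟩
    rw [indicator_of_mem hzA', indicator_of_mem hzA,
      volRatio_eq hg.isForm hg'.isForm he (e.map_target hze) hzr.2, e.right_inv hze, chartDensity,
      chartDensity, ← ENNReal.ofReal_mul]
    · congr 1
      have := (det_re_pos (hg.posDef e he z hzr)).ne'
      field_simp
    · have := det_re_pos (hg.posDef e he z hzr)
      positivity
  · have hzA' : z ∉ e.target ∩ e.symm ⁻¹' A := fun h => hzA h.2
    rw [indicator_of_notMem hzA', indicator_of_notMem hzA, mul_zero]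

end Vol

end Measure

end KahlerCone

namespace KahlerCone

/-! ### Functions with two bounded derivatives in the cone frame -/

section ConeFunctions

variable {n : ℕ} {X : Type*} [TopologicalSpace X] [ChartedSpace (Cn n) X]
  {D : Set X} {β : ℝ} {g h : Coeffs11 n X} {e e' : OpenPartialHomeomorph X (Cn n)}
  {f : X → ℝ} {k : Fin n}

/-- The function is of class `C²` on `M`, and near every point of `X` the function and the
components of `∂f` and `∂∂̄f` in the cone frame are bounded. -/
structure IsC2Cone (n : ℕ) {X : Type*} [TopologicalSpace X] [ChartedSpace (Cn n) X]
    (D : Set X) (β : ℝ) (f : X → ℝ) : Prop where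
  c2 : IsC2Off n D f
  bdd : ∀ p : X, ∃ (e : OpenPartialHomeomorph X (Cn n)) (k : Fin n), IsDivisorChart D e k ∧
    p ∈ e.source ∧ ∃ U ∈ 𝓝 (e p), ∃ N : ℝ, ∀ z ∈ U ∩ regTarget D e, ‖inChart e f z‖ ≤ N ∧
      (∀ i, ‖coneWeight β k i z * gradIn e f z i‖ ≤ N) ∧
      ∀ i j, ‖coneWeight β k i z * coneWeight β k j z * hessIn e f z i j‖ ≤ N

theorem IsDivisorChart.coord_ne_zero (he : IsDivisorChart D e k) {z : Cn n}
    (hz : z ∈ regTarget D e) : z k ≠ 0 := fun h =>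
  hz.2 ((he.2 _ (e.map_target hz.1)).2 (by rwa [e.right_inv hz.1]))

theorem IsDivisorChart.mem_regTarget (he : IsDivisorChart D e k) {z : Cn n}
    (hz : z ∈ e.target) (hk : z k ≠ 0) : z ∈ regTarget D e :=
  ⟨hz, fun h => hk (by have := (he.2 _ (e.map_target hz)).1 h; rwa [e.right_inv hz] at this)⟩

theorem Holder2LE.bounds {α N : ℝ} {U : Set (Cn n)} (he : IsDivisorChart D e k)
    (hf : Holder2LE β α k (U ∩ e.target) N (inChart e f)) {z : Cn n}
    (hz : z ∈ U ∩ regTarget D e) : ‖inChart e f z‖ ≤ N ∧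
      (∀ i, ‖coneWeight β k i z * gradIn e f z i‖ ≤ N) ∧
      ∀ i j, ‖coneWeight β k i z * coneWeight β k j z * hessIn e f z i j‖ ≤ N :=
  have hz' : z ∈ U ∩ e.target := ⟨hz.1, hz.2.1⟩
  have hk := he.coord_ne_zero hz.2
  ⟨hf.1.1 z hz' hk, fun i => (hf.2.1 i).1 z hz' hk, fun i j => (hf.2.2 i j).1 z hz' hk⟩

theorem MemHolder2.isC2Cone {α : ℝ} (hf : MemHolder2 n D β α f) : IsC2Cone n D β f where
  c2 := hf.1
  bdd p := by
    obtain ⟨e, k, he, hp, U, hU, N, hN⟩ := hf.2 p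
    exact ⟨e, k, he, hp, U, hU, N, fun z hz => hN.bounds he hz⟩

variable (D) in
/-- The form `h` is bounded by `C` times the metric `g`. -/
def FormLE (g h : Coeffs11 n X) (C : ℝ) : Prop :=
  ∀ e : OpenPartialHomeomorph X (Cn n), IsHolChart e → ∀ z ∈ regTarget D e, ∀ v,
    |quadForm (h e z) v| ≤ C * quadForm (g e z) v

theorem quadForm_bound_transfer (hg : IsForm11 D g) (hh : IsForm11 D h) (he : IsHolChart e)
    (he' : IsHolChart e') {C : ℝ} {z : Cn n} (hz : z ∈ regTarget D e) (hz' : e.symm z ∈ e'.source)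
    (hb : ∀ v, |quadForm (h e' (e' (e.symm z))) v| ≤ C * quadForm (g e' (e' (e.symm z))) v)
    (v : Fin n → ℂ) : |quadForm (h e z) v| ≤ C * quadForm (g e z) v := by
  rw [hg.eq_pullForm he he' hz hz', hh.eq_pullForm he he' hz hz', quadForm_pullForm,
    quadForm_pullForm]
  exact hb _

theorem mem_nhds_chart_preimage {p : X} (hp : p ∈ e.source) {U : Set (Cn n)}
    (hU : U ∈ 𝓝 (e p)) : e.source ∩ e ⁻¹' U ∈ 𝓝 p :=
  inter_mem (e.open_source.mem_nhds hp) ((e.continuousAt hp).preimage_mem_nhds hU)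

theorem quadForm_nonneg_of_metric (hg : IsKahlerConeMetric D β g) (he : IsHolChart e) {z : Cn n}
    (hz : z ∈ regTarget D e) (v : Fin n → ℂ) : 0 ≤ quadForm (g e z) v :=
  quadForm_nonneg (hg.posDef e he z hz).posSemidef v

/-- Local bounds for a family of forms give global bounds, by compactness. -/
theorem eventually_formLE [CompactSpace X] {ι : Type*} {l : Filter ι} {h : ι → Coeffs11 n X}
    (hg : IsForm11 D g) {T : Set ι} (hT : T ∈ l) (hh : ∀ t ∈ T, IsForm11 D (h t)) {C : ℝ}
    (hloc : ∀ p : X, ∃ e : OpenPartialHomeomorph X (Cn n), IsHolChart e ∧ p ∈ e.source ∧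
      ∃ U ∈ 𝓝 (e p), ∀ᶠ t in l, ∀ z ∈ U ∩ regTarget D e, ∀ v,
        |quadForm (h t e z) v| ≤ C * quadForm (g e z) v) :
    ∀ᶠ t in l, FormLE D g (h t) C := by
  have key : ∀ᶠ t in l, ∀ e : OpenPartialHomeomorph X (Cn n), IsHolChart e →
      ∀ z ∈ regTarget D e, e.symm z ∈ (univ : Set X) → ∀ v,
        |quadForm (h t e z) v| ≤ C * quadForm (g e z) v := by
    refine isCompact_univ.induction_on (p := fun s : Set X => ∀ᶠ t in l,
      ∀ e : OpenPartialHomeomorph X (Cn n), IsHolChart e → ∀ z ∈ regTarget D e, e.symm z ∈ s →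
        ∀ v, |quadForm (h t e z) v| ≤ C * quadForm (g e z) v) ?_ ?_ ?_ ?_
    · exact Eventually.of_forall fun t e _ z _ hz => hz.elim
    · exact fun s s' hss' hs' => hs'.mono fun t ht e he z hz hzs => ht e he z hz (hss' hzs)
    · intro s s' hs hs'
      filter_upwards [hs, hs'] with t h1 h2 e he z hz hzs
      exact hzs.elim (h1 e he z hz) (h2 e he z hz)
    · intro p _
      obtain ⟨e', he', hp, U, hU, hb⟩ := hloc p
      refine ⟨_, mem_nhdsWithin_of_mem_nhds (mem_nhds_chart_preimage hp hU), ?_⟩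
      filter_upwards [hb, hT] with t ht htT e he z hz hzs v
      exact quadForm_bound_transfer hg (hh t htT) he he' hz hzs.1
        (ht _ ⟨hzs.2, mem_regTarget_overlap hz hzs.1⟩) v
  exact key.mono fun t ht e he z hz => ht e he z hz (mem_univ _)

/-- Obtained from `eventually_formLE` for the family C⁻¹·h as C → ∞ with bound 1: near each point
all sufficiently large C are admissible, whatever the local constant. -/
theorem exists_formLE [CompactSpace X] (hg : IsKahlerConeMetric D β g) (hh : IsForm11 D h)
    (hloc : ∀ p : X, ∃ e : OpenPartialHomeomorph X (Cn n), IsHolChart e ∧ p ∈ e.source ∧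
      ∃ U ∈ 𝓝 (e p), ∃ C, ∀ z ∈ U ∩ regTarget D e, ∀ v,
        |quadForm (h e z) v| ≤ C * quadForm (g e z) v) :
    ∃ C, 0 ≤ C ∧ FormLE D g h C := by
  have h1 : ∀ᶠ C : ℝ in atTop, FormLE D (fun e z => g e z) (fun e z => ((C⁻¹ : ℝ) : ℂ) • h e z) 1 := by
    refine eventually_formLE hg.isForm univ_mem (fun C _ => ?_) fun p => ?_
    · intro e e' he he' z hz hz' i j
      simp only [Matrix.smul_apply, smul_eq_mul, hh e e' he he' z hz hz' i j, Finset.mul_sum]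
      exact Finset.sum_congr rfl fun a _ => Finset.sum_congr rfl fun b _ => by ring
    · obtain ⟨e, he, hp, U, hU, C, hC⟩ := hloc p
      refine ⟨e, he, hp, U, hU, ?_⟩
      filter_upwards [eventually_ge_atTop C, eventually_gt_atTop 0] with C' hC' h0 z hz v
      rw [quadForm_smul, abs_mul, abs_of_pos (inv_pos.2 h0), one_mul, inv_mul_le_iff₀ h0]
      exact (hC z hz v).trans (mul_le_mul_of_nonneg_right hC'
        (quadForm_nonneg_of_metric hg he hz.2 v))
  obtain ⟨C, hC, h0⟩ := (h1.and (eventually_gt_atTop 0)).exists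
  refine ⟨C, h0.le, fun e he z hz v => ?_⟩
  have h2 := hC e he z hz v
  rwa [quadForm_smul, abs_mul, abs_of_pos (inv_pos.2 h0), one_mul, inv_mul_le_iff₀ h0] at h2

theorem quadForm_bound_of_frame (hβ : 0 < β) (hβ1 : β ≤ 1) (he : IsDivisorChart D e k) {c N : ℝ}
    (hc : 0 < c) (hN : 0 ≤ N) {z : Cn n} (hz : z ∈ regTarget D e)
    {G H : Matrix (Fin n) (Fin n) ℂ} (hq : ∀ v, c⁻¹ * flatCone β k z v ≤ quadForm G v)
    (hH : ∀ i j, ‖coneWeight β k i z * coneWeight β k j z * H i j‖ ≤ N) (v : Fin n → ℂ) :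
    |quadForm H v| ≤ N * n * (β ^ 2)⁻¹ * c * quadForm G v := by
  have h1 := abs_quadForm_le_of_norm_frame_le hβ hβ1 (he.coord_ne_zero hz) hN hH v
  have h2 := hq v
  rw [inv_mul_le_iff₀ hc] at h2
  calc _ ≤ N * n * (β ^ 2)⁻¹ * flatCone β k z v := h1
    _ ≤ N * n * (β ^ 2)⁻¹ * (c * quadForm G v) := by gcongr
    _ = _ := by ring

theorem IsC2Cone.exists_formLE_hess [CompactSpace X] (hβ : 0 < β) (hβ1 : β ≤ 1) (hD : IsClosed D)
    (hg : IsKahlerConeMetric D β g) (hf : IsC2Cone n D β f) :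
    ∃ C, 0 ≤ C ∧ FormLE D g (hessForm f) C := by
  refine exists_formLE hg (isForm11_hessForm hf.c2 hD) fun p => ?_
  obtain ⟨e, k, he, hp, U, hU, N, hN⟩ := hf.bdd p
  obtain ⟨U', hU', c, hc, hq⟩ := hg.quasiIsometric e k he (e p) (e.map_source hp)
  refine ⟨e, he.1, hp, U ∩ U', inter_mem hU hU', N * n * (β ^ 2)⁻¹ * c, fun z hz v => ?_⟩
  exact quadForm_bound_of_frame hβ hβ1 he hc
    ((norm_nonneg _).trans (hN z ⟨hz.1.1, hz.2⟩).1) hz.2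
    (fun v => (hq z ⟨hz.1.2, hz.2⟩ v).1) (hN z ⟨hz.1.1, hz.2⟩).2.2 v

theorem IsC2Cone.exists_formLE_gradSq [CompactSpace X] (hβ : 0 < β) (hβ1 : β ≤ 1)
    (hD : IsClosed D) (hg : IsKahlerConeMetric D β g) (hf : IsC2Cone n D β f) :
    ∃ C, 0 ≤ C ∧ FormLE D g (gradSqForm f) C := by
  refine exists_formLE hg (isForm11_gradSqForm hf.c2 hD) fun p => ?_
  obtain ⟨e, k, he, hp, U, hU, N, hN⟩ := hf.bdd p
  obtain ⟨U', hU', c, hc, hq⟩ := hg.quasiIsometric e k he (e p) (e.map_source hp)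
  refine ⟨e, he.1, hp, U ∩ U', inter_mem hU hU', N * N * n * (β ^ 2)⁻¹ * c, fun z hz v => ?_⟩
  refine quadForm_bound_of_frame (N := N * N) hβ hβ1 he hc (mul_self_nonneg N) hz.2
    (fun v => (hq z ⟨hz.1.2, hz.2⟩ v).1) (fun i j => ?_) v
  have h1 := (hN z ⟨hz.1.1, hz.2⟩).2.1 i
  have h2 := (hN z ⟨hz.1.1, hz.2⟩).2.1 j
  have h3 : ‖coneWeight β k i z * coneWeight β k j z * gradSqForm f e z i j‖ =
      ‖coneWeight β k i z * gradIn e f z i‖ * ‖coneWeight β k j z * gradIn e f z j‖ := by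
    simp only [gradSqForm, sqForm, Matrix.of_apply, norm_mul, RCLike.norm_conj]
    ring
  rw [h3]
  exact mul_le_mul h1 h2 (norm_nonneg _) ((norm_nonneg _).trans h1)

theorem IsC2Cone.exists_bound [CompactSpace X] (hf : IsC2Cone n D β f) :
    ∃ C, 0 ≤ C ∧ ∀ x ∉ D, |f x| ≤ C := by
  have key : ∃ C : ℝ, 0 ≤ C ∧ ∀ x ∈ (univ : Set X), x ∉ D → |f x| ≤ C := by
    refine isCompact_univ.induction_on
      (p := fun s : Set X => ∃ C : ℝ, 0 ≤ C ∧ ∀ x ∈ s, x ∉ D → |f x| ≤ C) ?_ ?_ ?_ ?_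
    · exact ⟨0, le_rfl, fun x hx => hx.elim⟩
    · exact fun s s' hss' ⟨C, h0, hC⟩ => ⟨C, h0, fun x hx => hC x (hss' hx)⟩
    · rintro s s' ⟨C, h0, hC⟩ ⟨C', -, hC'⟩
      exact ⟨max C C', le_max_of_le_left h0, fun x hx hxD => hx.elim
        (fun h => (hC x h hxD).trans (le_max_left _ _))
        fun h => (hC' x h hxD).trans (le_max_right _ _)⟩
    · intro p _
      obtain ⟨e, k, he, hp, U, hU, N, hN⟩ := hf.bdd p
      refine ⟨_, mem_nhdsWithin_of_mem_nhds (mem_nhds_chart_preimage hp hU), |N|, abs_nonneg N,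
        fun x hx hxD => ?_⟩
      have h1 := (hN (e x) ⟨hx.2, KahlerCone.mem_regTarget hx.1 hxD⟩).1
      rw [inChart, e.left_inv hx.1, Complex.norm_real, Real.norm_eq_abs] at h1
      exact h1.trans (le_abs_self N)
  obtain ⟨C, h0, hC⟩ := key
  exact ⟨C, h0, fun x => hC x (mem_univ x)⟩

theorem differentiableAt_real_inChart (hf : IsC2Off n D f) (hD : IsClosed D) (he : IsHolChart e)
    {z : Cn n} (hz : z ∈ regTarget D e) : DifferentiableAt ℝ (fun y => f (e.symm y)) z := by
  have h := Complex.reCLM.differentiableAt.comp z (hf.differentiableAt hD he hz)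
  exact h

/-! ### Composition with functions of one real variable -/

section Composition

variable {s : Set ℝ} {F : ℝ → ℝ}

theorem hasDerivAt_of_contDiffOn (hs : IsOpen s) (hF : ContDiffOn ℝ 2 F s) {y : ℝ} (hy : y ∈ s) :
    HasDerivAt F (deriv F y) y :=
  ((hF.differentiableOn (by norm_num)).differentiableAt (hs.mem_nhds hy)).hasDerivAt

theorem contDiffOn_deriv_one (hs : IsOpen s) (hF : ContDiffOn ℝ 2 F s) :
    ContDiffOn ℝ 1 (deriv F) s :=
  ((contDiffOn_succ_iff_deriv_of_isOpen (n := 1) hs).1 (by simpa using! hF)).2.2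

theorem hasDerivAt_deriv_of_contDiffOn (hs : IsOpen s) (hF : ContDiffOn ℝ 2 F s) {y : ℝ}
    (hy : y ∈ s) : HasDerivAt (deriv F) (deriv (deriv F) y) y :=
  (((contDiffOn_deriv_one hs hF).differentiableOn (by norm_num)).differentiableAt
    (hs.mem_nhds hy)).hasDerivAt

theorem gradIn_comp (hf : IsC2Off n D f) (hD : IsClosed D) (hs : IsOpen s)
    (hF : ContDiffOn ℝ 2 F s) (hfs : ∀ x ∉ D, f x ∈ s) (he : IsHolChart e) {z : Cn n}
    (hz : z ∈ regTarget D e) (i : Fin n) :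
    gradIn e (fun x => F (f x)) z i = deriv F (f (e.symm z)) * gradIn e f z i :=
  dz_ofReal_comp (u := fun y => f (e.symm y)) (differentiableAt_real_inChart hf hD he hz)
    (hasDerivAt_of_contDiffOn hs hF (hfs _ hz.2)) i

theorem hessIn_comp (hf : IsC2Off n D f) (hD : IsClosed D) (hs : IsOpen s)
    (hF : ContDiffOn ℝ 2 F s) (hfs : ∀ x ∉ D, f x ∈ s) (he : IsHolChart e) {z : Cn n}
    (hz : z ∈ regTarget D e) :
    hessIn e (fun x => F (f x)) z = ((deriv F (f (e.symm z)) : ℝ) : ℂ) • hessIn e f z +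
      ((deriv (deriv F) (f (e.symm z)) : ℝ) : ℂ) • sqForm (gradIn e f z) := by
  ext i j
  have h := ddbar_ofReal_comp (isOpen_regTarget hD e) (u := fun y => f (e.symm y)) (hf e he)
    (fun y hy => hasDerivAt_of_contDiffOn hs hF (hfs _ hy.2))
    (fun y hy => hasDerivAt_deriv_of_contDiffOn hs hF (hfs _ hy.2)) hz i j
  refine h.trans ?_
  simp only [hessIn, sqForm, gradIn, Matrix.add_apply, Matrix.smul_apply, Matrix.of_apply,
    smul_eq_mul, mul_assoc]
  rfl

theorem IsC2Off.comp (hf : IsC2Off n D f) (hF : ContDiffOn ℝ 2 F s)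
    (hfs : ∀ x ∉ D, f x ∈ s) : IsC2Off n D fun x => F (f x) := by
  intro e he
  have h1 : ContDiffOn ℝ 2 (fun y => f (e.symm y)) (regTarget D e) :=
    Complex.reCLM.contDiff.comp_contDiffOn (hf e he)
  exact Complex.ofRealCLM.contDiff.comp_contDiffOn (hF.comp h1 fun y hy => hfs _ hy.2)

/-- The values of f lie in a compact subset of the domain of F, so F, F' and F'' are bounded there.
The quadratic gradient term of the chain rule is bounded in the frame like the Hessian. -/
theorem IsC2Cone.comp (hf : IsC2Cone n D β f) (hD : IsClosed D) (hs : IsOpen s)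
    (hF : ContDiffOn ℝ 2 F s) {K : Set ℝ} (hK : IsCompact K) (hKs : K ⊆ s)
    (hfK : ∀ x ∉ D, f x ∈ K) : IsC2Cone n D β fun x => F (f x) where
  c2 := hf.c2.comp hF fun x hx => hKs (hfK x hx)
  bdd p := by
    obtain ⟨e, k, he, hp, U, hU, N, hN⟩ := hf.bdd p
    have hfs : ∀ x ∉ D, f x ∈ s := fun x hx => hKs (hfK x hx)
    obtain ⟨C₀, h₀⟩ := hK.exists_bound_of_continuousOn (hF.continuousOn.mono hKs)
    obtain ⟨C₁, h₁⟩ := hK.exists_bound_of_continuousOn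
      ((contDiffOn_deriv_one hs hF).continuousOn.mono hKs)
    obtain ⟨C₂, h₂⟩ := hK.exists_bound_of_continuousOn
      (((contDiffOn_deriv_one hs hF).continuousOn_deriv_of_isOpen hs (by norm_num)).mono hKs)
    refine ⟨e, k, he, hp, U, hU, |C₀| + |C₁| * |N| + |C₂| * (|N| * |N|), fun z hz => ?_⟩
    obtain ⟨-, hN1, hN2⟩ := hN z hz
    have hy := hfK _ hz.2.2
    have hN1' : ∀ i, ‖coneWeight β k i z * gradIn e f z i‖ ≤ |N| := fun i =>
      (hN1 i).trans (le_abs_self N)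
    have b0 : 0 ≤ |C₀| := abs_nonneg _
    have b1 : 0 ≤ |C₁| * |N| := by positivity
    have b2 : 0 ≤ |C₂| * (|N| * |N|) := by positivity
    have a1 : ‖((deriv F (f (e.symm z)) : ℝ) : ℂ)‖ ≤ |C₁| := by
      rw [Complex.norm_real]; exact (h₁ _ hy).trans (le_abs_self _)
    have a2 : ‖((deriv (deriv F) (f (e.symm z)) : ℝ) : ℂ)‖ ≤ |C₂| := by
      rw [Complex.norm_real]; exact (h₂ _ hy).trans (le_abs_self _)
    refine ⟨?_, fun i => ?_, fun i j => ?_⟩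
    · rw [inChart, Complex.norm_real]
      linarith [(h₀ _ hy).trans (le_abs_self _)]
    · rw [gradIn_comp hf.c2 hD hs hF hfs he.1 hz.2, mul_left_comm, norm_mul]
      have := mul_le_mul a1 (hN1' i) (norm_nonneg _) (abs_nonneg _)
      linarith
    · rw [hessIn_comp hf.c2 hD hs hF hfs he.1 hz.2]
      have h3 : coneWeight β k i z * coneWeight β k j z *
          (((deriv F (f (e.symm z)) : ℝ) : ℂ) • hessIn e f z +
            ((deriv (deriv F) (f (e.symm z)) : ℝ) : ℂ) • sqForm (gradIn e f z)) i j =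
          ((deriv F (f (e.symm z)) : ℝ) : ℂ) *
            (coneWeight β k i z * coneWeight β k j z * hessIn e f z i j) +
          ((deriv (deriv F) (f (e.symm z)) : ℝ) : ℂ) * ((coneWeight β k i z * gradIn e f z i) *
            (coneWeight β k j z * starRingEnd ℂ (gradIn e f z j))) := by
        simp only [Matrix.add_apply, Matrix.smul_apply, smul_eq_mul, sqForm, Matrix.of_apply]
        ring
      rw [h3]
      refine (norm_add_le _ _).trans ?_
      have c1 := mul_le_mul a1 ((hN2 i j).trans (le_abs_self N)) (norm_nonneg _) (abs_nonneg _)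
      have c2 : ‖coneWeight β k j z * starRingEnd ℂ (gradIn e f z j)‖ ≤ |N| := by
        rw [norm_mul, RCLike.norm_conj, ← norm_mul]
        exact hN1' j
      have c3 := mul_le_mul a2 (mul_le_mul (hN1' i) c2 (norm_nonneg _) (abs_nonneg _))
        (by positivity) (abs_nonneg _)
      rw [← norm_mul] at c1
      rw [← norm_mul, ← norm_mul] at c3
      linarith

end Composition

end ConeFunctions

end KahlerCone

namespace KahlerCone

/-! ### The underlying real manifold and partitions of unity -/

section RealManifold

variable {n : ℕ} {X : Type*} [TopologicalSpace X] [ChartedSpace (Cn n) X]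
  {e e' : OpenPartialHomeomorph X (Cn n)}

theorem contDiffOn_real_transition (he : IsHolChart e) (he' : IsHolChart e') :
    ContDiffOn ℝ ∞ (fun y => e' (e.symm y)) (e.target ∩ e.symm ⁻¹' e'.source) :=
  ((contDiffOn_transition he he').restrict_scalars ℝ).of_le le_top

variable [IsManifold 𝓘(ℂ, Cn n) ω X]

theorem isHolChart_of_mem_atlas (he : e ∈ atlas (Cn n) X) : IsHolChart e :=
  IsManifold.subset_maximalAtlas he

/-- Forgetting the complex structure is needed because cutoffs and partitions of unity exist only in
the real smooth category. -/
theorem isManifold_real (n : ℕ) (X : Type*) [TopologicalSpace X] [ChartedSpace (Cn n) X]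
    [IsManifold 𝓘(ℂ, Cn n) ω X] : IsManifold 𝓘(ℝ, Cn n) ∞ X := by
  refine isManifold_of_contDiffOn _ _ _ fun e e' he he' => ?_
  have h := contDiffOn_real_transition (isHolChart_of_mem_atlas he) (isHolChart_of_mem_atlas he')
  simpa [OpenPartialHomeomorph.trans_source] using! h

theorem mem_maximalAtlas_real (he : IsHolChart e) :
    e ∈ IsManifold.maximalAtlas 𝓘(ℝ, Cn n) ∞ X := by
  have key : ∀ {e e' : OpenPartialHomeomorph X (Cn n)}, IsHolChart e → IsHolChart e' →
      e.symm.trans e' ∈ contDiffGroupoid ∞ 𝓘(ℝ, Cn n) := by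
    intro e e' he he'
    rw [contDiffGroupoid, mem_groupoid_of_pregroupoid]
    constructor
    · simpa [contDiffPregroupoid, OpenPartialHomeomorph.trans_source] using!
        contDiffOn_real_transition he he'
    · have h := contDiffOn_real_transition he' he
      simp only [contDiffPregroupoid, modelWithCornersSelf_coe, modelWithCornersSelf_coe_symm,
        CompTriple.comp_eq, preimage_id_eq, id_eq, range_id, inter_univ,
        OpenPartialHomeomorph.trans_symm_eq_symm_trans_symm, OpenPartialHomeomorph.symm_symm,
        OpenPartialHomeomorph.trans_target, OpenPartialHomeomorph.symm_target]
      exact h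
  rw [IsManifold.maximalAtlas, mem_maximalAtlas_iff]
  exact fun e' he' => ⟨key he (isHolChart_of_mem_atlas he'), key (isHolChart_of_mem_atlas he') he⟩

theorem contDiffOn_inChart_of_contMDiff {ρ : X → ℝ} (hρ : ContMDiff 𝓘(ℝ, Cn n) 𝓘(ℝ) ∞ ρ)
    (he : IsHolChart e) : ContDiffOn ℝ ∞ (inChart e ρ) e.target := by
  have : IsManifold 𝓘(ℝ, Cn n) ∞ X := isManifold_real n X
  have h1 := hρ.comp_contMDiffOn (contMDiffOn_symm_of_mem_maximalAtlas (mem_maximalAtlas_real he))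
  exact Complex.ofRealCLM.contDiff.comp_contDiffOn (contMDiffOn_iff_contDiffOn.1 h1)

/-- A finite smooth partition of unity subordinate to a choice of neighbourhoods. -/
theorem exists_finite_partition [T2Space X] [CompactSpace X] {V : X → Set X}
    (hV : ∀ p, V p ∈ 𝓝 p) : ∃ (t : Finset X) (ρ : X → X → ℝ),
      (∀ p ∈ t, ContMDiff 𝓘(ℝ, Cn n) 𝓘(ℝ) ∞ (ρ p)) ∧ (∀ p ∈ t, tsupport (ρ p) ⊆ V p) ∧
      ∀ x, ∑ p ∈ t, ρ p x = 1 := by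
  have : IsManifold 𝓘(ℝ, Cn n) ∞ X := isManifold_real n X
  obtain ⟨t, -, ht⟩ := isCompact_univ.elim_nhds_subcover (fun p => interior (V p))
    fun p _ => interior_mem_nhds.2 (hV p)
  obtain ⟨f, hf⟩ := SmoothPartitionOfUnity.exists_isSubordinate 𝓘(ℝ, Cn n) isClosed_univ
    (fun p : t => interior (V p)) (fun p => isOpen_interior)
    (fun x hx => by
      obtain ⟨p, hp, hxp⟩ := mem_iUnion₂.1 (ht hx)
      exact mem_iUnion.2 ⟨⟨p, hp⟩, hxp⟩)
  classical
  refine ⟨t, fun p => if hp : p ∈ t then f ⟨p, hp⟩ else 0, fun p hp => ?_, fun p hp => ?_,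
    fun x => ?_⟩
  · simp only [hp, dif_pos]
    exact (f ⟨p, hp⟩).contMDiff
  · simp only [hp, dif_pos]
    exact (hf ⟨p, hp⟩).trans interior_subset
  · have h1 := f.sum_eq_one (mem_univ x)
    rw [finsum_eq_sum_of_fintype] at h1
    rw [← h1, ← Finset.sum_coe_sort t]
    exact Finset.sum_congr rfl fun p _ => by simp

end RealManifold

/-! ### Finiteness and positivity of the volume -/

section Volume

variable {n : ℕ} {X : Type*} [TopologicalSpace X] [ChartedSpace (Cn n) X]
  {D : Set X} {β : ℝ} {g : Coeffs11 n X} {e : OpenPartialHomeomorph X (Cn n)} {k : Fin n}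
  [IsManifold 𝓘(ℂ, Cn n) ω X] [CompactSpace X] [Nonempty X] [MeasurableSpace X] [BorelSpace X]

/-- Every point of `X` lies in the domain of a divisor chart. -/
def HasDivisorCharts (n : ℕ) {X : Type*} [TopologicalSpace X] [ChartedSpace (Cn n) X]
    (D : Set X) : Prop :=
  ∀ p : X, ∃ (e : OpenPartialHomeomorph X (Cn n)) (k : Fin n), IsDivisorChart D e k ∧ p ∈ e.source

theorem IsC2Cone.hasDivisorCharts {f : X → ℝ} (hf : IsC2Cone n D β f) : HasDivisorCharts n D :=
  fun p => by
    obtain ⟨e, k, he, hp, -⟩ := hf.bdd p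
    exact ⟨e, k, he, hp⟩

/-- Near every point, the metric is bounded in the cone frame of a given divisor chart. -/
theorem IsKahlerConeMetric.exists_frame_bound (hβ : 0 < β) (hβ1 : β ≤ 1)
    (hg : IsKahlerConeMetric D β g) (he : IsDivisorChart D e k) {p : X} (hp : p ∈ e.source) :
    ∃ U ∈ 𝓝 (e p), ∃ N : ℝ, 0 ≤ N ∧ ∀ z ∈ U ∩ regTarget D e, ∀ i j,
      ‖coneWeight β k i z * coneWeight β k j z * g e z i j‖ ≤ N := by
  obtain ⟨U, hU, c, hc, hq⟩ := hg.quasiIsometric e k he (e p) (e.map_source hp)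
  exact ⟨U, hU, c, hc.le, fun z hz i j => norm_frame_le_of_quadForm_le hβ hβ1
    (he.coord_ne_zero hz.2) (hg.posDef e he.1 z hz.2) hc.le (fun v => (hq z hz v).2) i j⟩

theorem norm_det_le_of_frame {N C : ℝ}
    (hC : ∀ M : Matrix (Fin n) (Fin n) ℂ, (∀ i j, ‖M i j‖ ≤ N) →
      ‖M.det‖ ≤ C ∧ ∀ i j, ‖M.adjugate i j‖ ≤ C)
    {z : Cn n} (hz : z k ≠ 0) {M : Matrix (Fin n) (Fin n) ℂ}
    (hM : ∀ i j, ‖coneWeight β k i z * coneWeight β k j z * M i j‖ ≤ N) :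
    ‖M.det‖ ≤ C * ‖z k‖ ^ (2 * β - 2) := by
  have h := (hC (frameMatrix β k z M) hM).1
  have hpos : 0 < ‖z k‖ := norm_pos_iff.2 hz
  rw [det_frameMatrix, norm_mul, norm_pow, coneWeight_self, Complex.norm_real, Real.norm_eq_abs,
    abs_of_pos (Real.rpow_pos_of_pos hpos _), ← Real.rpow_natCast, ← Real.rpow_mul hpos.le] at h
  have h2 : ‖z k‖ ^ (2 * β - 2) * ‖z k‖ ^ ((1 - β) * ((2 : ℕ) : ℝ)) = 1 := by
    rw [← Real.rpow_add hpos]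
    norm_num
    ring_nf
    simp
  calc ‖M.det‖ = ‖z k‖ ^ (2 * β - 2) * (‖z k‖ ^ ((1 - β) * ((2 : ℕ) : ℝ)) * ‖M.det‖) := by
        rw [← mul_assoc, h2, one_mul]
    _ ≤ ‖z k‖ ^ (2 * β - 2) * C := by gcongr
    _ = _ := mul_comm _ _

/-- In a divisor chart the volume density is at most a constant times |z_k|^(2β-2), which is locally
integrable for β > 0; compactness of X does the rest. -/
theorem vol_univ_lt_top (hβ : 0 < β) (hβ1 : β ≤ 1) (hD : IsSmoothHypersurface n D)
    (hch : HasDivisorCharts n D) (hg : IsKahlerConeMetric D β g) : vol g univ < ⊤ := by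
  refine isCompact_univ.measure_lt_top_of_nhdsWithin fun p _ => ?_
  obtain ⟨e, k, he, hp⟩ := hch p
  obtain ⟨U, hU, N, hN, hb⟩ := hg.exists_frame_bound hβ hβ1 he hp
  obtain ⟨C, hC0, hC⟩ := exists_det_adjugate_bound n N
  set B := Metric.ball (e p) 1
  have hW : e.source ∩ e ⁻¹' (interior U ∩ B) ∈ 𝓝 p := mem_nhds_chart_preimage hp
    (inter_mem (interior_mem_nhds.2 hU) (Metric.ball_mem_nhds _ one_pos))
  have hWo : IsOpen (e.source ∩ e ⁻¹' (interior U ∩ B)) :=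
    e.isOpen_inter_preimage (isOpen_interior.inter Metric.isOpen_ball)
  refine ⟨_, mem_nhdsWithin_of_mem_nhds hW, ?_⟩
  rw [← inter_eq_self_of_subset_left (inter_subset_left :
    e.source ∩ e ⁻¹' (interior U ∩ B) ⊆ e.source), ← Measure.restrict_apply hWo.measurableSet,
    vol_restrict_source hD hg.isForm he.1, chartVolume_apply _ _ hWo.measurableSet]
  have hint : IntegrableOn (fun z : Cn n => n.factorial * 2 ^ n * (C * ‖z k‖ ^ (2 * β - 2))) B :=
    ((integrableOn_norm_coord_rpow (by linarith) k Metric.isBounded_ball).const_mul C).const_mul _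
  refine lt_of_le_of_lt ?_ hint.2
  refine (lintegral_mono_ae (g := fun z : Cn n =>
    ‖(n.factorial * 2 ^ n * (C * ‖z k‖ ^ (2 * β - 2)) : ℝ)‖ₑ) ?_).trans (lintegral_mono_set ?_)
  · rw [ae_restrict_iff' (measurableSet_target_inter_preimage e hWo.measurableSet)]
    filter_upwards [ae_notMem_preimage_divisor hD he.1] with z hz hzW
    have hzr : z ∈ regTarget D e := ⟨hzW.1, fun h => hz ⟨hzW.1, h⟩⟩
    have hzU : z ∈ U := by
      have := hzW.2.2.1
      rw [e.right_inv hzW.1] at this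
      exact interior_subset this
    have h1 := norm_det_le_of_frame hC (he.coord_ne_zero hzr) (hb z ⟨hzU, hzr⟩)
    rw [chartDensity, ← ofReal_norm]
    refine ENNReal.ofReal_le_ofReal ((le_abs_self _).trans' ?_)
    have := (Complex.re_le_norm (g e z).det).trans h1
    gcongr
  · rintro z ⟨hz, hzW⟩
    have := hzW.2.2
    rwa [e.right_inv hz] at this

/-- In a chart the divisor is a null set, while the target of the chart is a nonempty open set of
positive measure. -/
theorem nonempty_compl_divisor (hD : IsSmoothHypersurface n D) : (Dᶜ : Set X).Nonempty := by
  obtain ⟨x⟩ := ‹Nonempty X›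
  set e := chartAt (Cn n) x
  have hpos : 0 < volume e.target :=
    e.open_target.measure_pos _ ⟨e x, e.map_source (mem_chart_source _ x)⟩
  by_contra h
  rw [not_nonempty_iff_eq_empty, compl_empty_iff] at h
  have h0 := measure_preimage_divisor hD (isHolChart_chartAt (n := n) x)
  rw [h, preimage_univ, inter_univ] at h0
  exact hpos.ne' h0

theorem vol_pos_of_isOpen (hD : IsSmoothHypersurface n D) (hg : IsKahlerConeMetric D β g)
    {W : Set X} (hW : IsOpen W) (hne : (W ∩ Dᶜ).Nonempty) : 0 < vol g W := by
  obtain ⟨x, hxW, hxD⟩ := hne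
  set e := chartAt (Cn n) x
  have he : IsHolChart e := isHolChart_chartAt x
  have hx : x ∈ e.source := mem_chart_source _ x
  rw [pos_iff_ne_zero]
  intro h0
  have h1 : chartVolume g e W = 0 := by
    rw [← vol_restrict_source hD hg.isForm he]
    exact Measure.absolutelyContinuous_of_le Measure.restrict_le_self h0
  rw [chartVolume_apply _ _ hW.measurableSet, lintegral_eq_zero_iff'
    ((aemeasurable_chartDensity hD hg he).mono_set inter_subset_left)] at h1
  have hO : IsOpen (regTarget D e ∩ (e.target ∩ e.symm ⁻¹' W)) :=
    (isOpen_regTarget hD.1 e).inter (e.isOpen_inter_preimage_symm hW)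
  have hpos : 0 < volume (regTarget D e ∩ (e.target ∩ e.symm ⁻¹' W)) :=
    hO.measure_pos _ ⟨e x, KahlerCone.mem_regTarget hx hxD, e.map_source hx, by
      rwa [mem_preimage, e.left_inv hx]⟩
  rw [EventuallyEq, ae_restrict_iff' (measurableSet_target_inter_preimage e hW.measurableSet)] at h1
  refine hpos.ne' (measure_mono_null ?_ (ae_iff.1 h1))
  intro z hz hcon
  have h2 := hcon hz.2
  rw [chartDensity, Pi.zero_apply, ENNReal.ofReal_eq_zero] at h2
  have h3 := det_re_pos (hg.posDef e he z hz.1)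
  have : 0 < (n.factorial : ℝ) * 2 ^ n * (g e z).det.re := by positivity
  linarith

/-- Nonempty open sets off D have positive volume, so for functions continuous there an almost
everywhere bound is a pointwise one. This turns the essential supremum of Moser's iteration into a
genuine supremum. -/
theorem le_of_ae_le (hD : IsSmoothHypersurface n D) (hg : IsKahlerConeMetric D β g)
    {F : X → ℝ} (hF : ContinuousOn F Dᶜ) {c : ℝ} (h : ∀ᵐ x ∂(vol g), F x ≤ c) {x : X}
    (hx : x ∉ D) : F x ≤ c := by
  by_contra hc
  have hO : IsOpen (Dᶜ ∩ F ⁻¹' Ioi c) := hF.isOpen_inter_preimage hD.1.isOpen_compl isOpen_Ioi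
  have h1 := vol_pos_of_isOpen hD hg hO ⟨x, ⟨hx, not_le.1 hc⟩, hx⟩
  refine h1.ne' (measure_mono_null ?_ (ae_iff.1 h))
  exact fun y hy => not_le.2 hy.2

theorem vol_univ_pos (hD : IsSmoothHypersurface n D) (hg : IsKahlerConeMetric D β g) :
    0 < vol g univ :=
  vol_pos_of_isOpen hD hg isOpen_univ (by simpa using nonempty_compl_divisor hD)

theorem integrable_of_bounded (hD : IsSmoothHypersurface n D) (hg : IsKahlerConeMetric D β g)
    (hfin : vol g univ < ⊤) {F : X → ℝ} (hF : ContinuousOn F Dᶜ) {C : ℝ}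
    (hC : ∀ x ∉ D, |F x| ≤ C) : Integrable F (vol g) := by
  have : IsFiniteMeasure (vol g) := ⟨hfin⟩
  refine Integrable.of_bound (aestronglyMeasurable_of_continuousOn hD hg.isForm hF) C ?_
  filter_upwards [ae_notMem_divisor hD hg.isForm] with x hx
  exact hC x hx

end Volume

end KahlerCone

namespace KahlerCone

/-! ### Symmetry of the complex Hessian -/

section Hermitian

variable {n : ℕ}

theorem fderiv_fderiv_comm {f : Cn n → ℂ} {s : Set (Cn n)} (hs : IsOpen s)
    (hf : ContDiffOn ℝ 2 f s) {z : Cn n} (hz : z ∈ s) (v w : Cn n) :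
    fderiv ℝ (fun y => fderiv ℝ f y v) z w = fderiv ℝ (fun y => fderiv ℝ f y w) z v := by
  have hc : ContDiffAt ℝ 2 f z := hf.contDiffAt (hs.mem_nhds hz)
  have hd : DifferentiableAt ℝ (fderiv ℝ f) z :=
    (hc.fderiv_right (m := 1) (by norm_num)).differentiableAt (by norm_num)
  have h := hc.isSymmSndFDerivAt (by simp)
  have h1 : ∀ v, fderiv ℝ (fun y => fderiv ℝ f y v) z = (fderiv ℝ (fderiv ℝ f) z).flip v :=
    fun v => by
      ext w
      rw [fderiv_clm_apply hd (differentiableAt_const v)]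
      simp
  rw [h1, h1]
  exact h w v

theorem differentiableAt_fderiv_apply {f : Cn n → ℂ} {s : Set (Cn n)} (hs : IsOpen s)
    (hf : ContDiffOn ℝ 2 f s) {z : Cn n} (hz : z ∈ s) (v : Cn n) :
    DifferentiableAt ℝ (fun y => fderiv ℝ f y v) z :=
  ((((hf.contDiffAt (hs.mem_nhds hz)).fderiv_right (m := 1) (by norm_num)).differentiableAt
    (by norm_num)).clm_apply (differentiableAt_const v))

theorem fderiv_half_mul_sub {f g : Cn n → ℂ} {z : Cn n} (hf : DifferentiableAt ℝ f z)
    (hg : DifferentiableAt ℝ g z) (c : ℂ) (v : Cn n) :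
    fderiv ℝ (fun y => (1 / 2 : ℂ) * (f y + c * g y)) z v =
      (1 / 2 : ℂ) * (fderiv ℝ f z v + c * fderiv ℝ g z v) := by
  rw [((hf.hasFDerivAt.fun_add (hg.hasFDerivAt.const_mul c)).const_mul (1 / 2 : ℂ)).fderiv]
  simp [mul_add]

theorem ddbar_eq_dzbar_dz {f : Cn n → ℂ} {s : Set (Cn n)} (hs : IsOpen s)
    (hf : ContDiffOn ℝ 2 f s) {z : Cn n} (hz : z ∈ s) (i j : Fin n) :
    ddbar i j f z = dzbar j (dz i f) z := by
  have hd := differentiableAt_fderiv_apply hs hf hz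
  have h1 : dz i f = fun y => (1 / 2 : ℂ) * (fderiv ℝ f y (Pi.single i 1) +
      (-Complex.I) * fderiv ℝ f y (Pi.single i Complex.I)) := by
    funext y
    simp only [dz]
    ring
  rw [ddbar, h1, show dzbar j f = fun y => (1 / 2 : ℂ) * (fderiv ℝ f y (Pi.single j 1) +
    Complex.I * fderiv ℝ f y (Pi.single j Complex.I)) from rfl, dz, dzbar,
    fderiv_half_mul_sub (hd _) (hd _), fderiv_half_mul_sub (hd _) (hd _),
    fderiv_half_mul_sub (hd _) (hd _), fderiv_half_mul_sub (hd _) (hd _),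
    fderiv_fderiv_comm hs hf hz (Pi.single j 1), fderiv_fderiv_comm hs hf hz (Pi.single j 1),
    fderiv_fderiv_comm hs hf hz (Pi.single j Complex.I),
    fderiv_fderiv_comm hs hf hz (Pi.single j Complex.I)]
  ring

/-- For real u, conjugation exchanges ∂u and ∂̄u; the claim becomes that ∂ and ∂̄ commute, which is
the symmetry of second derivatives. -/
theorem isHermitian_ddbar {u : Cn n → ℝ} {s : Set (Cn n)} (hs : IsOpen s)
    (hu : ContDiffOn ℝ 2 (fun y => (u y : ℂ)) s) {z : Cn n} (hz : z ∈ s) :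
    (Matrix.of fun i j => ddbar i j (fun y => (u y : ℂ)) z).IsHermitian := by
  ext i j
  rw [Matrix.conjTranspose_apply, Matrix.of_apply, Matrix.of_apply, ddbar, RCLike.star_def]
  have hd : DifferentiableAt ℝ (dzbar i fun y => (u y : ℂ)) z :=
    ((contDiffOn_dzbar (m := 1) hs hu (by norm_num) i).differentiableOn
      (by norm_num)).differentiableAt (hs.mem_nhds hz)
  rw [← dzbar_conj hd, ddbar_eq_dzbar_dz hs hu hz]
  refine dzbar_congr (Filter.eventually_of_mem (hs.mem_nhds hz) fun y hy => ?_) j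
  rw [dzbar_ofReal ((hu.differentiableOn (by norm_num)).differentiableAt (hs.mem_nhds hy)),
    Complex.conj_conj]

end Hermitian

/-! ### Products with smooth functions -/

section Products

variable {n : ℕ} {X : Type*} [TopologicalSpace X] [ChartedSpace (Cn n) X]
  {D : Set X} {β : ℝ} {g h : Coeffs11 n X} {e : OpenPartialHomeomorph X (Cn n)} {f : X → ℝ}
  {k : Fin n} {z : Cn n}

theorem isHermitian_hessIn (hf : IsC2Off n D f) (hD : IsClosed D) (he : IsHolChart e)
    (hz : z ∈ regTarget D e) : (hessIn e f z).IsHermitian :=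
  isHermitian_ddbar (u := fun y => f (e.symm y)) (isOpen_regTarget hD e) (hf e he) hz

variable (D β k e f) in
/-- On the regular part of `s`, the function and the components of `∂f` and `∂∂̄f` in the cone
frame are bounded by `N`. -/
def ConeBound (s : Set (Cn n)) (N : ℝ) : Prop :=
  ∀ z ∈ s ∩ regTarget D e, ‖inChart e f z‖ ≤ N ∧
    (∀ i, ‖coneWeight β k i z * gradIn e f z i‖ ≤ N) ∧
    ∀ i j, ‖coneWeight β k i z * coneWeight β k j z * hessIn e f z i j‖ ≤ N

/-- The exponent 1-β is nonnegative, so the weights stay bounded up to the divisor. Derivatives of a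
smooth function on X are then automatically bounded in the cone frame. -/
theorem continuous_coneWeight (hβ1 : β ≤ 1) (k i : Fin n) : Continuous (coneWeight β k i) := by
  by_cases hik : i = k
  · have h : coneWeight β k i = fun z : Cn n => ((‖z k‖ ^ (1 - β) : ℝ) : ℂ) := by
      funext z
      simp [coneWeight, hik]
    rw [h]
    exact Complex.continuous_ofReal.comp
      ((Real.continuous_rpow_const (by linarith)).comp (continuous_apply k).norm)
  · have h : coneWeight β k i = fun _ : Cn n => 1 := by
      funext z
      simp [coneWeight, hik]
    rw [h]
    exact continuous_const

theorem exists_family_bound {ι : Type*} [Fintype ι] {K : Set (Cn n)} (hK : IsCompact K)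
    {h : ι → Cn n → ℂ} (hc : ∀ a, ContinuousOn (h a) K) :
    ∃ M : ℝ, 0 ≤ M ∧ ∀ a, ∀ z ∈ K, ‖h a z‖ ≤ M := by
  choose C hC using fun a => hK.exists_bound_of_continuousOn (hc a)
  refine ⟨∑ a, |C a|, Finset.sum_nonneg fun a _ => abs_nonneg _, fun a z hz => ?_⟩
  exact (hC a z hz).trans ((le_abs_self _).trans
    (Finset.single_le_sum (f := fun a => |C a|) (fun a _ => abs_nonneg _) (Finset.mem_univ a)))

theorem norm_dzbar_inChart (hf : DifferentiableAt ℝ (inChart e f) z) (j : Fin n) :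
    ‖dzbar j (inChart e f) z‖ = ‖gradIn e f z j‖ := by
  have h : dzbar j (inChart e f) z = starRingEnd ℂ (gradIn e f z j) :=
    dzbar_ofReal (u := fun y => f (e.symm y)) hf j
  rw [h, RCLike.norm_conj]

/-- By the product rule, with the weights distributed so that each derivative of f carries its own
weight; the remaining factors are continuous on the compact set K. -/
theorem ConeBound.mul_smooth (hβ1 : β ≤ 1) (hD : IsClosed D) {ρ : X → ℝ} (he : IsHolChart e)
    (hρ : ContDiffOn ℝ 2 (inChart e ρ) e.target) (hf : IsC2Off n D f) {K : Set (Cn n)}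
    (hK : IsCompact K) (hKe : K ⊆ e.target) {N : ℝ} (hN : ConeBound D β e f k K N) :
    ∃ N', ConeBound D β e (fun x => ρ x * f x) k K N' := by
  obtain ⟨M₀, h0, hM₀⟩ := exists_family_bound (ι := Unit) hK (h := fun _ => inChart e ρ)
    fun _ => hρ.continuousOn.mono hKe
  obtain ⟨M₁, h1, hM₁⟩ := exists_family_bound hK (h := fun i => dz i (inChart e ρ)) fun i =>
    (contDiffOn_dz (m := 1) e.open_target hρ (by norm_num) i).continuousOn.mono hKe
  obtain ⟨M₂, h2, hM₂⟩ := exists_family_bound hK (h := fun a : Fin n × Fin n =>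
    ddbar a.1 a.2 (inChart e ρ)) fun a => (continuousOn_ddbar e.open_target hρ a.1 a.2).mono hKe
  obtain ⟨M₃, h3, hM₃⟩ := exists_family_bound hK (h := fun i => coneWeight β k i) fun i =>
    (continuous_coneWeight hβ1 k i).continuousOn
  set N₀ := |N|
  have hN0 : 0 ≤ N₀ := abs_nonneg N
  refine ⟨M₀ * N₀ + M₃ * M₁ * N₀ + M₃ * M₃ * M₂ * N₀ + M₃ * M₁ * N₀, fun z hz => ?_⟩
  obtain ⟨a0, a1, a2⟩ := hN z hz
  replace a0 := a0.trans (le_abs_self N)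
  replace a1 := fun i => (a1 i).trans (le_abs_self N)
  replace a2 := fun i j => (a2 i j).trans (le_abs_self N)
  have b0 := hM₀ () z hz.1
  have b1 := fun i => hM₁ i z hz.1
  have b2 := fun i j => hM₂ (i, j) z hz.1
  have b3 := fun i => hM₃ i z hz.1
  have hmul : inChart e (fun x => ρ x * f x) = fun y => inChart e ρ y * inChart e f y := by
    funext y
    simp [inChart]
  have hdρ : DifferentiableAt ℝ (inChart e ρ) z := (hρ.differentiableOn
    (by norm_num)).differentiableAt (e.open_target.mem_nhds hz.2.1)
  have hdf := hf.differentiableAt hD he hz.2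
  have p1 : 0 ≤ M₀ * N₀ := by positivity
  have p2 : 0 ≤ M₃ * M₁ * N₀ := by positivity
  have p3 : 0 ≤ M₃ * M₃ * M₂ * N₀ := by positivity
  refine ⟨?_, fun i => ?_, fun i j => ?_⟩
  · rw [hmul, norm_mul]
    have := mul_le_mul b0 a0 (norm_nonneg _) h0
    linarith
  · have h4 : coneWeight β k i z * gradIn e (fun x => ρ x * f x) z i =
        coneWeight β k i z * dz i (inChart e ρ) z * inChart e f z +
          inChart e ρ z * (coneWeight β k i z * gradIn e f z i) := by
      rw [gradIn, hmul, dz_mul hdρ hdf, gradIn]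
      ring
    rw [h4]
    refine (norm_add_le _ _).trans ?_
    have c1 := mul_le_mul (mul_le_mul (b3 i) (b1 i) (norm_nonneg _) h3) a0 (norm_nonneg _)
      (by positivity)
    have c2 := mul_le_mul b0 (a1 i) (norm_nonneg _) h0
    rw [← norm_mul, ← norm_mul] at c1
    rw [← norm_mul] at c2
    linarith
  · have h4 : coneWeight β k i z * coneWeight β k j z * hessIn e (fun x => ρ x * f x) z i j =
        coneWeight β k i z * coneWeight β k j z * ddbar i j (inChart e ρ) z * inChart e f z +
        coneWeight β k j z * dzbar j (inChart e ρ) z * (coneWeight β k i z * gradIn e f z i) +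
        coneWeight β k i z * dz i (inChart e ρ) z *
          (coneWeight β k j z * dzbar j (inChart e f) z) +
        inChart e ρ z * (coneWeight β k i z * coneWeight β k j z * hessIn e f z i j) := by
      simp only [hessIn, Matrix.of_apply, hmul, gradIn]
      rw [ddbar_mul (isOpen_regTarget hD e) (hρ.mono inter_subset_left) (hf e he) hz.2]
      ring
    have e1 : ‖coneWeight β k i z * coneWeight β k j z * ddbar i j (inChart e ρ) z *
        inChart e f z‖ ≤ M₃ * M₃ * M₂ * N₀ := by
      rw [norm_mul, norm_mul, norm_mul]
      gcongr
      exacts [b3 i, b3 j, b2 i j]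
    have e2 : ‖coneWeight β k j z * dzbar j (inChart e ρ) z *
        (coneWeight β k i z * gradIn e f z i)‖ ≤ M₃ * M₁ * N₀ := by
      rw [norm_mul, norm_mul, norm_dzbar_inChart hdρ]
      gcongr
      exacts [b3 j, b1 j, a1 i]
    have e3 : ‖coneWeight β k i z * dz i (inChart e ρ) z *
        (coneWeight β k j z * dzbar j (inChart e f) z)‖ ≤ M₃ * M₁ * N₀ := by
      rw [norm_mul, norm_mul, norm_mul (coneWeight β k j z), norm_dzbar_inChart hdf,
        ← norm_mul (coneWeight β k j z)]
      gcongr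
      exacts [b3 i, b1 i, a1 j]
    have e4 : ‖inChart e ρ z * (coneWeight β k i z * coneWeight β k j z * hessIn e f z i j)‖ ≤
        M₀ * N₀ := by
      rw [norm_mul]
      exact mul_le_mul b0 (a2 i j) (norm_nonneg _) h0
    rw [h4]
    refine (norm_add_le _ _).trans ((add_le_add (norm_add₃_le) le_rfl).trans ?_)
    linarith

theorem IsC2Off.mul_smooth {ρ : X → ℝ}
    (hρ : ∀ e : OpenPartialHomeomorph X (Cn n), IsHolChart e →
      ContDiffOn ℝ 2 (inChart e ρ) e.target) (hf : IsC2Off n D f) :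
    IsC2Off n D fun x => ρ x * f x := by
  intro e he
  have hmul : inChart e (fun x => ρ x * f x) = fun y => inChart e ρ y * inChart e f y := by
    funext y
    simp [inChart]
  rw [hmul]
  exact ((hρ e he).mono inter_subset_left).mul (hf e he)

theorem IsC2Cone.mul_smooth (hβ1 : β ≤ 1) (hD : IsClosed D) {ρ : X → ℝ}
    (hρ : ∀ e : OpenPartialHomeomorph X (Cn n), IsHolChart e →
      ContDiffOn ℝ 2 (inChart e ρ) e.target) (hf : IsC2Cone n D β f) :
    IsC2Cone n D β fun x => ρ x * f x where
  c2 := hf.c2.mul_smooth hρ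
  bdd p := by
    obtain ⟨e, k, he, hp, U, hU, N, hN⟩ := hf.bdd p
    obtain ⟨K, hK, hKU, hKc⟩ := local_compact_nhds
      (inter_mem (e.open_target.mem_nhds (e.map_source hp)) hU)
    obtain ⟨N', hN'⟩ := ConeBound.mul_smooth (K := K) hβ1 hD he.1 (hρ e he.1) hf.c2 hKc
      (fun z hz => (hKU hz).1) (fun z hz => hN z ⟨(hKU hz.1).2, hz.2⟩)
    exact ⟨e, k, he, hp, K, hK, N', hN'⟩

end Products

end KahlerCone

namespace KahlerCone

/-! ### The Laplacian of a cone function has integral zero -/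

section Stokes

variable {n : ℕ} {X : Type*} [TopologicalSpace X] [ChartedSpace (Cn n) X]
  {D : Set X} {β : ℝ} {g h : Coeffs11 n X} {e : OpenPartialHomeomorph X (Cn n)} {f : X → ℝ}
  {k : Fin n} {z : Cn n}

/-- Identifies the density of Δf·ωⁿ with the adjugate expression of the local Stokes theorem. For
Hermitian matrices the determinant and the trace are real, so taking real parts loses nothing. -/
theorem det_mul_traceWith {G H : Matrix (Fin n) (Fin n) ℂ} (hG : G.PosDef) (hH : H.IsHermitian) :
    ((G.det.re * traceWith G H : ℝ) : ℂ) = ∑ i, ∑ j, G.adjugate j i * H i j := by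
  have h1 : ((G.det.re : ℝ) : ℂ) = G.det := by
    rw [← Complex.conj_eq_iff_re, ← Complex.star_def, ← Matrix.det_conjTranspose, hG.1.eq]
  have h2 : ((traceWith G H : ℝ) : ℂ) = (G⁻¹ * H).trace := by
    rw [traceWith, ← Complex.conj_eq_iff_re, ← Complex.star_def, ← Matrix.trace_conjTranspose,
      Matrix.conjTranspose_mul, hH.eq, hG.1.inv.eq, Matrix.trace_mul_comm]
  have hd : G.det ≠ 0 := hG.det_pos.ne'
  rw [Complex.ofReal_mul, h1, h2, Matrix.inv_def, Matrix.smul_mul, Matrix.trace_smul,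
    Ring.inverse_eq_inv', smul_eq_mul, mul_inv_cancel_left₀ hd, Finset.sum_comm]
  simp only [Matrix.trace, Matrix.diag, Matrix.mul_apply]

theorem traceWith_add (G H H' : Matrix (Fin n) (Fin n) ℂ) :
    traceWith G (H + H') = traceWith G H + traceWith G H' := by
  rw [traceWith, Matrix.mul_add, Matrix.trace_add, Complex.add_re]
  rfl

theorem traceWith_smul (G H : Matrix (Fin n) (Fin n) ℂ) (c : ℝ) :
    traceWith G ((c : ℂ) • H) = c * traceWith G H := by
  rw [traceWith, Matrix.mul_smul, Matrix.trace_smul, smul_eq_mul, Complex.re_ofReal_mul]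
  rfl

theorem traceWith_sum {ι : Type*} (t : Finset ι) (G : Matrix (Fin n) (Fin n) ℂ)
    (H : ι → Matrix (Fin n) (Fin n) ℂ) :
    traceWith G (∑ p ∈ t, H p) = ∑ p ∈ t, traceWith G (H p) := by
  simp only [traceWith, Matrix.mul_sum, Matrix.trace_sum, Complex.re_sum]

theorem ddbar_sum {ι : Type*} (t : Finset ι) {s : Set (Cn n)} (hs : IsOpen s)
    {F : ι → Cn n → ℂ} (hF : ∀ p ∈ t, ContDiffOn ℝ 2 (F p) s) (hz : z ∈ s) (i j : Fin n) :
    ddbar i j (fun y => ∑ p ∈ t, F p y) z = ∑ p ∈ t, ddbar i j (F p) z := by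
  have hd : ∀ p ∈ t, ∀ y ∈ s, DifferentiableAt ℝ (F p) y := fun p hp y hy =>
    ((hF p hp).differentiableOn (by norm_num)).differentiableAt (hs.mem_nhds hy)
  have h1 : dzbar j (fun y => ∑ p ∈ t, F p y) =ᶠ[𝓝 z] fun y => ∑ p ∈ t, dzbar j (F p) y :=
    Filter.eventually_of_mem (hs.mem_nhds hz) fun y hy => dzbar_sum t (fun p hp => hd p hp y hy) j
  rw [ddbar, dz_congr h1, dz_sum]
  · rfl
  · exact fun p hp => ((contDiffOn_dzbar (m := 1) hs (hF p hp) (by norm_num) j).differentiableOn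
      (by norm_num)).differentiableAt (hs.mem_nhds hz)

theorem hessIn_sum {ι : Type*} (t : Finset ι) {F : ι → X → ℝ} (hD : IsClosed D)
    (hF : ∀ p ∈ t, IsC2Off n D (F p)) (he : IsHolChart e) (hz : z ∈ regTarget D e) :
    hessIn e (fun x => ∑ p ∈ t, F p x) z = ∑ p ∈ t, hessIn e (F p) z := by
  ext i j
  have h1 : inChart e (fun x => ∑ p ∈ t, F p x) = fun y => ∑ p ∈ t, inChart e (F p) y := by
    funext y
    simp [inChart]
  rw [Matrix.sum_apply]
  simp only [hessIn, Matrix.of_apply]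
  rw [h1, ddbar_sum t (isOpen_regTarget hD e) (fun p hp => hF p hp e he) hz]

theorem continuousOn_hessIn (hf : IsC2Off n D f) (hD : IsClosed D) (he : IsHolChart e)
    (i j : Fin n) : ContinuousOn (fun z => hessIn e f z i j) (regTarget D e) :=
  continuousOn_ddbar (isOpen_regTarget hD e) (hf e he) i j

theorem continuousOn_gradIn (hf : IsC2Off n D f) (hD : IsClosed D) (he : IsHolChart e)
    (i : Fin n) : ContinuousOn (fun z => gradIn e f z i) (regTarget D e) :=
  (contDiffOn_dz (m := 1) (isOpen_regTarget hD e) (hf e he) (by norm_num) i).continuousOn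

variable [IsManifold 𝓘(ℂ, Cn n) ω X]

theorem continuousOn_traceAt (hD : IsClosed D) (hg : IsKahlerConeMetric D β g)
    (hh : IsForm11 D h) (hc : ∀ e : OpenPartialHomeomorph X (Cn n), IsHolChart e → ∀ i j,
      ContinuousOn (fun z => h e z i j) (regTarget D e)) : ContinuousOn (traceAt g h) Dᶜ :=
  continuousOn_of_charts (n := n) hD fun e he => ⟨fun z => traceWith (g e z) (h e z),
    continuousOn_traceWith (fun i j => (hg.smooth e he i j).continuousOn)
      (fun z hz => (hg.posDef e he z hz).det_pos.ne') (hc e he),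
    fun _ hx hxD => traceAt_eq hg.isForm hh he hx hxD⟩

theorem continuousOn_traceAt_hessForm (hD : IsClosed D) (hg : IsKahlerConeMetric D β g)
    (hf : IsC2Off n D f) : ContinuousOn (traceAt g (hessForm f)) Dᶜ :=
  continuousOn_traceAt hD hg (isForm11_hessForm hf hD) fun _ he i j =>
    continuousOn_hessIn hf hD he i j

theorem continuousOn_traceAt_gradSqForm (hD : IsClosed D) (hg : IsKahlerConeMetric D β g)
    (hf : IsC2Off n D f) : ContinuousOn (traceAt g (gradSqForm f)) Dᶜ :=
  continuousOn_traceAt hD hg (isForm11_gradSqForm hf hD) fun _ he i j =>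
    (continuousOn_gradIn hf hD he i).mul
      (Complex.continuous_conj.comp_continuousOn (continuousOn_gradIn hf hD he j))

theorem abs_traceAt_le (hg : IsKahlerConeMetric D β g) {C : ℝ} (hh : FormLE D g h C) {x : X}
    (hx : x ∉ D) : |traceAt g h x| ≤ n * C :=
  have hz := KahlerCone.mem_regTarget (mem_chart_source (Cn n) x) hx
  abs_traceWith_le (hg.posDef _ (isHolChart_chartAt x) _ hz) (hh _ (isHolChart_chartAt x) _ hz)

variable [T2Space X] [CompactSpace X] [Nonempty X] [MeasurableSpace X] [BorelSpace X]

theorem integral_traceAt_hessForm_of_support (hβ : 0 < β) (hD : IsSmoothHypersurface n D)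
    (hg : IsKahlerConeMetric D β g) (he : IsDivisorChart D e k) (hf : IsC2Off n D f) {K : Set X}
    (hK : IsCompact K) (hKe : K ⊆ e.source) (h0 : ∀ x ∉ K, f x = 0) {N : ℝ}
    (hgb : ∀ z ∈ e '' K ∩ regTarget D e, ∀ i j,
      ‖coneWeight β k i z * coneWeight β k j z * g e z i j‖ ≤ N)
    (hfb : ConeBound D β e f k (e '' K) N) :
    ∫ x, traceAt g (hessForm f) x ∂(vol g) = 0 := by
  -- Outside the target of the chart the values of the inverse chart are arbitrary; extension by
  -- zero gives a function on all of ℂⁿ that is C² off z_k = 0.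
  set F : Cn n → ℂ := e.target.indicator (inChart e f)
  have hK' : IsCompact (e '' K) := hK.image_of_continuousOn (e.continuousOn.mono hKe)
  have hKt : e '' K ⊆ e.target := fun z ⟨x, hx, hxz⟩ => hxz ▸ e.map_source (hKe hx)
  have hF : ∀ z ∈ e.target, F =ᶠ[𝓝 z] inChart e f := fun z hz =>
    Filter.eventually_of_mem (e.open_target.mem_nhds hz) fun y hy => indicator_of_mem hy _
  have hFK : ∀ z ∉ e '' K, F z = 0 := fun z hz => by
    by_cases hzt : z ∈ e.target
    · rw [show F z = _ from indicator_of_mem hzt _, inChart, h0, Complex.ofReal_zero]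
      exact fun h => hz ⟨_, h, e.right_inv hzt⟩
    · exact indicator_of_notMem hzt _
  have hF0 : ∀ z ∉ e '' K, F =ᶠ[𝓝 z] fun _ => 0 := fun z hz =>
    Filter.eventually_of_mem (hK'.isClosed.isOpen_compl.mem_nhds hz) fun y hy => hFK y hy
  have hreg : ∀ z ∈ e.target, z k ≠ 0 → z ∈ regTarget D e := fun z hz hk => he.mem_regTarget hz hk
  have hFd : ∀ z ∈ e.target, z k ≠ 0 → ∀ j, ‖dzbar j F z‖ = ‖gradIn e f z j‖ :=
    fun z hz hk j => by
      rw [dzbar_congr (hF z hz), norm_dzbar_inChart (hf.differentiableAt hD.1 he.1 (hreg z hz hk))]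
  have hFdd : ∀ z ∈ e.target, ∀ i j, ddbar i j F z = hessIn e f z i j := fun z hz i j => by
    rw [ddbar_congr (hF z hz)]
    rfl
  have key := integral_adjugate_ddbar_eq_zero (β := β) (F := F) (G := g e) (N := N) hβ k
    e.open_target hK' hKt
    (fun i j => ((hg.smooth e he.1 i j).mono fun z hz => hreg z hz.1 hz.2).of_le
      (by exact_mod_cast le_top))
    (fun z hz => (hg.posDef e he.1 z (hreg z hz.1 hz.2)).det_pos.ne')
    (fun z hz => hg.closed e he.1 z (hreg z hz.1 hz.2))
    (fun z hz hk => hgb z ⟨hz, hreg z (hKt hz) hk⟩)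
    (fun z hk => by
      refine ContDiffAt.contDiffWithinAt ?_
      by_cases hz : z ∈ e '' K
      · exact ((hf e he.1).contDiffAt ((isOpen_regTarget hD.1 e).mem_nhds
          (hreg z (hKt hz) hk))).congr_of_eventuallyEq (hF z (hKt hz))
      · exact contDiffAt_const.congr_of_eventuallyEq (hF0 z hz))
    hFK
    (fun z hz hk j => by
      rw [norm_mul, hFd z (hKt hz) hk, ← norm_mul]
      exact (hfb z ⟨hz, hreg z (hKt hz) hk⟩).2.1 j)
    (fun z hz hk i j => by
      rw [hFdd z (hKt hz)]
      exact (hfb z ⟨hz, hreg z (hKt hz) hk⟩).2.2 i j)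
  have hsupp : ∀ x ∉ e.source, traceAt g (hessForm f) x = 0 := by
    intro x hx
    have hxK : x ∉ K := fun h => hx (hKe h)
    have hs : x ∈ (chartAt (Cn n) x).source := mem_chart_source _ x
    have h1 : inChart (chartAt (Cn n) x) f =ᶠ[𝓝 (chartAt (Cn n) x x)] fun _ => 0 := by
      have hc := (chartAt (Cn n) x).continuousAt_symm ((chartAt (Cn n) x).map_source hs)
      have : Kᶜ ∈ 𝓝 ((chartAt (Cn n) x).symm (chartAt (Cn n) x x)) := by
        rw [(chartAt (Cn n) x).left_inv hs]
        exact hK.isClosed.isOpen_compl.mem_nhds hxK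
      filter_upwards [hc this] with y hy
      rw [inChart, h0 _ hy, Complex.ofReal_zero]
    have h2 : hessIn (chartAt (Cn n) x) f (chartAt (Cn n) x x) = 0 := by
      ext i j
      rw [hessIn, Matrix.of_apply, ddbar_congr h1, ddbar_const]
      rfl
    rw [traceAt, hessForm, h2, traceWith]
    simp
  rw [integral_vol_of_support hD hg he.1 (continuousOn_traceAt_hessForm hD.1 hg hf) hsupp,
    ← Complex.ofReal_eq_zero, ← integral_complex_ofReal]
  have hcongr : ∫ z in e.target, ((n.factorial * 2 ^ n * (g e z).det.re *
      traceAt g (hessForm f) (e.symm z) : ℝ) : ℂ) =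
      ∫ z in e.target, ((n.factorial * 2 ^ n : ℝ) : ℂ) *
        ∑ i, ∑ j, (g e z).adjugate j i * ddbar i j F z := by
    refine setIntegral_congr_ae e.open_target.measurableSet ?_
    filter_upwards [ae_notMem_preimage_divisor hD he.1] with z hz hzt
    have hzr : z ∈ regTarget D e := ⟨hzt, fun h => hz ⟨hzt, h⟩⟩
    rw [traceAt_eq hg.isForm (isForm11_hessForm hf hD.1) he.1 (e.map_target hzt) hzr.2,
      e.right_inv hzt, mul_assoc (n.factorial * 2 ^ n : ℝ), Complex.ofReal_mul, hessForm,
      det_mul_traceWith (hg.posDef e he.1 z hzr) (isHermitian_hessIn hf hD.1 he.1 hzr)]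
    simp only [hFdd z hzt]
  rw [hcongr, integral_const_mul, setIntegral_eq_integral_of_forall_compl_eq_zero, key, mul_zero]
  intro z hz
  refine Finset.sum_eq_zero fun i _ => Finset.sum_eq_zero fun j _ => ?_
  rw [ddbar_congr (hF0 z fun h => hz (hKt h)), ddbar_const, mul_zero]

theorem IsC2Cone.integrable_traceAt_hessForm (hβ : 0 < β) (hβ1 : β ≤ 1)
    (hD : IsSmoothHypersurface n D) (hg : IsKahlerConeMetric D β g) (hf : IsC2Cone n D β f) :
    Integrable (traceAt g (hessForm f)) (vol g) := by
  obtain ⟨C, -, hC⟩ := hf.exists_formLE_hess hβ hβ1 hD.1 hg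
  exact integrable_of_bounded hD hg (vol_univ_lt_top hβ hβ1 hD hf.hasDivisorCharts hg)
    (continuousOn_traceAt_hessForm hD.1 hg hf.c2) fun x hx => abs_traceAt_le hg hC hx

theorem IsC2Cone.integrable_traceAt_gradSqForm (hβ : 0 < β) (hβ1 : β ≤ 1)
    (hD : IsSmoothHypersurface n D) (hg : IsKahlerConeMetric D β g) (hf : IsC2Cone n D β f) :
    Integrable (traceAt g (gradSqForm f)) (vol g) := by
  obtain ⟨C, -, hC⟩ := hf.exists_formLE_gradSq hβ hβ1 hD.1 hg
  exact integrable_of_bounded hD hg (vol_univ_lt_top hβ hβ1 hD hf.hasDivisorCharts hg)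
    (continuousOn_traceAt_gradSqForm hD.1 hg hf.c2) fun x hx => abs_traceAt_le hg hC hx

/-- The Laplacian of a cone function has integral zero. -/
theorem IsC2Cone.integral_traceAt_hessForm (hβ : 0 < β) (hβ1 : β ≤ 1)
    (hD : IsSmoothHypersurface n D) (hg : IsKahlerConeMetric D β g) (hf : IsC2Cone n D β f) :
    ∫ x, traceAt g (hessForm f) x ∂(vol g) = 0 := by
  choose e k he hp U hU N hN using hf.bdd
  choose U' hU' N' hN'0 hN' using fun p => hg.exists_frame_bound hβ hβ1 (he p) (hp p)
  have hV : ∀ p, ∃ V ∈ 𝓝 p, V ⊆ (e p).source ∩ e p ⁻¹' (U p ∩ U' p) := fun p =>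
    ⟨_, mem_nhds_chart_preimage (hp p) (inter_mem (hU p) (hU' p)), Subset.rfl⟩
  choose V hVn hVs using hV
  -- The partition is subordinate to neighbourhoods on which both f and the metric are bounded in a
  -- single cone frame, so each piece ρ_p·f satisfies the local theorem.
  obtain ⟨t, ρ, hρ, hsub, hsum⟩ := exists_finite_partition (n := n) hVn
  have hρ2 : ∀ p ∈ t, ∀ e : OpenPartialHomeomorph X (Cn n), IsHolChart e →
      ContDiffOn ℝ 2 (inChart e (ρ p)) e.target := fun p hp e he =>
    (contDiffOn_inChart_of_contMDiff (hρ p hp) he).of_le (WithTop.coe_le_coe.2 (le_top : (2 : ℕ∞) ≤ ⊤))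
  have hcone : ∀ p ∈ t, IsC2Cone n D β fun x => ρ p x * f x := fun p hp =>
    hf.mul_smooth hβ1 hD.1 (hρ2 p hp)
  have hzero : ∀ p ∈ t, ∫ x, traceAt g (hessForm fun x => ρ p x * f x) x ∂(vol g) = 0 := by
    intro p hpt
    set K := tsupport (ρ p)
    have hK : IsCompact K := (isClosed_tsupport _).isCompact
    have hKV : K ⊆ (e p).source ∩ e p ⁻¹' (U p ∩ U' p) := (hsub p hpt).trans (hVs p)
    have hKe : K ⊆ (e p).source := fun x hx => (hKV hx).1
    have hKU : e p '' K ⊆ U p ∩ U' p := fun z ⟨x, hx, hxz⟩ => hxz ▸ (hKV hx).2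
    obtain ⟨N₁, hN₁⟩ := ConeBound.mul_smooth (k := k p) hβ1 hD.1 (he p).1 (hρ2 p hpt _ (he p).1)
      hf.c2 (hK.image_of_continuousOn ((e p).continuousOn.mono hKe))
      (fun z ⟨x, hx, hxz⟩ => hxz ▸ (e p).map_source (hKe hx))
      (fun z hz => hN p z ⟨(hKU hz.1).1, hz.2⟩)
    refine integral_traceAt_hessForm_of_support (N := max N₁ (N' p)) hβ hD hg (he p)
      (hcone p hpt).c2 hK hKe (fun x hx => by rw [image_eq_zero_of_notMem_tsupport hx, zero_mul])
      (fun z hz i j => (hN' p z ⟨(hKU hz.1).2, hz.2⟩ i j).trans (le_max_right _ _))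
      fun z hz => ?_
    obtain ⟨b0, b1, b2⟩ := hN₁ z hz
    exact ⟨b0.trans (le_max_left _ _), fun i => (b1 i).trans (le_max_left _ _),
      fun i j => (b2 i j).trans (le_max_left _ _)⟩
  have hf_sum : f = fun x => ∑ p ∈ t, ρ p x * f x := by
    funext x
    rw [← Finset.sum_mul, hsum, one_mul]
  have hlin : ∀ᵐ x ∂(vol g), traceAt g (hessForm f) x =
      ∑ p ∈ t, traceAt g (hessForm fun x => ρ p x * f x) x := by
    filter_upwards [ae_notMem_divisor hD hg.isForm] with x hx
    have hz := KahlerCone.mem_regTarget (mem_chart_source (Cn n) x) hx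
    conv_lhs => rw [hf_sum]
    simp only [traceAt, hessForm]
    rw [hessIn_sum t hD.1 (fun p hp => (hcone p hp).c2) (isHolChart_chartAt x) hz, traceWith_sum]
  rw [integral_congr_ae hlin, integral_finsetSum _ fun p hp =>
    (hcone p hp).integrable_traceAt_hessForm hβ hβ1 hD hg]
  exact Finset.sum_eq_zero hzero

end Stokes

end KahlerCone

namespace KahlerCone

/-! ### Kähler cone metrics along a segment of potentials -/

section Segment

variable {n : ℕ} {X : Type*} [TopologicalSpace X] [ChartedSpace (Cn n) X]
  {D : Set X} {β : ℝ} {g g' h : Coeffs11 n X} {e : OpenPartialHomeomorph X (Cn n)} {f : X → ℝ}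
  {k : Fin n} {z : Cn n}

theorem hessIn_const_mul (hf : IsC2Off n D f) (hD : IsClosed D) (he : IsHolChart e)
    (hz : z ∈ regTarget D e) (s : ℝ) :
    hessIn e (fun x => s * f x) z = (s : ℂ) • hessIn e f z := by
  have h1 := hessIn_comp hf hD isOpen_univ (F := fun y => s * y)
    (contDiff_const.mul contDiff_id).contDiffOn (fun _ _ => mem_univ _) he hz
  have h2 : deriv (fun y : ℝ => s * y) = fun _ => s := by
    funext y
    simp
  rw [h1, h2]
  simp

theorem quadForm_segment (A B : Matrix (Fin n) (Fin n) ℂ) (s : ℝ) (v : Fin n → ℂ) :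
    quadForm (((1 - s : ℝ) : ℂ) • A + (s : ℂ) • B) v =
      (1 - s) * quadForm A v + s * quadForm B v := by
  rw [quadForm_add, quadForm_smul, quadForm_smul]

/-- A convex combination of two Kähler cone metrics is one. -/
theorem IsKahlerConeMetric.segment (hD : IsClosed D) (hg : IsKahlerConeMetric D β g)
    (hg' : IsKahlerConeMetric D β g') {s : ℝ} (hs : s ∈ Icc (0 : ℝ) 1)
    (hh : ∀ e : OpenPartialHomeomorph X (Cn n), IsHolChart e → ∀ z ∈ regTarget D e,
      h e z = ((1 - s : ℝ) : ℂ) • g e z + (s : ℂ) • g' e z) : IsKahlerConeMetric D β h where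
  isForm e e' he he' z hz hz' i j := by
    have h1 := hg.isForm e e' he he' z hz hz' i j
    have h2 := hg'.isForm e e' he he' z hz hz' i j
    rw [hh e he z hz, hh e' he' _ (mem_regTarget_overlap hz hz')]
    simp only [Matrix.add_apply, Matrix.smul_apply, smul_eq_mul, h1, h2, Finset.mul_sum,
      ← Finset.sum_add_distrib]
    exact Finset.sum_congr rfl fun a _ => Finset.sum_congr rfl fun b _ => by ring
  smooth e he i j := by
    refine ContDiffOn.congr (f := fun z => ((1 - s : ℝ) : ℂ) * g e z i j + (s : ℂ) * g' e z i j)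
      ?_ fun z hz => ?_
    · exact (contDiffOn_const.mul (hg.smooth e he i j)).add
        (contDiffOn_const.mul (hg'.smooth e he i j))
    · rw [hh e he z hz]
      rfl
  posDef e he z hz := by
    have h1 := hg.posDef e he z hz
    have h2 : (g e z + (g' e z - g e z)).PosDef := by
      rw [add_sub_cancel]
      exact hg'.posDef e he z hz
    have h3 := posDef_segment h1 h2 hs
    rw [hh e he z hz]
    convert h3 using 1
    rw [smul_sub, Complex.ofReal_sub, Complex.ofReal_one, sub_smul, one_smul]
    abel
  closed e he z hz i j l := by
    have hev : ∀ i j, (fun y => h e y i j) =ᶠ[𝓝 z]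
        fun y => ((1 - s : ℝ) : ℂ) * g e y i j + (s : ℂ) * g' e y i j := fun i j =>
      Filter.eventually_of_mem ((isOpen_regTarget hD e).mem_nhds hz) fun y hy => by
        simp only [hh e he y hy]
        rfl
    have hd : ∀ i j, DifferentiableAt ℝ (fun y => g e y i j) z := fun i j =>
      ((hg.smooth e he i j).differentiableOn (by simp)).differentiableAt
        ((isOpen_regTarget hD e).mem_nhds hz)
    have hd' : ∀ i j, DifferentiableAt ℝ (fun y => g' e y i j) z := fun i j =>
      ((hg'.smooth e he i j).differentiableOn (by simp)).differentiableAt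
        ((isOpen_regTarget hD e).mem_nhds hz)
    rw [dz_congr (hev i j), dz_congr (hev l j), dz_add ((hd i j).const_mul _)
      ((hd' i j).const_mul _), dz_add ((hd l j).const_mul _) ((hd' l j).const_mul _),
      dz_const_mul _ (hd i j), dz_const_mul _ (hd' i j), dz_const_mul _ (hd l j),
      dz_const_mul _ (hd' l j), hg.closed e he z hz, hg'.closed e he z hz]
  quasiIsometric e k he p hp := by
    obtain ⟨U, hU, c, hc, hq⟩ := hg.quasiIsometric e k he p hp
    obtain ⟨U', hU', c', hc', hq'⟩ := hg'.quasiIsometric e k he p hp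
    refine ⟨U ∩ U', inter_mem hU hU', max c c', lt_max_of_lt_left hc, fun z hz v => ?_⟩
    have hflat : 0 ≤ flatCone β k z v := Finset.sum_nonneg fun i _ => by
      split_ifs
      · have := Real.rpow_nonneg (norm_nonneg (z k)) (2 * (β - 1))
        positivity
      · positivity
    obtain ⟨a1, a2⟩ := hq z ⟨hz.1.1, hz.2⟩ v
    obtain ⟨b1, b2⟩ := hq' z ⟨hz.1.2, hz.2⟩ v
    have h1 := quadForm_segment (g e z) (g' e z) s v
    rw [← hh e he.1 z hz.2] at h1
    change _ ≤ quadForm (h e z) v ∧ quadForm (h e z) v ≤ _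
    change _ ≤ quadForm (g e z) v at a1
    change quadForm (g e z) v ≤ _ at a2
    change _ ≤ quadForm (g' e z) v at b1
    change quadForm (g' e z) v ≤ _ at b2
    have c1 : (max c c')⁻¹ * flatCone β k z v ≤ c⁻¹ * flatCone β k z v :=
      mul_le_mul_of_nonneg_right (inv_anti₀ hc (le_max_left _ _)) hflat
    have c2 : (max c c')⁻¹ * flatCone β k z v ≤ c'⁻¹ * flatCone β k z v :=
      mul_le_mul_of_nonneg_right (inv_anti₀ hc' (le_max_right _ _)) hflat
    have c3 : c * flatCone β k z v ≤ max c c' * flatCone β k z v :=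
      mul_le_mul_of_nonneg_right (le_max_left _ _) hflat
    have c4 : c' * flatCone β k z v ≤ max c c' * flatCone β k z v :=
      mul_le_mul_of_nonneg_right (le_max_right _ _) hflat
    have hs0 := hs.1
    have hs1 : 0 ≤ 1 - s := by linarith [hs.2]
    rw [h1]
    constructor
    · have d1 := mul_le_mul_of_nonneg_left (c1.trans a1) hs1
      have d2 := mul_le_mul_of_nonneg_left (c2.trans b1) hs0
      linarith
    · have d1 := mul_le_mul_of_nonneg_left (a2.trans c3) hs1
      have d2 := mul_le_mul_of_nonneg_left (b2.trans c4) hs0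
      linarith

theorem withPotential_const_mul (hf : IsC2Off n D f) (hD : IsClosed D) (he : IsHolChart e)
    (hz : z ∈ regTarget D e) (s : ℝ) :
    withPotential g (fun x => s * f x) e z = g e z + (s : ℂ) • hessIn e f z := by
  rw [withPotential_apply, hessIn_const_mul hf hD he hz]

/-- The metric ω + s√-1∂∂̄φ is the convex combination (1-s)ω + s·ω_φ. -/
theorem isKahlerConeMetric_segment (hD : IsClosed D) (hg : IsKahlerConeMetric D β g)
    (hf : IsC2Off n D f) (hg' : IsKahlerConeMetric D β (withPotential g f)) {s : ℝ}
    (hs : s ∈ Icc (0 : ℝ) 1) : IsKahlerConeMetric D β (withPotential g fun x => s * f x) :=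
  hg.segment hD hg' hs fun e he z hz => by
    rw [withPotential_const_mul hf hD he hz, withPotential_apply, smul_add, ← add_assoc,
      ← add_smul, Complex.ofReal_sub, Complex.ofReal_one, sub_add_cancel, one_smul]

end Segment

/-! ### Traces of composed functions -/

section Composition

variable {n : ℕ} {X : Type*} [TopologicalSpace X] [ChartedSpace (Cn n) X]
  [IsManifold 𝓘(ℂ, Cn n) ω X]
  {D : Set X} {β : ℝ} {g : Coeffs11 n X} {f : X → ℝ} {s : Set ℝ} {F : ℝ → ℝ} {x : X}

theorem traceAt_hessForm_comp (hf : IsC2Off n D f) (hD : IsClosed D) (hs : IsOpen s)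
    (hF : ContDiffOn ℝ 2 F s) (hfs : ∀ x ∉ D, f x ∈ s) (hx : x ∉ D) :
    traceAt g (hessForm fun x => F (f x)) x = deriv F (f x) * traceAt g (hessForm f) x +
      deriv (deriv F) (f x) * traceAt g (gradSqForm f) x := by
  have hz := KahlerCone.mem_regTarget (mem_chart_source (Cn n) x) hx
  simp only [traceAt, hessForm, gradSqForm]
  rw [hessIn_comp hf hD hs hF hfs (isHolChart_chartAt x) hz, traceWith_add, traceWith_smul,
    traceWith_smul, (chartAt (Cn n) x).left_inv (mem_chart_source _ x)]

theorem traceAt_gradSqForm_comp (hf : IsC2Off n D f) (hD : IsClosed D) (hs : IsOpen s)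
    (hF : ContDiffOn ℝ 2 F s) (hfs : ∀ x ∉ D, f x ∈ s) (hx : x ∉ D) :
    traceAt g (gradSqForm fun x => F (f x)) x =
      deriv F (f x) ^ 2 * traceAt g (gradSqForm f) x := by
  have hz := KahlerCone.mem_regTarget (mem_chart_source (Cn n) x) hx
  have h1 : gradSqForm (fun x => F (f x)) (chartAt (Cn n) x) (chartAt (Cn n) x x) =
      ((deriv F (f x) ^ 2 : ℝ) : ℂ) •
        gradSqForm f (chartAt (Cn n) x) (chartAt (Cn n) x x) := by
    ext i j
    simp only [gradSqForm, sqForm, Matrix.of_apply, Matrix.smul_apply, smul_eq_mul]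
    rw [gradIn_comp hf hD hs hF hfs (isHolChart_chartAt x) hz,
      gradIn_comp hf hD hs hF hfs (isHolChart_chartAt x) hz,
      (chartAt (Cn n) x).left_inv (mem_chart_source _ x), map_mul, Complex.conj_ofReal]
    push_cast
    ring
  rw [traceAt, h1, traceWith_smul]
  rfl

theorem traceAt_gradSqForm_nonneg (hg : IsKahlerConeMetric D β g) (hx : x ∉ D) :
    0 ≤ traceAt g (gradSqForm f) x :=
  traceWith_nonneg (hg.posDef _ (isHolChart_chartAt x) _
    (KahlerCone.mem_regTarget (mem_chart_source (Cn n) x) hx)) _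

theorem normSq10_gradIn (g : Coeffs11 n X) (f : X → ℝ) (x : X) :
    normSq10 g (fun e => gradIn e f) x = traceAt g (gradSqForm f) x :=
  (traceWith_sqForm _ _).symm

end Composition

/-! ### Cone functions as Sobolev functions -/

section Sobolev

variable {n : ℕ} {X : Type*} [TopologicalSpace X] [ChartedSpace (Cn n) X]
  {D : Set X} {β : ℝ} {g : Coeffs11 n X} {e : OpenPartialHomeomorph X (Cn n)} {f : X → ℝ}

theorem locallyIntegrableOn_regTarget (hD : IsClosed D) {u : Cn n → ℂ}
    (hu : ContinuousOn u (regTarget D e)) : LocallyIntegrableOn u (regTarget D e) :=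
  hu.locallyIntegrableOn (isOpen_regTarget hD e).measurableSet

/-- Integration by parts against a test function on the regular part of a chart. -/
theorem integral_inChart_mul_dz (hf : IsC2Off n D f) (hD : IsClosed D) (he : IsHolChart e)
    {χ : Cn n → ℂ} (hχ : ContDiff ℝ ∞ χ) (hc : HasCompactSupport χ)
    (hs : tsupport χ ⊆ regTarget D e) (i : Fin n) :
    ∫ z, inChart e f z * dz i χ z = -∫ z, gradIn e f z i * χ z := by
  have hO := isOpen_regTarget hD e
  have hχ0 : ∀ z ∉ tsupport χ, χ =ᶠ[𝓝 z] fun _ => 0 := fun z hz =>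
    Filter.eventually_of_mem ((isClosed_tsupport χ).isOpen_compl.mem_nhds hz) fun y hy =>
      image_eq_zero_of_notMem_tsupport hy
  have hprod : ContDiff ℝ 1 fun z => inChart e f z * χ z := by
    rw [contDiff_iff_contDiffAt]
    intro z
    by_cases hz : z ∈ tsupport χ
    · exact (((hf e he).contDiffAt (hO.mem_nhds (hs hz))).of_le (by norm_num)).mul
        (hχ.contDiffAt.of_le (by simp))
    · refine contDiffAt_const (c := (0 : ℂ)) |>.congr_of_eventuallyEq ?_
      filter_upwards [hχ0 z hz] with y hy
      rw [hy, mul_zero]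
  have hpc : HasCompactSupport fun z => inChart e f z * χ z := hc.mul_left
  have hA : Continuous fun z => gradIn e f z i * χ z := by
    rw [continuous_iff_continuousAt]
    intro z
    by_cases hz : z ∈ tsupport χ
    · exact ((continuousOn_gradIn hf hD he i).continuousAt (hO.mem_nhds (hs hz))).mul
        hχ.continuous.continuousAt
    · refine (continuousAt_const (y := (0 : ℂ))).congr ?_
      filter_upwards [hχ0 z hz] with y hy
      rw [hy, mul_zero]
  have hAi : Integrable fun z => gradIn e f z i * χ z :=
    hA.integrable_of_hasCompactSupport hc.mul_left
  have hdz0 : ∀ z ∉ tsupport χ, dz i (fun z => inChart e f z * χ z) z = 0 := fun z hz => by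
    have : (fun z => inChart e f z * χ z) =ᶠ[𝓝 z] fun _ => 0 := by
      filter_upwards [hχ0 z hz] with y hy
      rw [hy, mul_zero]
    rw [dz_congr this, dz_const]
  have hdzc : Continuous (dz i fun z => inChart e f z * χ z) := by
    rw [← continuousOn_univ]
    exact (contDiffOn_dz (m := 0) isOpen_univ hprod.contDiffOn (by norm_num) i).continuousOn
  have hdzi : Integrable (dz i fun z => inChart e f z * χ z) :=
    hdzc.integrable_of_hasCompactSupport (HasCompactSupport.intro hc hdz0)
  have heq : (fun z => inChart e f z * dz i χ z) = fun z =>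
      dz i (fun z => inChart e f z * χ z) z - gradIn e f z i * χ z := by
    funext z
    by_cases hz : z ∈ tsupport χ
    · rw [dz_mul (hf.differentiableAt hD he (hs hz))
        (hχ.contDiffAt.differentiableAt (by simp)), gradIn]
      ring
    · rw [hdz0 z hz, dz_congr (hχ0 z hz), dz_const, image_eq_zero_of_notMem_tsupport hz]
      ring
  rw [heq, integral_sub hdzi hAi, integral_dz_eq_zero hprod hpc, zero_sub]

variable [IsManifold 𝓘(ℂ, Cn n) ω X] [T2Space X] [CompactSpace X] [Nonempty X]
  [MeasurableSpace X] [BorelSpace X]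

theorem isProbabilityMeasure_normVol (hD : IsSmoothHypersurface n D)
    (hg : IsKahlerConeMetric D β g) (hfin : vol g univ < ⊤) :
    IsProbabilityMeasure (normVol g) := by
  refine ⟨?_⟩
  rw [normVol, Measure.smul_apply, smul_eq_mul,
    ENNReal.inv_mul_cancel (vol_univ_pos hD hg).ne' hfin.ne]

theorem integral_normVol (g : Coeffs11 n X) (F : X → ℝ) :
    ∫ x, F x ∂(normVol g) = (totalVol g)⁻¹ * ∫ x, F x ∂(vol g) := by
  rw [normVol, integral_smul_measure, ENNReal.toReal_inv, smul_eq_mul]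
  rfl

theorem integrable_normVol (hD : IsSmoothHypersurface n D)
    (hg : IsKahlerConeMetric D β g) {F : X → ℝ} (hF : Integrable F (vol g)) :
    Integrable F (normVol g) :=
  hF.smul_measure (ENNReal.inv_ne_top.2 (vol_univ_pos hD hg).ne')

theorem ae_notMem_divisor_normVol (hD : IsSmoothHypersurface n D) (hg : IsForm11 D g) :
    ∀ᵐ x ∂(normVol g), x ∉ D :=
  Measure.ae_smul_measure (ae_notMem_divisor hD hg) _

/-- Makes cone functions admissible in the Sobolev and Poincaré inequalities, with their classical
differential as the weak one. -/
theorem IsC2Cone.isSobolev12 (hβ : 0 < β) (hβ1 : β ≤ 1) (hD : IsSmoothHypersurface n D)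
    (hg : IsKahlerConeMetric D β g) (hf : IsC2Cone n D β f) :
    IsSobolev12 D g f fun e => gradIn e f where
  memLp := by
    have := isProbabilityMeasure_normVol hD hg (vol_univ_lt_top hβ hβ1 hD hf.hasDivisorCharts hg)
    obtain ⟨C, -, hC⟩ := hf.exists_bound
    refine MemLp.of_bound ((aestronglyMeasurable_of_continuousOn hD hg.isForm
      (continuousOn_of_inChart hD.1 hf.c2)).smul_measure _) C ?_
    filter_upwards [ae_notMem_divisor_normVol hD hg.isForm] with x hx
    exact hC x hx
  isForm := isForm10_gradIn hf.c2 hD.1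
  locInt e he := ⟨locallyIntegrableOn_regTarget hD.1 (hf.c2 e he).continuousOn, fun i =>
    locallyIntegrableOn_regTarget hD.1 (continuousOn_gradIn hf.c2 hD.1 he i)⟩
  weak e he _ hχ hc hs i := integral_inChart_mul_dz hf.c2 hD.1 he hχ hc hs i
  energy := by
    simp only [normSq10_gradIn]
    exact (integrable_normVol hD hg
      (hf.integrable_traceAt_gradSqForm hβ hβ1 hD hg)).lintegral_lt_top

theorem IsC2Cone.lintegral_normSq10 (hβ : 0 < β) (hβ1 : β ≤ 1) (hD : IsSmoothHypersurface n D)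
    (hg : IsKahlerConeMetric D β g) (hf : IsC2Cone n D β f) :
    ∫⁻ x, ENNReal.ofReal (normSq10 g (fun e => gradIn e f) x) ∂(normVol g) =
      ENNReal.ofReal (∫ x, traceAt g (gradSqForm f) x ∂(normVol g)) := by
  simp only [normSq10_gradIn]
  refine (ofReal_integral_eq_lintegral_ofReal (integrable_normVol hD hg
    (hf.integrable_traceAt_gradSqForm hβ hβ1 hD hg)) ?_).symm
  filter_upwards [ae_notMem_divisor_normVol hD hg.isForm] with x hx
  exact traceAt_gradSqForm_nonneg hg hx

end Sobolev

end KahlerCone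

namespace KahlerCone

/-! ### Moser's iteration, abstract part -/

section Iteration

/-- The constant of Moser's iteration for the exponents `2 χᵏ`. -/
noncomputable def moserConst (χ K : ℝ) : ℝ :=
  Real.exp (∑' k : ℕ, Real.log (K * (2 * χ ^ k)) / (2 * χ ^ k))

theorem moserConst_pos (χ K : ℝ) : 0 < moserConst χ K := Real.exp_pos _

/-- The numerators grow linearly in k and the denominators geometrically. -/
theorem summable_moser {χ K : ℝ} (hχ : 1 < χ) (hK : 1 ≤ K) :
    Summable fun k : ℕ => Real.log (K * (2 * χ ^ k)) / (2 * χ ^ k) := by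
  have hχ0 : 0 < χ := by linarith
  have hr : ‖χ⁻¹‖ < 1 := by
    rw [norm_inv, Real.norm_of_nonneg hχ0.le]
    exact inv_lt_one_of_one_lt₀ hχ
  have h1 : Summable fun k : ℕ => Real.log (2 * K) / 2 * χ⁻¹ ^ k :=
    (summable_geometric_of_norm_lt_one hr).mul_left _
  have h2 : Summable fun k : ℕ => Real.log χ / 2 * ((k : ℝ) ^ 1 * χ⁻¹ ^ k) :=
    (summable_pow_mul_geometric_of_norm_lt_one 1 hr).mul_left _
  refine (h1.add h2).congr fun k => ?_
  have h3 : Real.log (K * (2 * χ ^ k)) = Real.log (2 * K) + k * Real.log χ := by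
    rw [← mul_assoc, mul_comm K, Real.log_mul (by positivity) (by positivity), Real.log_pow]
  rw [h3, inv_pow]
  field_simp

/-- With p_k = 2χᵏ, the quantities log N(p_k)/p_k grow by at most log(K·p_k)/p_k at each step, and
these increments are summable. The initial term log N(2)/2 accounts for the square root. -/
theorem moser_sequence {χ K : ℝ} (hχ : 1 < χ) (hK : 1 ≤ K) {N : ℝ → ℝ}
    (h1 : ∀ p, 2 ≤ p → 1 ≤ N p) (hN : ∀ p, 2 ≤ p → N (p * χ) ≤ (K * p * N p) ^ χ) (k : ℕ) :
    N (2 * χ ^ k) ≤ (moserConst χ K * √(N 2)) ^ (2 * χ ^ k) := by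
  have hχ0 : 0 < χ := by linarith
  set b : ℕ → ℝ := fun k => Real.log (K * (2 * χ ^ k)) / (2 * χ ^ k)
  have hp : ∀ k : ℕ, 2 ≤ 2 * χ ^ k := fun k => by
    have := one_le_pow₀ hχ.le (n := k)
    linarith
  have hb : ∀ k, 0 ≤ b k := fun k => by
    refine div_nonneg (Real.log_nonneg ?_) (by linarith [hp k])
    nlinarith [hp k]
  have key : ∀ k : ℕ, Real.log (N (2 * χ ^ k)) ≤
      2 * χ ^ k * (Real.log (N 2) / 2 + ∑ j ∈ Finset.range k, b j) := by
    intro k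
    induction k with
    | zero => simp; linarith
    | succ k ih =>
      have hpk := hp k
      have hNk := h1 _ hpk
      have h2 := hN _ hpk
      have e1 : 2 * χ ^ k * χ = 2 * χ ^ (k + 1) := by ring
      rw [e1] at h2
      have h3 := Real.log_le_log (by linarith [h1 _ (hp (k + 1))]) h2
      have hKp : 0 < K * (2 * χ ^ k) := by positivity
      rw [Real.log_rpow (by positivity), Real.log_mul hKp.ne' (by positivity)] at h3
      have h4 : Real.log (K * (2 * χ ^ k)) = 2 * χ ^ k * b k := by
        simp only [b]
        field_simp
      rw [h4] at h3
      rw [Finset.sum_range_succ]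
      have h5 := mul_le_mul_of_nonneg_left (add_le_add_right ih (2 * χ ^ k * b k)) hχ0.le
      calc _ ≤ _ := h3
        _ ≤ _ := h5
        _ = _ := by ring
  have hsum : ∑ j ∈ Finset.range k, b j ≤ ∑' j, b j :=
    (summable_moser hχ hK).sum_le_tsum _ fun j _ => hb j
  have hN2 := h1 2 le_rfl
  have hk := key k
  have hle : Real.log (N (2 * χ ^ k)) ≤ 2 * χ ^ k * (Real.log (N 2) / 2 + ∑' j, b j) :=
    hk.trans (mul_le_mul_of_nonneg_left (by linarith) (by linarith [hp k]))
  rw [← Real.exp_log (show 0 < N (2 * χ ^ k) by linarith [h1 _ (hp k)]),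
    Real.rpow_def_of_pos (mul_pos (moserConst_pos χ K) (Real.sqrt_pos.2 (by linarith))),
    Real.log_mul (moserConst_pos χ K).ne' (Real.sqrt_pos.2 (by linarith)).ne', moserConst,
    Real.log_exp, Real.log_sqrt (by linarith)]
  refine Real.exp_le_exp.2 (hle.trans (le_of_eq ?_))
  ring

/-- Markov's inequality for the power p_k = 2χᵏ gives the set where v > c a measure of at most
(M/c)^(p_k), which tends to 0 because M < c. No limit of Lᵖ norms is needed. -/
theorem ae_le_of_moser {Ω : Type*} [MeasurableSpace Ω] {ν : Measure Ω} [IsProbabilityMeasure ν]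
    {χ K : ℝ} (hχ : 1 < χ) (hK : 1 ≤ K) {v : Ω → ℝ} (hv : ∀ᵐ x ∂ν, 1 ≤ v x)
    (hi : ∀ p : ℝ, 2 ≤ p → Integrable (fun x => v x ^ p) ν)
    (hN : ∀ p : ℝ, 2 ≤ p → ∫ x, v x ^ (p * χ) ∂ν ≤ (K * p * ∫ x, v x ^ p ∂ν) ^ χ) {c : ℝ}
    (hc : moserConst χ K * √(∫ x, v x ^ (2 : ℝ) ∂ν) < c) : ∀ᵐ x ∂ν, v x ≤ c := by
  set M := moserConst χ K * √(∫ x, v x ^ (2 : ℝ) ∂ν)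
  have hχ0 : 0 < χ := by linarith
  have h1 : ∀ p : ℝ, 2 ≤ p → 1 ≤ ∫ x, v x ^ p ∂ν := fun p hp => by
    have h := integral_mono_ae (integrable_const (1 : ℝ)) (hi p hp) (by
      filter_upwards [hv] with x hx
      exact Real.one_le_rpow hx (by linarith))
    simpa using h
  have hM : 0 < M := mul_pos (moserConst_pos χ K) (Real.sqrt_pos.2 (by linarith [h1 2 le_rfl]))
  have hc0 : 0 < c := hM.trans hc
  have hp : ∀ k : ℕ, 2 ≤ 2 * χ ^ k := fun k => by
    have := one_le_pow₀ hχ.le (n := k)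
    linarith
  have hb : ∀ k : ℕ, ν.real {x | c < v x} ≤ (M / c) ^ (2 * χ ^ k) := by
    intro k
    have h2 := moser_sequence hχ hK (N := fun p => ∫ x, v x ^ p ∂ν) h1 hN k
    have h3 := mul_meas_ge_le_integral_of_nonneg (μ := ν) (f := fun x => v x ^ (2 * χ ^ k))
      (by
        filter_upwards [hv] with x hx
        exact Real.rpow_nonneg (by linarith) _) (hi _ (hp k)) (c ^ (2 * χ ^ k))
    have h4 : ν.real {x | c < v x} ≤ ν.real {x | c ^ (2 * χ ^ k) ≤ v x ^ (2 * χ ^ k)} := by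
      refine measureReal_mono fun x hx => ?_
      exact Real.rpow_le_rpow hc0.le (le_of_lt hx) (by linarith [hp k])
    have hcp : 0 < c ^ (2 * χ ^ k) := Real.rpow_pos_of_pos hc0 _
    rw [Real.div_rpow hM.le hc0.le, le_div_iff₀ hcp, mul_comm]
    exact (mul_le_mul_of_nonneg_left h4 hcp.le).trans (h3.trans h2)
  have hlim : Tendsto (fun k : ℕ => (M / c) ^ (2 * χ ^ k)) atTop (𝓝 0) :=
    (tendsto_rpow_atTop_of_base_lt_one _ (by linarith [div_pos hM hc0])
      ((div_lt_one hc0).2 hc)).comp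
      ((tendsto_pow_atTop_atTop_of_one_lt hχ).const_mul_atTop two_pos)
  have h0 : ν.real {x | c < v x} ≤ 0 := ge_of_tendsto' hlim hb
  have h5 : ν {x | c < v x} = 0 := by
    have := le_antisymm h0 measureReal_nonneg
    rwa [measureReal_eq_zero_iff] at this
  rw [ae_iff]
  simpa using h5

end Iteration

/-! ### Moser's estimate for cone metrics -/

section Moser

variable {n : ℕ} {X : Type*} [TopologicalSpace X] [ChartedSpace (Cn n) X]
  {D : Set X} {β : ℝ} {g : Coeffs11 n X} {e : OpenPartialHomeomorph X (Cn n)} {f v : X → ℝ}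
  [IsManifold 𝓘(ℂ, Cn n) ω X] [T2Space X] [CompactSpace X] [Nonempty X]
  [MeasurableSpace X] [BorelSpace X]

theorem IsC2Cone.integrable (hβ : 0 < β) (hβ1 : β ≤ 1) (hD : IsSmoothHypersurface n D)
    (hg : IsKahlerConeMetric D β g) (hf : IsC2Cone n D β f) : Integrable f (vol g) := by
  obtain ⟨C, -, hC⟩ := hf.exists_bound
  exact integrable_of_bounded hD hg (vol_univ_lt_top hβ hβ1 hD hf.hasDivisorCharts hg)
    (continuousOn_of_inChart hD.1 hf.c2) hC

theorem IsC2Cone.memLp (hβ : 0 < β) (hβ1 : β ≤ 1) (hD : IsSmoothHypersurface n D)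
    (hg : IsKahlerConeMetric D β g) (hf : IsC2Cone n D β f) (q : ℝ≥0∞) :
    MemLp f q (normVol g) := by
  have := isProbabilityMeasure_normVol hD hg (vol_univ_lt_top hβ hβ1 hD hf.hasDivisorCharts hg)
  obtain ⟨C, -, hC⟩ := hf.exists_bound
  refine MemLp.of_bound ((aestronglyMeasurable_of_continuousOn hD hg.isForm
    (continuousOn_of_inChart hD.1 hf.c2)).smul_measure _) C ?_
  filter_upwards [ae_notMem_divisor_normVol hD hg.isForm] with x hx
  exact hC x hx

theorem integral_gradSq_nonneg (hD : IsSmoothHypersurface n D)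
    (hg : IsKahlerConeMetric D β g) : 0 ≤ ∫ x, traceAt g (gradSqForm f) x ∂(normVol g) := by
  refine integral_nonneg_of_ae ?_
  filter_upwards [ae_notMem_divisor_normVol hD hg.isForm] with x hx
  exact traceAt_gradSqForm_nonneg hg hx

theorem eLpNorm_sq_eq {Ω : Type*} [MeasurableSpace Ω] {ν : Measure Ω} {w : Ω → ℝ} {q : ℝ}
    (hq : 0 < q) (hw : MemLp w (ENNReal.ofReal q) ν) :
    eLpNorm w (ENNReal.ofReal q) ν ^ 2 = ENNReal.ofReal ((∫ x, |w x| ^ q ∂ν) ^ (2 / q)) := by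
  rw [hw.eLpNorm_eq_integral_rpow_norm (by simpa using hq) ENNReal.ofReal_ne_top,
    ENNReal.toReal_ofReal hq.le]
  have h0 : 0 ≤ ∫ x, |w x| ^ q ∂ν := integral_nonneg fun x => Real.rpow_nonneg (abs_nonneg _) _
  simp only [Real.norm_eq_abs]
  rw [← ENNReal.ofReal_pow (Real.rpow_nonneg h0 _), ← Real.rpow_natCast, ← Real.rpow_mul h0]
  congr 2
  push_cast
  field_simp

theorem eLpNorm_two_sq_eq {Ω : Type*} [MeasurableSpace Ω] {ν : Measure Ω} {w : Ω → ℝ}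
    (hw : MemLp w 2 ν) : eLpNorm w 2 ν ^ 2 = ENNReal.ofReal (∫ x, w x ^ 2 ∂ν) := by
  have h2 : (2 : ℝ≥0∞) = ENNReal.ofReal 2 := by simp
  have h := eLpNorm_sq_eq (q := 2) two_pos (by rwa [h2] at hw)
  rw [← h2] at h
  rw [h]
  simp [sq_abs]

/-- The maximum with 0 appears because `ENNReal.ofReal` truncates a negative constant to 0. -/
theorem HasSobolevConst.integral_le (hβ : 0 < β) (hβ1 : β ≤ 1) (hD : IsSmoothHypersurface n D)
    (hg : IsKahlerConeMetric D β g) (hn : 2 ≤ n) {A : ℝ} (hA : HasSobolevConst D g A)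
    (hf : IsC2Cone n D β f) :
    (∫ x, |f x| ^ (2 * (n / (n - 1) : ℝ)) ∂(normVol g)) ^ (n / (n - 1) : ℝ)⁻¹ ≤
      max A 0 * (∫ x, traceAt g (gradSqForm f) x ∂(normVol g) + ∫ x, f x ^ 2 ∂(normVol g)) := by
  have hn' : (2 : ℝ) ≤ n := by exact_mod_cast hn
  have hq : 0 < 2 * (n : ℝ) / (n - 1) := div_pos (by linarith) (by linarith)
  have h := hA f _ (hf.isSobolev12 hβ hβ1 hD hg)
  have hE := integral_gradSq_nonneg (f := f) hD hg
  have h2 : 0 ≤ ∫ x, f x ^ 2 ∂(normVol g) := integral_nonneg fun x => sq_nonneg _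
  rw [hf.lintegral_normSq10 hβ hβ1 hD hg, eLpNorm_two_sq_eq (hf.memLp hβ hβ1 hD hg 2),
    eLpNorm_sq_eq hq (hf.memLp hβ hβ1 hD hg _), ← ENNReal.ofReal_add hE h2] at h
  have h3 : ENNReal.ofReal A = ENNReal.ofReal (max A 0) := by
    rcases le_total A 0 with h | h
    · rw [max_eq_right h, ENNReal.ofReal_of_nonpos h, ENNReal.ofReal_zero]
    · rw [max_eq_left h]
  rw [h3, ← ENNReal.ofReal_mul (le_max_right _ _),
    ENNReal.ofReal_le_ofReal_iff (mul_nonneg (le_max_right _ _) (add_nonneg hE h2))] at h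
  have e1 : 2 / (2 * (n : ℝ) / (n - 1)) = (n / (n - 1) : ℝ)⁻¹ := by
    have : (n : ℝ) - 1 ≠ 0 := by linarith
    field_simp
  rwa [e1, mul_div_assoc] at h

theorem HasPoincareConst.integral_le (hβ : 0 < β) (hβ1 : β ≤ 1) (hD : IsSmoothHypersurface n D)
    (hg : IsKahlerConeMetric D β g) {P : ℝ} (hP : HasPoincareConst D g P)
    (hf : IsC2Cone n D β f) :
    ∫ x, (f x - ∫ y, f y ∂(normVol g)) ^ 2 ∂(normVol g) ≤
      max P 0 * ∫ x, traceAt g (gradSqForm f) x ∂(normVol g) := by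
  have := isProbabilityMeasure_normVol hD hg (vol_univ_lt_top hβ hβ1 hD hf.hasDivisorCharts hg)
  have h := hP f _ (hf.isSobolev12 hβ hβ1 hD hg)
  have hE := integral_gradSq_nonneg (f := f) hD hg
  have hm : MemLp (fun x => f x - ∫ y, f y ∂(normVol g)) 2 (normVol g) :=
    (hf.memLp hβ hβ1 hD hg 2).sub (memLp_const _)
  rw [hf.lintegral_normSq10 hβ hβ1 hD hg, eLpNorm_two_sq_eq hm] at h
  have h3 : ENNReal.ofReal P = ENNReal.ofReal (max P 0) := by
    rcases le_total P 0 with h | h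
    · rw [max_eq_right h, ENNReal.ofReal_of_nonpos h, ENNReal.ofReal_zero]
    · rw [max_eq_left h]
  rwa [h3, ← ENNReal.ofReal_mul (le_max_right _ _),
    ENNReal.ofReal_le_ofReal_iff (mul_nonneg (le_max_right _ _) hE)] at h

theorem contDiffOn_rpow (p : ℝ) : ContDiffOn ℝ 2 (fun y : ℝ => y ^ p) (Ioi 0) := fun _ hy =>
  (Real.contDiffAt_rpow_const_of_ne (ne_of_gt hy)).contDiffWithinAt

theorem IsC2Cone.rpow (hD : IsClosed D) (hv : IsC2Cone n D β v) (h1 : ∀ x ∉ D, 1 ≤ v x) (p : ℝ) :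
    IsC2Cone n D β fun x => v x ^ p := by
  obtain ⟨C, -, hC⟩ := hv.exists_bound
  exact hv.comp hD isOpen_Ioi (contDiffOn_rpow p) (isCompact_Icc (a := 1) (b := C))
    (fun y hy => lt_of_lt_of_le one_pos hy.1) fun x hx => ⟨h1 x hx, (le_abs_self _).trans (hC x hx)⟩

theorem deriv_rpow {p : ℝ} (hp : 1 ≤ p) :
    deriv (fun y : ℝ => y ^ p) = fun y => p * y ^ (p - 1) :=
  funext fun _ => (Real.hasDerivAt_rpow_const (Or.inr hp)).deriv

/-- The energy of `v^(p/2)` for a function `v ≥ 1` with Laplacian bounded below. -/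
theorem energy_rpow_le (hβ : 0 < β) (hβ1 : β ≤ 1) (hD : IsSmoothHypersurface n D)
    (hg : IsKahlerConeMetric D β g) (hv : IsC2Cone n D β v) (h1 : ∀ x ∉ D, 1 ≤ v x) {Λ p : ℝ}
    (hΛ : 0 ≤ Λ) (hlap : ∀ x ∉ D, -Λ ≤ traceAt g (hessForm v) x) (hp : 2 ≤ p) :
    ∫ x, traceAt g (gradSqForm fun x => v x ^ (p / 2)) x ∂(normVol g) ≤
      p / 2 * Λ * ∫ x, v x ^ p ∂(normVol g) := by
  have hvp := hv.rpow hD.1 h1 p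
  have hw := hv.rpow hD.1 h1 (p / 2)
  have hpos : ∀ x ∉ D, v x ∈ Ioi (0 : ℝ) := fun x hx => lt_of_lt_of_le one_pos (h1 x hx)
  have hS : ∫ x, traceAt g (hessForm fun x => v x ^ p) x ∂(normVol g) = 0 := by
    rw [integral_normVol, hvp.integral_traceAt_hessForm hβ hβ1 hD hg, mul_zero]
  -- Here Δ(v^p) = p v^(p-1) Δv + p(p-1) v^(p-2)|∂v|², while |∂v^(p/2)|² = (p²/4) v^(p-2)|∂v|²; the
  -- factor p/(4(p-1)) matches the gradient terms. The bound v ≥ 1 replaces v^(p-1) by v^p in the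
  -- error.
  have hpt : ∀ x ∉ D, traceAt g (gradSqForm fun x => v x ^ (p / 2)) x ≤
      p / (4 * (p - 1)) * (traceAt g (hessForm fun x => v x ^ p) x + p * Λ * v x ^ p) := by
    intro x hx
    have h0 := hpos x hx
    have hg0 := traceAt_gradSqForm_nonneg (f := v) hg hx
    rw [traceAt_gradSqForm_comp hv.c2 hD.1 isOpen_Ioi (contDiffOn_rpow _) hpos hx,
      traceAt_hessForm_comp hv.c2 hD.1 isOpen_Ioi (contDiffOn_rpow _) hpos hx,
      deriv_rpow (by linarith), deriv_rpow (by linarith),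
      ((Real.hasDerivAt_rpow_const (Or.inr (by linarith : 1 ≤ p - 1))).const_mul p).deriv]
    set T := traceAt g (gradSqForm v) x
    set L := traceAt g (hessForm v) x
    have e1 : (p / 2 * v x ^ (p / 2 - 1)) ^ 2 = p ^ 2 / 4 * v x ^ (p - 1 - 1) := by
      rw [mul_pow, ← Real.rpow_natCast (v x ^ (p / 2 - 1)), ← Real.rpow_mul (le_of_lt h0)]
      congr 1
      · ring
      · congr 1
        push_cast
        ring
    have e2 : v x ^ (p - 1) ≤ v x ^ p := Real.rpow_le_rpow_of_exponent_le (h1 x hx) (by linarith)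
    have e3 : 0 ≤ v x ^ (p - 1) := Real.rpow_nonneg (le_of_lt h0) _
    have e4 : 0 ≤ L * v x ^ (p - 1) + Λ * v x ^ p := by
      have := mul_le_mul_of_nonneg_right (hlap x hx) e3
      have := mul_le_mul_of_nonneg_left e2 hΛ
      linarith
    rw [e1]
    have hp1 : p - 1 ≠ 0 := by linarith
    have e5 : p / (4 * (p - 1)) * (p * v x ^ (p - 1) * L + p * ((p - 1) * v x ^ (p - 1 - 1)) * T +
        p * Λ * v x ^ p) = p ^ 2 / 4 * v x ^ (p - 1 - 1) * T +
          p / (4 * (p - 1)) * (p * (L * v x ^ (p - 1) + Λ * v x ^ p)) := by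
      field_simp
      ring
    rw [e5]
    have e6 : 0 ≤ p / (4 * (p - 1)) := div_nonneg (by linarith) (by linarith)
    have := mul_nonneg e6 (mul_nonneg (by linarith : 0 ≤ p) e4)
    linarith
  have i1 := integrable_normVol hD hg (hw.integrable_traceAt_gradSqForm hβ hβ1 hD hg)
  have i2 := integrable_normVol hD hg (hvp.integrable_traceAt_hessForm hβ hβ1 hD hg)
  have i3 := integrable_normVol hD hg (hvp.integrable hβ hβ1 hD hg)
  have h2 := integral_mono_ae i1 ((i2.add (i3.const_mul (p * Λ))).const_mul (p / (4 * (p - 1)))) (by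
    filter_upwards [ae_notMem_divisor_normVol hD hg.isForm] with x hx
    exact hpt x hx)
  refine h2.trans ?_
  rw [integral_const_mul, integral_add' i2 (i3.const_mul _), hS, zero_add, integral_const_mul]
  have hN : 0 ≤ ∫ x, v x ^ p ∂(normVol g) := by
    refine integral_nonneg_of_ae ?_
    filter_upwards [ae_notMem_divisor_normVol hD hg.isForm] with x hx
    exact Real.rpow_nonneg (le_of_lt (hpos x hx)) _
  -- Equivalent to p ≤ 2(p-1), hence the restriction to p ≥ 2.
  have e7 : p / (4 * (p - 1)) * p ≤ p / 2 := by
    rw [div_mul_eq_mul_div, div_le_div_iff₀ (by linarith) two_pos]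
    nlinarith
  calc _ = p / (4 * (p - 1)) * p * (Λ * ∫ x, v x ^ p ∂(normVol g)) := by ring
    _ ≤ p / 2 * (Λ * ∫ x, v x ^ p ∂(normVol g)) :=
      mul_le_mul_of_nonneg_right e7 (mul_nonneg hΛ hN)
    _ = _ := by ring

/-- Moser's estimate of the maximum of a function whose Laplacian is bounded below. -/
theorem sup_le_of_sobolev (hβ : 0 < β) (hβ1 : β ≤ 1) (hD : IsSmoothHypersurface n D)
    (hg : IsKahlerConeMetric D β g) (hn : 2 ≤ n) {A : ℝ} (hA : HasSobolevConst D g A)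
    (hv : IsC2Cone n D β v) (h1 : ∀ x ∉ D, 1 ≤ v x) {Λ : ℝ}
    (hΛ : 0 ≤ Λ) (hlap : ∀ x ∉ D, -Λ ≤ traceAt g (hessForm v) x) {x : X} (hx : x ∉ D) :
    v x ≤ moserConst (n / (n - 1)) (max A 1 * (Λ + 1)) * √(∫ x, v x ^ (2 : ℝ) ∂(normVol g)) := by
  have := isProbabilityMeasure_normVol hD hg (vol_univ_lt_top hβ hβ1 hD hv.hasDivisorCharts hg)
  have hn' : (2 : ℝ) ≤ n := by exact_mod_cast hn
  have hχ : 1 < (n / (n - 1) : ℝ) := by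
    rw [one_lt_div (by linarith)]
    linarith
  set χ : ℝ := n / (n - 1)
  have hχ0 : 0 < χ := by linarith
  -- The Sobolev inequality for v^(p/2) and the energy bound give A(pΛ/2 + 1)∫v^p, which is at most
  -- K·p·∫v^p. The maximum with 1 ensures K ≥ 1, as the iteration requires.
  set K := max A 1 * (Λ + 1)
  have hK : 1 ≤ K := one_le_mul_of_one_le_of_one_le (le_max_right _ _) (by linarith)
  have hae := ae_notMem_divisor_normVol hD hg.isForm
  have hpos : ∀ x ∉ D, 0 < v x := fun x hx => lt_of_lt_of_le one_pos (h1 x hx)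
  have hi : ∀ p : ℝ, Integrable (fun x => v x ^ p) (normVol g) := fun p =>
    integrable_normVol hD hg ((hv.rpow hD.1 h1 p).integrable hβ hβ1 hD hg)
  have hN : ∀ p : ℝ, 2 ≤ p →
      ∫ x, v x ^ (p * χ) ∂(normVol g) ≤ (K * p * ∫ x, v x ^ p ∂(normVol g)) ^ χ := by
    intro p hp
    have h2 := hA.integral_le hβ hβ1 hD hg hn (hv.rpow hD.1 h1 (p / 2))
    have h3 := energy_rpow_le hβ hβ1 hD hg hv h1 hΛ hlap hp
    have e1 : ∫ x, |v x ^ (p / 2)| ^ (2 * χ) ∂(normVol g) = ∫ x, v x ^ (p * χ) ∂(normVol g) := by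
      refine integral_congr_ae ?_
      filter_upwards [hae] with x hx
      rw [abs_of_nonneg (Real.rpow_nonneg (hpos x hx).le _), ← Real.rpow_mul (hpos x hx).le]
      congr 1
      ring
    have e2 : ∫ x, (v x ^ (p / 2)) ^ 2 ∂(normVol g) = ∫ x, v x ^ p ∂(normVol g) := by
      refine integral_congr_ae ?_
      filter_upwards [hae] with x hx
      rw [← Real.rpow_natCast, ← Real.rpow_mul (hpos x hx).le]
      congr 1
      push_cast
      ring
    rw [e1, e2] at h2
    set Np := ∫ x, v x ^ p ∂(normVol g)
    have hNp : 0 ≤ Np := by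
      refine integral_nonneg_of_ae ?_
      filter_upwards [hae] with x hx
      exact Real.rpow_nonneg (hpos x hx).le _
    have hM : 0 ≤ ∫ x, v x ^ (p * χ) ∂(normVol g) := by
      refine integral_nonneg_of_ae ?_
      filter_upwards [hae] with x hx
      exact Real.rpow_nonneg (hpos x hx).le _
    have h4 : (∫ x, v x ^ (p * χ) ∂(normVol g)) ^ χ⁻¹ ≤ K * p * Np := by
      refine h2.trans ?_
      have a1 : max A 0 ≤ max A 1 := max_le_max le_rfl zero_le_one
      have a2 : p / 2 * Λ * Np + Np ≤ (Λ + 1) * p * Np := by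
        have := mul_nonneg (mul_nonneg (by linarith : 0 ≤ p / 2) hΛ) hNp
        nlinarith
      calc _ ≤ max A 0 * (p / 2 * Λ * Np + Np) :=
            mul_le_mul_of_nonneg_left (by linarith) (le_max_right _ _)
        _ ≤ max A 1 * ((Λ + 1) * p * Np) :=
            mul_le_mul a1 a2 (by positivity) (zero_le_one.trans (le_max_right _ _))
        _ = _ := by ring
    have h5 := Real.rpow_le_rpow (Real.rpow_nonneg hM _) h4 hχ0.le
    rwa [← Real.rpow_mul hM, inv_mul_cancel₀ hχ0.ne', Real.rpow_one] at h5
  -- The iteration bounds v only by constants strictly above the claimed one; density of ℝ closes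
  -- the gap.
  refine le_of_forall_gt_imp_ge_of_dense fun c hc => ?_
  have h6 := ae_le_of_moser hχ hK (hae.mono h1) (fun p _ => hi p) hN hc
  have h7 : ∀ᵐ x ∂(vol g), v x ≤ c := by
    have hfin := vol_univ_lt_top hβ hβ1 hD hv.hasDivisorCharts hg
    rwa [normVol, Measure.ae_ennreal_smul_measure_iff (ENNReal.inv_ne_zero.2 hfin.ne)] at h6
  exact le_of_ae_le hD hg (continuousOn_of_inChart hD.1 hv.c2) h7 hx

end Moser

end KahlerCone

namespace KahlerCone

/-! ### Aubin's functional and the Dirichlet energy -/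

section Aubin

variable {n : ℕ} {X : Type*} [TopologicalSpace X] [ChartedSpace (Cn n) X]
  {D : Set X} {β : ℝ} {g g' : Coeffs11 n X} {φ F : X → ℝ} {s : ℝ} {x : X}
  [IsManifold 𝓘(ℂ, Cn n) ω X]

/-- The quotient of the volume forms of `ω + s √-1 ∂∂̄φ` and `ω`. -/
noncomputable def segRatio (g : Coeffs11 n X) (φ : X → ℝ) (s : ℝ) (x : X) : ℝ :=
  (g (chartAt (Cn n) x) (chartAt (Cn n) x x) +
    (s : ℂ) • hessIn (chartAt (Cn n) x) φ (chartAt (Cn n) x x)).det.re /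
    (g (chartAt (Cn n) x) (chartAt (Cn n) x x)).det.re

theorem volRatio_withPotential (hφ : IsC2Off n D φ) (hD : IsClosed D) (hx : x ∉ D) :
    volRatio g (withPotential g fun x => s * φ x) x = segRatio g φ s x := by
  rw [volRatio, withPotential_const_mul hφ hD (isHolChart_chartAt x)
    (KahlerCone.mem_regTarget (mem_chart_source (Cn n) x) hx)]
  rfl

theorem posDef_chartAt (hg : IsKahlerConeMetric D β g) (hx : x ∉ D) :
    (g (chartAt (Cn n) x) (chartAt (Cn n) x x)).PosDef :=
  hg.posDef _ (isHolChart_chartAt x) _ (KahlerCone.mem_regTarget (mem_chart_source (Cn n) x) hx)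

theorem traceAt_withPotential (hφ : IsC2Off n D φ) (hD : IsClosed D) (hx : x ∉ D)
    (h : Coeffs11 n X) : traceAt (withPotential g fun x => s * φ x) h x =
      traceWith (g (chartAt (Cn n) x) (chartAt (Cn n) x x) +
        (s : ℂ) • hessIn (chartAt (Cn n) x) φ (chartAt (Cn n) x x))
        (h (chartAt (Cn n) x) (chartAt (Cn n) x x)) := by
  rw [traceAt, withPotential_const_mul hφ hD (isHolChart_chartAt x)
    (KahlerCone.mem_regTarget (mem_chart_source (Cn n) x) hx)]

theorem segRatio_zero (hg : IsKahlerConeMetric D β g) (hx : x ∉ D) : segRatio g φ 0 x = 1 := by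
  rw [segRatio, Complex.ofReal_zero, zero_smul, add_zero]
  exact div_self (det_re_pos (posDef_chartAt hg hx)).ne'

theorem hasDerivAt_segRatio (hg : IsKahlerConeMetric D β g) (hφ : IsC2Off n D φ)
    (hD : IsClosed D) (hg' : IsKahlerConeMetric D β (withPotential g φ)) (hx : x ∉ D)
    (hs : s ∈ Icc (0 : ℝ) 1) : HasDerivAt (fun s => segRatio g φ s x)
      (traceAt (withPotential g fun x => s * φ x) (hessForm φ) x * segRatio g φ s x) s := by
  rw [traceAt_withPotential hφ hD hx]
  have h := hasDerivAt_det_segment (posDef_chartAt hg hx) (posDef_chartAt hg' hx) hs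
  have h2 := h.div_const (g (chartAt (Cn n) x) (chartAt (Cn n) x x)).det.re
  rw [mul_div_assoc] at h2
  exact h2

theorem abs_traceAt_mul_segRatio_le (hg : IsKahlerConeMetric D β g) (hφ : IsC2Off n D φ)
    (hD : IsClosed D) (hg' : IsKahlerConeMetric D β (withPotential g φ)) {C : ℝ} (hC0 : 0 ≤ C)
    (hC : FormLE D g (hessForm φ) C) (hx : x ∉ D) (hs : s ∈ Icc (0 : ℝ) 1) :
    |traceAt (withPotential g fun x => s * φ x) (hessForm φ) x * segRatio g φ s x| ≤
      n * C * (1 + C) ^ n := by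
  have hz := KahlerCone.mem_regTarget (mem_chart_source (Cn n) x) hx
  have h := abs_traceWith_mul_det_segment_le (posDef_chartAt hg hx) (posDef_chartAt hg' hx)
    hC0 hs (hC _ (isHolChart_chartAt x) _ hz)
  have hpos := det_re_pos (posDef_chartAt hg hx)
  rw [traceAt_withPotential hφ hD hx, segRatio, ← mul_div_assoc, abs_div, abs_of_pos hpos,
    div_le_iff₀ hpos]
  exact h

/-- Mean value inequality from the value 1 at s = 0, using the uniform bound on the derivative. -/
theorem abs_segRatio_le (hg : IsKahlerConeMetric D β g) (hφ : IsC2Off n D φ)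
    (hD : IsClosed D) (hg' : IsKahlerConeMetric D β (withPotential g φ)) {C : ℝ} (hC0 : 0 ≤ C)
    (hC : FormLE D g (hessForm φ) C) (hx : x ∉ D) (hs : s ∈ Icc (0 : ℝ) 1) :
    |segRatio g φ s x| ≤ 1 + n * C * (1 + C) ^ n := by
  have h := (convex_Icc (0 : ℝ) 1).norm_image_sub_le_of_norm_hasDerivWithin_le
    (fun r hr => (hasDerivAt_segRatio hg hφ hD hg' hx hr).hasDerivWithinAt)
    (fun r hr => abs_traceAt_mul_segRatio_le hg hφ hD hg' hC0 hC hx hr)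
    (left_mem_Icc.2 zero_le_one) hs
  rw [segRatio_zero hg hx, Real.norm_eq_abs, Real.norm_eq_abs, sub_zero, abs_of_nonneg hs.1] at h
  have h2 : n * C * (1 + C) ^ n * s ≤ n * C * (1 + C) ^ n :=
    mul_le_of_le_one_right (by positivity) hs.2
  have h3 := abs_add_le (segRatio g φ s x - 1) 1
  rw [sub_add_cancel, abs_one] at h3
  linarith

/-- Compares the gradient density of ω_s with that of ω; the pointwise input is ω_s ≥ (1-s)ω. -/
theorem traceAt_gradSq_segment_ge (hg : IsKahlerConeMetric D β g) (hφ : IsC2Off n D φ)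
    (hD : IsClosed D) (hg' : IsKahlerConeMetric D β (withPotential g φ)) (hx : x ∉ D)
    (hs : s ∈ Icc (0 : ℝ) 1) : (1 - s) ^ (n - 1) * traceAt g (gradSqForm φ) x ≤
      segRatio g φ s x * traceAt (withPotential g fun x => s * φ x) (gradSqForm φ) x := by
  have h := traceWith_sqForm_segment_ge (posDef_chartAt hg hx) (posDef_chartAt hg' hx) hs
    (gradIn (chartAt (Cn n) x) φ (chartAt (Cn n) x x))
  have hpos := det_re_pos (posDef_chartAt hg hx)
  rw [traceAt_withPotential hφ hD hx, segRatio, div_mul_eq_mul_div, le_div_iff₀ hpos,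
    mul_assoc, mul_comm (Complex.re _) (traceWith _ _)]
  exact h

variable [T2Space X] [CompactSpace X] [Nonempty X] [MeasurableSpace X] [BorelSpace X]

theorem volRatio_nonneg (hg : IsKahlerConeMetric D β g) (hg' : IsKahlerConeMetric D β g')
    (hx : x ∉ D) : 0 ≤ volRatio g g' x :=
  div_nonneg (det_re_pos (posDef_chartAt hg' hx)).le (det_re_pos (posDef_chartAt hg hx)).le

theorem integral_vol_eq (hD : IsSmoothHypersurface n D) (hg : IsKahlerConeMetric D β g)
    (hg' : IsKahlerConeMetric D β g') (F : X → ℝ) :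
    ∫ x, F x ∂(vol g') = ∫ x, volRatio g g' x * F x ∂(vol g) := by
  rw [vol_eq_withDensity hD hg hg', integral_withDensity_eq_integral_toReal_smul₀
    (aestronglyMeasurable_of_continuousOn hD hg.isForm
      (continuousOn_volRatio hD.1 hg hg')).aemeasurable.ennreal_ofReal
    (Eventually.of_forall fun _ => ENNReal.ofReal_lt_top)]
  refine integral_congr_ae ?_
  filter_upwards [ae_notMem_divisor hD hg.isForm] with x hx
  rw [ENNReal.toReal_ofReal (volRatio_nonneg hg hg' hx), smul_eq_mul]

theorem integral_vol_segment (hD : IsSmoothHypersurface n D) (hg : IsKahlerConeMetric D β g)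
    (hφ : IsC2Off n D φ) (hg' : IsKahlerConeMetric D β (withPotential g φ))
    (hs : s ∈ Icc (0 : ℝ) 1) (F : X → ℝ) :
    ∫ x, F x ∂(vol (withPotential g fun x => s * φ x)) =
      ∫ x, segRatio g φ s x * F x ∂(vol g) := by
  rw [integral_vol_eq hD hg (isKahlerConeMetric_segment hD.1 hg hφ hg' hs)]
  refine integral_congr_ae ?_
  filter_upwards [ae_notMem_divisor hD hg.isForm] with x hx
  rw [volRatio_withPotential hφ hD.1 hx]

theorem continuousOn_segRatio (hD : IsClosed D) (hg : IsKahlerConeMetric D β g)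
    (hφ : IsC2Off n D φ) (hg' : IsKahlerConeMetric D β (withPotential g φ))
    (hs : s ∈ Icc (0 : ℝ) 1) : ContinuousOn (segRatio g φ s) Dᶜ :=
  (continuousOn_volRatio hD hg (isKahlerConeMetric_segment hD hg hφ hg' hs)).congr
    fun _ hx => (volRatio_withPotential hφ hD hx).symm

/-- The derivative of an integral for the measures `(ω + s √-1 ∂∂̄φ)ⁿ`. -/
theorem integral_segRatio_deriv (hβ : 0 < β) (hβ1 : β ≤ 1) (hD : IsSmoothHypersurface n D)
    (hg : IsKahlerConeMetric D β g) (hφ : IsC2Cone n D β φ)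
    (hg' : IsKahlerConeMetric D β (withPotential g φ)) (hF : ContinuousOn F Dᶜ) {B : ℝ}
    (hB : ∀ x ∉ D, |F x| ≤ B) :
    ContinuousOn (fun s => ∫ x, segRatio g φ s x * F x ∂(vol g)) (Icc 0 1) ∧
    ∀ s ∈ Ioo (0 : ℝ) 1, HasDerivAt (fun s => ∫ x, segRatio g φ s x * F x ∂(vol g))
      (∫ x, traceAt (withPotential g fun x => s * φ x) (hessForm φ) x * F x
        ∂(vol (withPotential g fun x => s * φ x))) s := by
  obtain ⟨C, hC0, hC⟩ := hφ.exists_formLE_hess hβ hβ1 hD.1 hg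
  have hfin := vol_univ_lt_top hβ hβ1 hD hφ.hasDivisorCharts hg
  have : IsFiniteMeasure (vol g) := ⟨hfin⟩
  have hae := ae_notMem_divisor hD hg.isForm
  have hmeas : ∀ s ∈ Icc (0 : ℝ) 1, AEStronglyMeasurable (fun x => segRatio g φ s x * F x) (vol g) :=
    fun s hs => aestronglyMeasurable_of_continuousOn hD hg.isForm
      ((continuousOn_segRatio hD.1 hg hφ.c2 hg' hs).mul hF)
  set C' := n * C * (1 + C) ^ n
  have hbd : ∀ s ∈ Icc (0 : ℝ) 1, ∀ x ∉ D, ‖segRatio g φ s x * F x‖ ≤ (1 + C') * B := by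
    intro s hs x hx
    rw [norm_mul]
    exact mul_le_mul (abs_segRatio_le hg hφ.c2 hD.1 hg' hC0 hC hx hs) (hB x hx) (norm_nonneg _)
      ((abs_nonneg _).trans (abs_segRatio_le hg hφ.c2 hD.1 hg' hC0 hC hx hs))
  refine ⟨continuousOn_of_dominated (bound := fun _ => (1 + C') * B) hmeas
    (fun s hs => hae.mono fun x hx => hbd s hs x hx) (integrable_const _) ?_, fun s hs => ?_⟩
  · filter_upwards [hae] with x hx s hs
    exact ((hasDerivAt_segRatio hg hφ.c2 hD.1 hg' hx hs).continuousAt.mul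
      continuousAt_const).continuousWithinAt
  · have hs' := Ioo_subset_Icc_self hs
    have hseg := isKahlerConeMetric_segment hD.1 hg hφ.c2 hg' hs'
    have h := (hasDerivAt_integral_of_dominated_loc_of_deriv_le (μ := vol g)
      (F := fun s x => segRatio g φ s x * F x)
      (F' := fun s x => traceAt (withPotential g fun x => s * φ x) (hessForm φ) x *
        segRatio g φ s x * F x) (bound := fun _ => C' * B) (Ioo_mem_nhds hs.1 hs.2)
      (Filter.eventually_of_mem (Ioo_mem_nhds hs.1 hs.2) fun r hr =>
        hmeas r (Ioo_subset_Icc_self hr))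
      (Integrable.of_bound (hmeas s hs') ((1 + C') * B) (hae.mono fun x hx => hbd s hs' x hx))
      (aestronglyMeasurable_of_continuousOn hD hg.isForm
        (((continuousOn_traceAt_hessForm hD.1 hseg hφ.c2).mul
          (continuousOn_segRatio hD.1 hg hφ.c2 hg' hs')).mul hF))
      (by
        filter_upwards [hae] with x hx r hr
        have hb := abs_traceAt_mul_segRatio_le hg hφ.c2 hD.1 hg' hC0 hC hx (Ioo_subset_Icc_self hr)
        rw [norm_mul]
        exact mul_le_mul hb (hB x hx) (norm_nonneg _) ((abs_nonneg _).trans hb))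
      (integrable_const _)
      (by
        filter_upwards [hae] with x hx r hr
        exact (hasDerivAt_segRatio hg hφ.c2 hD.1 hg' hx (Ioo_subset_Icc_self hr)).mul_const _)).2
    rw [integral_vol_segment hD hg hφ.c2 hg' hs']
    simp only [← mul_assoc, mul_comm (segRatio g φ s _) (traceAt _ _ _)]
    exact h

theorem withPotential_one_mul (g : Coeffs11 n X) (φ : X → ℝ) :
    (withPotential g fun x => 1 * φ x) = withPotential g φ := by
  simp only [one_mul]

/-- The total volume does not change along `ω + s √-1 ∂∂̄φ`. -/
theorem totalVol_withPotential (hβ : 0 < β) (hβ1 : β ≤ 1) (hD : IsSmoothHypersurface n D)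
    (hg : IsKahlerConeMetric D β g) (hφ : IsC2Cone n D β φ)
    (hg' : IsKahlerConeMetric D β (withPotential g φ)) :
    totalVol (withPotential g φ) = totalVol g := by
  obtain ⟨hc, hd⟩ := integral_segRatio_deriv (F := fun _ => 1) (B := 1) hβ hβ1 hD hg hφ hg'
    continuousOn_const (by simp)
  have hd0 : ∀ s ∈ Ioo (0 : ℝ) 1,
      HasDerivAt (fun s => ∫ x, segRatio g φ s x * 1 ∂(vol g)) 0 s := fun s hs => by
    have h := hd s hs
    simp only [mul_one] at h ⊢
    rwa [hφ.integral_traceAt_hessForm hβ hβ1 hD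
      (isKahlerConeMetric_segment hD.1 hg hφ.c2 hg' (Ioo_subset_Icc_self hs))] at h
  -- The derivative vanishes on the open interval only, so continuity at the endpoints is what
  -- allows s = 0 and s = 1 to be compared.
  have h1 : ∫ x, segRatio g φ 1 x * 1 ∂(vol g) = ∫ x, segRatio g φ 0 x * 1 ∂(vol g) := by
    have key : Convex ℝ (Icc (0 : ℝ) 1) := convex_Icc 0 1
    refine le_antisymm ?_ ?_
    · refine antitoneOn_of_deriv_nonpos key hc ?_ ?_ (left_mem_Icc.2 zero_le_one)
        (right_mem_Icc.2 zero_le_one) zero_le_one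
      · rw [interior_Icc]
        exact fun s hs => (hd0 s hs).differentiableAt.differentiableWithinAt
      · rw [interior_Icc]
        exact fun s hs => (hd0 s hs).deriv.le
    · refine monotoneOn_of_deriv_nonneg key hc ?_ ?_ (left_mem_Icc.2 zero_le_one)
        (right_mem_Icc.2 zero_le_one) zero_le_one
      · rw [interior_Icc]
        exact fun s hs => (hd0 s hs).differentiableAt.differentiableWithinAt
      · rw [interior_Icc]
        exact fun s hs => (hd0 s hs).deriv.ge
  have h2 := integral_vol_segment hD hg hφ.c2 hg' (right_mem_Icc.2 zero_le_one) fun _ => (1 : ℝ)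
  have h3 := integral_vol_segment hD hg hφ.c2 hg' (left_mem_Icc.2 zero_le_one) fun _ => (1 : ℝ)
  rw [withPotential_one_mul, h1] at h2
  have h4 : ∫ x, segRatio g φ 0 x * 1 ∂(vol g) = ∫ x, (1 : ℝ) ∂(vol g) := by
    refine integral_congr_ae ?_
    filter_upwards [ae_notMem_divisor hD hg.isForm] with x hx
    rw [segRatio_zero hg hx, one_mul]
  rw [h4] at h2
  simpa [totalVol, Measure.real] using h2

/-- Green's formula, from the vanishing integral of Δ(φ²/2) = φΔφ + |∂φ|². -/
theorem IsC2Cone.integral_mul_traceAt (hβ : 0 < β) (hβ1 : β ≤ 1) (hD : IsSmoothHypersurface n D)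
    (hg : IsKahlerConeMetric D β g) (hφ : IsC2Cone n D β φ) :
    ∫ x, traceAt g (hessForm φ) x * φ x ∂(vol g) =
      -∫ x, traceAt g (gradSqForm φ) x ∂(vol g) := by
  obtain ⟨C, hC0, hC⟩ := hφ.exists_bound
  have hF : ContDiffOn ℝ 2 (fun y : ℝ => y ^ 2 / 2) univ :=
    ((contDiff_id.pow 2).div_const 2).contDiffOn
  have hd : deriv (fun y : ℝ => y ^ 2 / 2) = fun y => y := by
    funext y
    simp
  have hsq := hφ.comp hD.1 isOpen_univ hF (isCompact_Icc (a := -C) (b := C)) (subset_univ _)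
    fun x hx => abs_le.1 (hC x hx)
  have h1 := hsq.integral_traceAt_hessForm hβ hβ1 hD hg
  have i2 := hφ.integrable_traceAt_gradSqForm hβ hβ1 hD hg
  have h2 : ∀ᵐ x ∂(vol g), traceAt g (hessForm φ) x * φ x =
      traceAt g (hessForm fun x => φ x ^ 2 / 2) x - traceAt g (gradSqForm φ) x := by
    filter_upwards [ae_notMem_divisor hD hg.isForm] with x hx
    have h3 := traceAt_hessForm_comp (g := g) hφ.c2 hD.1 isOpen_univ hF (fun _ _ => mem_univ _) hx
    rw [hd] at h3
    rw [h3]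
    simp
    ring
  rw [integral_congr_ae h2, integral_sub (hsq.integrable_traceAt_hessForm hβ hβ1 hD hg) i2, h1,
    zero_sub]

theorem totalVol_pos (hβ : 0 < β) (hβ1 : β ≤ 1) (hD : IsSmoothHypersurface n D)
    (hg : IsKahlerConeMetric D β g) (hφ : IsC2Cone n D β φ) : 0 < totalVol g :=
  ENNReal.toReal_pos (vol_univ_pos hD hg).ne'
    (vol_univ_lt_top hβ hβ1 hD hφ.hasDivisorCharts hg).ne

/-- The Dirichlet energy is bounded by Aubin's functional. -/
theorem energy_le_aubinI (hn : 0 < n) (hβ : 0 < β) (hβ1 : β ≤ 1)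
    (hD : IsSmoothHypersurface n D) (hg : IsKahlerConeMetric D β g) (hφ : IsC2Cone n D β φ)
    (hg' : IsKahlerConeMetric D β (withPotential g φ)) :
    ∫ x, traceAt g (gradSqForm φ) x ∂(normVol g) ≤ n * aubinI g φ := by
  obtain ⟨B, -, hB⟩ := hφ.exists_bound
  obtain ⟨hc, hd⟩ := integral_segRatio_deriv hβ hβ1 hD hg hφ hg'
    (continuousOn_of_inChart hD.1 hφ.c2) hB
  set E := ∫ x, traceAt g (gradSqForm φ) x ∂(vol g)
  have hn' : (0 : ℝ) < n := by exact_mod_cast hn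
  -- The derivative of ∫φ ω_sⁿ is minus the energy of φ for ω_s by Green's formula, hence at most
  -- -(1-s)^(n-1) times the energy for ω.
  have hJ : ∀ s ∈ Ioo (0 : ℝ) 1, ∫ x, traceAt (withPotential g fun x => s * φ x) (hessForm φ) x *
      φ x ∂(vol (withPotential g fun x => s * φ x)) ≤ -((1 - s) ^ (n - 1) * E) := by
    intro s hs
    have hs' := Ioo_subset_Icc_self hs
    have hseg := isKahlerConeMetric_segment hD.1 hg hφ.c2 hg' hs'
    rw [hφ.integral_mul_traceAt hβ hβ1 hD hseg, neg_le_neg_iff,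
      integral_vol_segment hD hg hφ.c2 hg' hs', ← integral_const_mul]
    obtain ⟨C, hC0, hC⟩ := hφ.exists_formLE_hess hβ hβ1 hD.1 hg
    obtain ⟨C', hC0', hC'⟩ := hφ.exists_formLE_gradSq hβ hβ1 hD.1 hseg
    have i1 : Integrable (fun x => segRatio g φ s x *
        traceAt (withPotential g fun x => s * φ x) (gradSqForm φ) x) (vol g) := by
      refine integrable_of_bounded (C := (1 + n * C * (1 + C) ^ n) * (n * C')) hD hg
        (vol_univ_lt_top hβ hβ1 hD hφ.hasDivisorCharts hg)
        ((continuousOn_segRatio hD.1 hg hφ.c2 hg' hs').mul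
          (continuousOn_traceAt_gradSqForm hD.1 hseg hφ.c2)) fun x hx => ?_
      have hb := abs_segRatio_le hg hφ.c2 hD.1 hg' hC0 hC hx hs'
      rw [abs_mul]
      exact mul_le_mul hb (abs_traceAt_le hseg hC' hx) (abs_nonneg _) ((abs_nonneg _).trans hb)
    refine integral_mono_ae
      ((hφ.integrable_traceAt_gradSqForm hβ hβ1 hD hg).const_mul _) i1 ?_
    filter_upwards [ae_notMem_divisor hD hg.isForm] with x hx
    exact traceAt_gradSq_segment_ge hg hφ.c2 hD.1 hg' hx hs'
  have hpoly : ∀ s : ℝ, HasDerivAt (fun s : ℝ => (1 - s) ^ n * (E / n))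
      (-((1 - s) ^ (n - 1) * E)) s := fun s => by
    have h := ((((hasDerivAt_id s).const_sub 1).pow n).mul_const (E / n))
    convert! h using 1
    simp only [id]
    field_simp
  -- The subtracted term is a primitive of the upper bound for the derivative. Comparing s = 0 with
  -- s = 1 gives E/n ≤ ∫φ ωⁿ - ∫φ ω_φⁿ.
  have hanti : AntitoneOn (fun s => ∫ x, segRatio g φ s x * φ x ∂(vol g) -
      (1 - s) ^ n * (E / n)) (Icc 0 1) := by
    refine antitoneOn_of_deriv_nonpos (convex_Icc 0 1)
      (hc.sub fun s _ => (hpoly s).continuousAt.continuousWithinAt) ?_ ?_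
    · rw [interior_Icc]
      exact fun s hs => ((hd s hs).sub (hpoly s)).differentiableAt.differentiableWithinAt
    · rw [interior_Icc]
      intro s hs
      rw [((hd s hs).fun_sub (hpoly s)).deriv]
      linarith [hJ s hs]
  have h1 := hanti (left_mem_Icc.2 zero_le_one) (right_mem_Icc.2 zero_le_one) zero_le_one
  simp only [← integral_vol_segment hD hg hφ.c2 hg' (right_mem_Icc.2 zero_le_one),
    sub_self, zero_pow hn.ne', zero_mul, sub_zero, one_pow, one_mul] at h1
  have h2 : ∫ x, segRatio g φ 0 x * φ x ∂(vol g) = ∫ x, φ x ∂(vol g) := by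
    refine integral_congr_ae ?_
    filter_upwards [ae_notMem_divisor hD hg.isForm] with x hx
    rw [segRatio_zero hg hx, one_mul]
  rw [h2] at h1
  have hV := totalVol_pos hβ hβ1 hD hg hφ
  rw [integral_normVol, aubinI, one_div, mul_left_comm]
  refine mul_le_mul_of_nonneg_left ?_ (inv_nonneg.2 hV.le)
  have h3 : E / n ≤ ∫ x, φ x ∂(vol g) - ∫ x, φ x ∂(vol (withPotential g φ)) := by linarith
  rw [div_le_iff₀ hn'] at h3
  linarith

theorem aubinI_nonneg (hn : 0 < n) (hβ : 0 < β) (hβ1 : β ≤ 1)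
    (hD : IsSmoothHypersurface n D) (hg : IsKahlerConeMetric D β g) (hφ : IsC2Cone n D β φ)
    (hg' : IsKahlerConeMetric D β (withPotential g φ)) : 0 ≤ aubinI g φ := by
  have h := (integral_gradSq_nonneg (f := φ) hD hg).trans
    (energy_le_aubinI hn hβ hβ1 hD hg hφ hg')
  exact nonneg_of_mul_nonneg_right h (by exact_mod_cast hn)

theorem aubinI_eq_sub (hβ : 0 < β) (hβ1 : β ≤ 1) (hD : IsSmoothHypersurface n D)
    (hg : IsKahlerConeMetric D β g) (hφ : IsC2Cone n D β φ)
    (hg' : IsKahlerConeMetric D β (withPotential g φ)) :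
    aubinI g φ = ∫ x, φ x ∂(normVol g) - ∫ x, φ x ∂(normVol (withPotential g φ)) := by
  rw [aubinI, integral_normVol, integral_normVol,
    totalVol_withPotential hβ hβ1 hD hg hφ hg']
  ring

end Aubin

end KahlerCone

namespace KahlerCone

/-! ### A smooth convex substitute for the positive part -/

section Softplus

theorem hasDerivAt_softplus (a y : ℝ) :
    HasDerivAt (fun y : ℝ => Real.log (1 + Real.exp (y - a)) + 1)
      (1 - (1 + Real.exp (y - a))⁻¹) y := by
  have hpos : 1 + Real.exp (y - a) ≠ 0 := by positivity
  have h1 := (((((hasDerivAt_id y).sub_const a).exp).const_add 1).log hpos).add_const 1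
  refine h1.congr_deriv ?_
  simp only [id]
  field_simp
  ring

theorem hasDerivAt_deriv_softplus (a y : ℝ) :
    HasDerivAt (fun y : ℝ => 1 - (1 + Real.exp (y - a))⁻¹)
      (Real.exp (y - a) / (1 + Real.exp (y - a)) ^ 2) y := by
  have hpos : 1 + Real.exp (y - a) ≠ 0 := by positivity
  have h1 := (((((hasDerivAt_id y).sub_const a).exp).const_add 1).fun_inv hpos).const_sub 1
  refine h1.congr_deriv ?_
  simp only [id]
  ring

theorem deriv_softplus (a : ℝ) : deriv (fun y : ℝ => Real.log (1 + Real.exp (y - a)) + 1) =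
    fun y => 1 - (1 + Real.exp (y - a))⁻¹ :=
  funext fun y => (hasDerivAt_softplus a y).deriv

theorem contDiff_softplus (a : ℝ) :
    ContDiff ℝ 2 fun y : ℝ => Real.log (1 + Real.exp (y - a)) + 1 := by
  refine ContDiff.add (ContDiff.log ?_ fun y => by positivity) contDiff_const
  exact contDiff_const.add (Real.contDiff_exp.comp (contDiff_id.sub contDiff_const))

theorem softplus_le (u : ℝ) : Real.log (1 + Real.exp u) ≤ |u| + 1 := by
  rw [Real.log_le_iff_le_exp (by positivity)]
  have h1 : Real.exp u ≤ Real.exp |u| := Real.exp_le_exp.2 (le_abs_self u)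
  have h2 : 1 ≤ Real.exp |u| := Real.one_le_exp (abs_nonneg u)
  have h3 := Real.add_one_le_exp 1
  rw [Real.exp_add]
  nlinarith

theorem le_softplus (u : ℝ) : u ≤ Real.log (1 + Real.exp u) := by
  rw [Real.le_log_iff_exp_le (by positivity)]
  linarith

end Softplus

/-! ### The oscillation estimate for a single potential -/

section Estimate

variable {n : ℕ} {X : Type*} [TopologicalSpace X] [ChartedSpace (Cn n) X]
  {D : Set X} {β : ℝ} {g : Coeffs11 n X} {φ : X → ℝ} {x : X}
  [IsManifold 𝓘(ℂ, Cn n) ω X]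

theorem hessForm_eq_withPotential_sub (g : Coeffs11 n X) (φ : X → ℝ)
    (e : OpenPartialHomeomorph X (Cn n)) (z : Cn n) :
    hessForm φ e z = withPotential g φ e z - g e z := by
  rw [withPotential_apply, add_sub_cancel_left]
  rfl

theorem neg_le_traceAt_hessForm (hg : IsKahlerConeMetric D β g)
    (hg' : IsKahlerConeMetric D β (withPotential g φ)) (hx : x ∉ D) :
    -(n : ℝ) ≤ traceAt g (hessForm φ) x := by
  rw [traceAt, hessForm_eq_withPotential_sub g]
  exact neg_le_traceWith_sub (posDef_chartAt hg hx) (posDef_chartAt hg' hx)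

theorem traceAt_withPotential_hessForm_le (hg : IsKahlerConeMetric D β g)
    (hg' : IsKahlerConeMetric D β (withPotential g φ)) (hx : x ∉ D) :
    traceAt (withPotential g φ) (hessForm φ) x ≤ n := by
  rw [traceAt, hessForm_eq_withPotential_sub g]
  exact traceWith_sub_le (posDef_chartAt hg hx) (posDef_chartAt hg' hx)

variable [T2Space X] [CompactSpace X] [Nonempty X] [MeasurableSpace X] [BorelSpace X]

/-- The Moser constant of a metric with Sobolev constant `A`, for functions with `Δv ≥ -n`. -/
noncomputable def supConst (n : ℕ) (A : ℝ) : ℝ :=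
  moserConst (n / (n - 1)) (max A 1 * (n + 1))

theorem supConst_pos (n : ℕ) (A : ℝ) : 0 < supConst n A := moserConst_pos _ _

/-- Moser's estimate is applied to v = log(1 + exp(φ - a)) + 1, with a the mean of φ. This function
is at least 1 and at least φ - a. It is convex in φ with slope between 0 and 1, so the bound Δφ ≥ -n
passes to v. -/
theorem sub_average_le (hβ : 0 < β) (hβ1 : β ≤ 1) (hD : IsSmoothHypersurface n D)
    (hg : IsKahlerConeMetric D β g) (hn : 2 ≤ n) {A : ℝ} (hA : HasSobolevConst D g A)
    (hφ : IsC2Cone n D β φ) (hlap : ∀ x ∉ D, -(n : ℝ) ≤ traceAt g (hessForm φ) x) (hx : x ∉ D) :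
    φ x - ∫ y, φ y ∂(normVol g) ≤ 2 * supConst n A *
      (∫ y, (φ y - ∫ y, φ y ∂(normVol g)) ^ 2 ∂(normVol g) + 3) := by
  have := isProbabilityMeasure_normVol hD hg (vol_univ_lt_top hβ hβ1 hD hφ.hasDivisorCharts hg)
  set a := ∫ y, φ y ∂(normVol g)
  obtain ⟨B, -, hB⟩ := hφ.exists_bound
  have hF : ContDiffOn ℝ 2 (fun y : ℝ => Real.log (1 + Real.exp (y - a)) + 1) univ :=
    (contDiff_softplus a).contDiffOn
  set v : X → ℝ := fun x => Real.log (1 + Real.exp (φ x - a)) + 1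
  have hv : IsC2Cone n D β v := hφ.comp hD.1 isOpen_univ hF (isCompact_Icc (a := -B) (b := B))
    (subset_univ _) fun x hx => abs_le.1 (hB x hx)
  have hv1 : ∀ x, 1 ≤ v x := fun x => by
    have := Real.log_nonneg (by linarith [Real.exp_pos (φ x - a)] : 1 ≤ 1 + Real.exp (φ x - a))
    simp only [v]
    linarith
  have hlapv : ∀ x ∉ D, -(n : ℝ) ≤ traceAt g (hessForm v) x := by
    intro x hx
    have h1 := traceAt_hessForm_comp (g := g) hφ.c2 hD.1 isOpen_univ hF (fun _ _ => mem_univ _) hx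
    rw [h1, deriv_softplus, (hasDerivAt_deriv_softplus a _).deriv]
    have h2 : 0 ≤ Real.exp (φ x - a) / (1 + Real.exp (φ x - a)) ^ 2 := by positivity
    have h3 := mul_nonneg h2 (traceAt_gradSqForm_nonneg (f := φ) hg hx)
    have h4 : 0 < (1 + Real.exp (φ x - a))⁻¹ := by positivity
    have h5 : (1 + Real.exp (φ x - a))⁻¹ ≤ 1 :=
      inv_le_one_of_one_le₀ (by linarith [Real.exp_pos (φ x - a)])
    have h6 := mul_le_mul_of_nonneg_left (hlap x hx) (sub_nonneg.2 h5)
    have h7 : (0 : ℝ) ≤ n := n.cast_nonneg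
    have h8 := mul_nonneg h4.le h7
    linarith
  have key := sup_le_of_sobolev hβ hβ1 hD hg hn hA hv (fun x _ => hv1 x) n.cast_nonneg hlapv hx
  set σ := ∫ y, (φ y - a) ^ 2 ∂(normVol g)
  have hσ : 0 ≤ σ := integral_nonneg fun _ => sq_nonneg _
  have hint : ∫ x, v x ^ (2 : ℝ) ∂(normVol g) ≤ 2 * σ + 8 := by
    have i1 : Integrable (fun x => v x ^ (2 : ℝ)) (normVol g) := by
      have := (hv.memLp hβ hβ1 hD hg 2).integrable_sq
      simpa only [Real.rpow_two] using this
    have i2 : Integrable (fun x => (φ x - a) ^ 2) (normVol g) :=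
      MemLp.integrable_sq ((hφ.memLp hβ hβ1 hD hg 2).sub (memLp_const a))
    -- From v ≤ |φ - a| + 2 and (u + 2)² ≤ 2u² + 8.
    have h1 : ∫ x, v x ^ (2 : ℝ) ∂(normVol g) ≤ ∫ x, (2 * (φ x - a) ^ 2 + 8) ∂(normVol g) := by
      refine integral_mono i1 ((i2.const_mul 2).add (integrable_const 8)) fun x => ?_
      have h2 : v x ≤ |φ x - a| + 2 := by
        have := softplus_le (φ x - a)
        simp only [v]
        linarith
      have h3 := hv1 x
      have h4 := sq_abs (φ x - a)
      simp only [Real.rpow_two]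
      nlinarith [sq_nonneg (|φ x - a| - 2)]
    rw [integral_add (i2.const_mul 2) (integrable_const 8), integral_const_mul] at h1
    simpa using h1
  -- Trading √(2σ + 8) for the larger 2(σ + 3) keeps the bound linear in the variance, and hence in
  -- I.
  have hsqrt : √(∫ x, v x ^ (2 : ℝ) ∂(normVol g)) ≤ 2 * (σ + 3) := by
    refine (Real.sqrt_le_sqrt hint).trans ?_
    rw [Real.sqrt_le_left (by linarith)]
    nlinarith
  have h1 : φ x - a ≤ v x := by
    have := le_softplus (φ x - a)
    simp only [v]
    linarith
  calc φ x - a ≤ _ := h1.trans key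
    _ ≤ supConst n A * (2 * (σ + 3)) := mul_le_mul_of_nonneg_left hsqrt (supConst_pos n A).le
    _ = _ := by ring

/-- Moser's estimate for v = M - φ + 1, whose Laplacian is at least -n. Bounding ∫v² by sup v · ∫v
lets the supremum absorb itself, so the mean of φ replaces an L² norm and no Poincaré inequality is
needed for this metric. -/
theorem sup_sub_le (hβ : 0 < β) (hβ1 : β ≤ 1) (hD : IsSmoothHypersurface n D)
    (hg : IsKahlerConeMetric D β g) (hn : 2 ≤ n) {S : ℝ} (hS : HasSobolevConst D g S)
    (hφ : IsC2Cone n D β φ) (hlap : ∀ x ∉ D, traceAt g (hessForm φ) x ≤ n) {M : ℝ}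
    (hM : ∀ x ∉ D, φ x ≤ M) (hx : x ∉ D) :
    M - φ x + 1 ≤ supConst n S ^ 2 * (M + 1 - ∫ y, φ y ∂(normVol g)) := by
  have := isProbabilityMeasure_normVol hD hg (vol_univ_lt_top hβ hβ1 hD hφ.hasDivisorCharts hg)
  obtain ⟨B, -, hB⟩ := hφ.exists_bound
  have hF : ContDiffOn ℝ 2 (fun y : ℝ => M - y + 1) univ :=
    ((contDiff_const.sub contDiff_id).add contDiff_const).contDiffOn
  set v : X → ℝ := fun x => M - φ x + 1
  have hv : IsC2Cone n D β v := hφ.comp hD.1 isOpen_univ hF (isCompact_Icc (a := -B) (b := B))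
    (subset_univ _) fun x hx => abs_le.1 (hB x hx)
  have hv1 : ∀ x ∉ D, 1 ≤ v x := fun x hx => by
    have := hM x hx
    simp only [v]
    linarith
  have hd : deriv (fun y : ℝ => M - y + 1) = fun _ => -1 := by
    funext y
    exact (((hasDerivAt_id y).const_sub M).add_const 1).deriv
  have hlapv : ∀ x ∉ D, -(n : ℝ) ≤ traceAt g (hessForm v) x := by
    intro x hx
    have h1 := traceAt_hessForm_comp (g := g) hφ.c2 hD.1 isOpen_univ hF (fun _ _ => mem_univ _) hx
    rw [h1, hd]
    simp only [deriv_const, zero_mul, add_zero]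
    linarith [hlap x hx]
  have hne : (v '' Dᶜ).Nonempty := (nonempty_compl_divisor (n := n) hD).image v
  obtain ⟨B', -, hB'⟩ := hv.exists_bound
  have hbdd : BddAbove (v '' Dᶜ) := ⟨B', by
    rintro _ ⟨y, hy, rfl⟩
    exact (le_abs_self _).trans (hB' y hy)⟩
  set Q := sSup (v '' Dᶜ)
  have hvQ : ∀ x ∉ D, v x ≤ Q := fun x hx => le_csSup hbdd ⟨x, hx, rfl⟩
  have hQ : 0 < Q := lt_of_lt_of_le one_pos ((hv1 x hx).trans (hvQ x hx))
  have i1 := integrable_normVol hD hg (hv.integrable hβ hβ1 hD hg)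
  set T := ∫ x, v x ∂(normVol g)
  have hint : ∫ x, v x ^ (2 : ℝ) ∂(normVol g) ≤ Q * T := by
    rw [← integral_const_mul]
    refine integral_mono_ae ?_ (i1.const_mul Q) ?_
    · have := (hv.memLp hβ hβ1 hD hg 2).integrable_sq
      simpa only [Real.rpow_two] using this
    · filter_upwards [ae_notMem_divisor_normVol hD hg.isForm] with x hx
      have := mul_le_mul_of_nonneg_right (hvQ x hx) (by linarith [hv1 x hx] : 0 ≤ v x)
      simp only [Real.rpow_two]
      linarith [sq (v x)]
  set c := supConst n S
  have hc : 0 < c := supConst_pos n S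
  have key : Q ≤ c * √(Q * T) := by
    refine csSup_le hne ?_
    rintro _ ⟨y, hy, rfl⟩
    refine (sup_le_of_sobolev hβ hβ1 hD hg hn hS hv hv1 n.cast_nonneg hlapv hy).trans ?_
    exact mul_le_mul_of_nonneg_left (Real.sqrt_le_sqrt hint) hc.le
  have hT : 0 ≤ T := by
    refine integral_nonneg_of_ae ?_
    filter_upwards [ae_notMem_divisor_normVol hD hg.isForm] with x hx
    exact zero_le_one.trans (hv1 x hx)
  have h2 : Q ^ 2 ≤ c ^ 2 * (Q * T) := by
    have := pow_le_pow_left₀ hQ.le key 2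
    rwa [mul_pow, Real.sq_sqrt (mul_nonneg hQ.le hT)] at this
  -- Division of Q² ≤ c²·Q·T by Q > 0.
  have h3 : Q ≤ c ^ 2 * T := by
    by_contra h
    have := mul_lt_mul_of_pos_left (not_le.1 h) hQ
    nlinarith
  have h4 : T = M + 1 - ∫ y, φ y ∂(normVol g) := by
    have i2 := integrable_normVol hD hg (hφ.integrable hβ hβ1 hD hg)
    have h5 : ∀ x, v x = M + 1 - φ x := fun x => by
      simp only [v]
      ring
    simp only [T, h5]
    rw [integral_sub (integrable_const _) i2]
    simp
  rw [← h4]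
  exact (hvQ x hx).trans h3

theorem osc_le_of_forall {f : X → ℝ} {c : ℝ} (hne : (Dᶜ : Set X).Nonempty)
    (h : ∀ x ∉ D, ∀ y ∉ D, f x - f y ≤ c) : osc D f ≤ c := by
  have hne' := hne.image f
  have h1 : ∀ y ∉ D, sSup (f '' Dᶜ) ≤ c + f y := fun y hy => csSup_le hne' (by
    rintro _ ⟨x, hx, rfl⟩
    linarith [h x hx y hy])
  have h2 : sSup (f '' Dᶜ) - c ≤ sInf (f '' Dᶜ) := le_csInf hne' (by
    rintro _ ⟨y, hy, rfl⟩
    linarith [h1 y hy])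
  rw [osc]
  linarith

theorem sub_le_osc {f : X → ℝ} {B : ℝ} (hB : ∀ x ∉ D, |f x| ≤ B) {x y : X} (hx : x ∉ D)
    (hy : y ∉ D) : f x - f y ≤ osc D f := by
  have h1 : f x ≤ sSup (f '' Dᶜ) := le_csSup ⟨B, by
    rintro _ ⟨y, hy, rfl⟩
    exact (abs_le.1 (hB y hy)).2⟩ ⟨x, hx, rfl⟩
  have h2 : sInf (f '' Dᶜ) ≤ f y := csInf_le ⟨-B, by
    rintro _ ⟨y, hy, rfl⟩
    exact (abs_le.1 (hB y hy)).1⟩ ⟨y, hy, rfl⟩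
  rw [osc]
  linarith

/-- The constant of the zero order estimate for a single potential. -/
noncomputable def oscConst (n : ℕ) (A P S : ℝ) : ℝ :=
  supConst n S ^ 2 * (2 * supConst n A * (max P 0 * n + 3) + 1)

theorem oscConst_nonneg (n : ℕ) (A P S : ℝ) : 0 ≤ oscConst n A P S := by
  have := supConst_pos n A
  have := le_max_right P 0
  unfold oscConst
  positivity

/-- The drop of φ below M is controlled by M minus the mean for ω_φ. That difference is M minus the
mean for ω, bounded by Poincaré and the energy, plus exactly I. -/
theorem osc_le_aubinI (hβ : 0 < β) (hβ1 : β ≤ 1) (hD : IsSmoothHypersurface n D)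
    (hg : IsKahlerConeMetric D β g) (hn : 2 ≤ n) (hφ : IsC2Cone n D β φ)
    (hg' : IsKahlerConeMetric D β (withPotential g φ)) {A P S : ℝ} (hA : HasSobolevConst D g A)
    (hP : HasPoincareConst D g P) (hS : HasSobolevConst D (withPotential g φ) S) :
    osc D φ ≤ oscConst n A P S * (aubinI g φ + 1) := by
  have hn0 : 0 < n := by omega
  have hI := aubinI_nonneg hn0 hβ hβ1 hD hg hφ hg'
  have hE := energy_le_aubinI hn0 hβ hβ1 hD hg hφ hg'
  have hPo := hP.integral_le hβ hβ1 hD hg hφ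
  have hIeq := aubinI_eq_sub hβ hβ1 hD hg hφ hg'
  obtain ⟨B, -, hB⟩ := hφ.exists_bound
  have hne := nonempty_compl_divisor (n := n) hD
  have hbdd : BddAbove (φ '' Dᶜ) := ⟨B, by
    rintro _ ⟨y, hy, rfl⟩
    exact (abs_le.1 (hB y hy)).2⟩
  set M := sSup (φ '' Dᶜ)
  have hM : ∀ x ∉ D, φ x ≤ M := fun x hx => le_csSup hbdd ⟨x, hx, rfl⟩
  set a := ∫ y, φ y ∂(normVol g)
  set I := aubinI g φ
  set c := 2 * supConst n A
  have hc : 0 < c := mul_pos two_pos (supConst_pos n A)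
  set p := max P 0
  have hp : 0 ≤ p := le_max_right _ _
  have h1 : M - a ≤ c * (p * (n * I) + 3) := by
    have h2 : M ≤ a + c * (p * (n * I) + 3) := by
      refine csSup_le (hne.image φ) ?_
      rintro _ ⟨x, hx, rfl⟩
      have h3 := sub_average_le hβ hβ1 hD hg hn hA hφ
        (fun x hx => neg_le_traceAt_hessForm hg hg' hx) hx
      have h4 := hPo.trans (mul_le_mul_of_nonneg_left hE hp)
      have h5 := mul_le_mul_of_nonneg_left (add_le_add_left h4 3) hc.le
      linarith
    linarith
  refine osc_le_of_forall hne fun x hx y hy => ?_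
  have h2 := sup_sub_le hβ hβ1 hD hg' hn hS hφ
    (fun x hx => traceAt_withPotential_hessForm_le hg hg' hx) hM hy
  -- The mean for ω_φ is a - I, so the left side is (M - a) + I + 1; the constants are then enlarged
  -- to factor out I + 1.
  have h3 : M + 1 - ∫ y, φ y ∂(normVol (withPotential g φ)) ≤
      (c * (p * n + 3) + 1) * (I + 1) := by
    have : 0 ≤ c * (p * n) := by positivity
    have : 0 ≤ c * 3 * I := by positivity
    linarith
  calc φ x - φ y ≤ M - φ y + 1 := by linarith [hM x hx]
    _ ≤ _ := h2
    _ ≤ supConst n S ^ 2 * ((c * (p * n + 3) + 1) * (I + 1)) :=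
      mul_le_mul_of_nonneg_left h3 (sq_nonneg _)
    _ = _ := by
      rw [oscConst]
      ring

end Estimate

end KahlerCone

namespace KahlerCone

/-! ### Continuity of the oscillation and of Aubin's functional along the path -/

section Continuity

variable {n : ℕ} {X : Type*} [TopologicalSpace X] [ChartedSpace (Cn n) X]
  {D : Set X} {β α : ℝ} {g : Coeffs11 n X} {φ : ℝ → X → ℝ} {f u : X → ℝ} {x : X}
  {e : OpenPartialHomeomorph X (Cn n)} {z : Cn n}

theorem IsC2Off.sub (hf : IsC2Off n D f) (hu : IsC2Off n D u) :
    IsC2Off n D fun x => f x - u x := by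
  intro e he
  have h : inChart e (fun x => f x - u x) = fun z => inChart e f z - inChart e u z := by
    funext z
    simp [inChart]
  rw [h]
  exact (hf e he).sub (hu e he)

theorem hessIn_add_sub (hf : IsC2Off n D f) (hu : IsC2Off n D u) (hD : IsClosed D)
    (he : IsHolChart e) (hz : z ∈ regTarget D e) :
    hessIn e f z = hessIn e u z + hessIn e (fun x => f x - u x) z := by
  -- Writes f as the two-term sum u + (f - u), so that additivity is read off from `hessIn_sum`.
  have h := hessIn_sum (z := z) (e := e) Finset.univ
    (F := fun i : Fin 2 => if i = 0 then u else fun x => f x - u x) hD (fun i _ => by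
      fin_cases i
      · exact hu
      · exact hf.sub hu) he hz
  simpa [Fin.sum_univ_two] using h

theorem eventually_abs_sub_le [CompactSpace X] (hc : ContinuousHolder2 n D β α φ) {s : ℝ}
    (hs : s ∈ Icc (0 : ℝ) 1) {ε : ℝ} (hε : 0 < ε) :
    ∀ᶠ t in 𝓝[Icc 0 1] s, ∀ x ∉ D, |φ t x - φ s x| ≤ ε := by
  have key : ∀ᶠ t in 𝓝[Icc 0 1] s, ∀ x ∈ (univ : Set X), x ∉ D → |φ t x - φ s x| ≤ ε := by
    refine isCompact_univ.induction_on (p := fun T : Set X => ∀ᶠ t in 𝓝[Icc 0 1] s,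
      ∀ x ∈ T, x ∉ D → |φ t x - φ s x| ≤ ε) ?_ ?_ ?_ ?_
    · exact Eventually.of_forall fun t x hx => hx.elim
    · exact fun T T' hT hT' => hT'.mono fun t ht x hx => ht x (hT hx)
    · intro T T' h h'
      filter_upwards [h, h'] with t h1 h2 x hx
      exact hx.elim (h1 x) (h2 x)
    · intro p _
      obtain ⟨e, k, he, hp, U, hU, h⟩ := hc s hs p
      refine ⟨_, mem_nhdsWithin_of_mem_nhds (mem_nhds_chart_preimage hp hU), ?_⟩
      filter_upwards [h ε hε] with t ht x hx hxD
      have h1 := (ht.bounds he ⟨hx.2, KahlerCone.mem_regTarget hx.1 hxD⟩).1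
      rwa [inChart, e.left_inv hx.1, Complex.norm_real, Real.norm_eq_abs] at h1
  exact key.mono fun t ht x => ht x (mem_univ x)

/-- Smallness of the Hessian of φ_t - φ_s in the cone frame becomes smallness relative to ω_{φ_s},
by quasi-isometry and compactness. The local tolerance is chosen to cancel the factor n·β⁻²·c of
`quadForm_bound_of_frame`. -/
theorem eventually_formLE_sub [CompactSpace X] (hn : 0 < n) (hβ : 0 < β) (hβ1 : β ≤ 1)
    (hD : IsClosed D) (hφ : IsContinuityPath D β α g φ) {s : ℝ} (hs : s ∈ Icc (0 : ℝ) 1) {ε : ℝ}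
    (hε : 0 < ε) : ∀ᶠ t in 𝓝[Icc 0 1] s,
      FormLE D (withPotential g (φ s)) (hessForm fun x => φ t x - φ s x) ε := by
  have hg := hφ.isMetric s hs
  refine eventually_formLE hg.isForm self_mem_nhdsWithin (fun t ht =>
    isForm11_hessForm (IsC2Off.sub (hφ.memHolder t ht).1 (hφ.memHolder s hs).1) hD) fun p => ?_
  obtain ⟨e, k, he, hp, U, hU, h⟩ := hφ.continuous s hs p
  obtain ⟨U', hU', c, hc, hq⟩ := hg.quasiIsometric e k he (e p) (e.map_source hp)
  have hn' : (0 : ℝ) < n := by exact_mod_cast hn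
  have hpos : 0 < n * (β ^ 2)⁻¹ * c := by positivity
  refine ⟨e, he.1, hp, U ∩ U', inter_mem hU hU', ?_⟩
  filter_upwards [h (ε / (n * (β ^ 2)⁻¹ * c)) (by positivity)] with t ht z hz v
  have h1 := quadForm_bound_of_frame (N := ε / (n * (β ^ 2)⁻¹ * c)) hβ hβ1 he hc (by positivity)
    hz.2 (fun v => (hq z ⟨hz.1.2, hz.2⟩ v).1) (ht.bounds he ⟨hz.1.1, hz.2⟩).2.2 v
  have h2 : ε / (n * (β ^ 2)⁻¹ * c) * n * (β ^ 2)⁻¹ * c = ε := by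
    field_simp
  rwa [h2] at h1

variable [IsManifold 𝓘(ℂ, Cn n) ω X]

theorem volRatio_bounds (hD : IsClosed D) (hg : IsKahlerConeMetric D β g)
    (hf : IsC2Off n D f) (hu : IsC2Off n D u)
    (hgu : IsKahlerConeMetric D β (withPotential g u)) {ε : ℝ} (hε1 : ε ≤ 1)
    (h : FormLE D (withPotential g u) (hessForm fun x => f x - u x) ε) (hx : x ∉ D) :
    (1 - ε) ^ n * volRatio g (withPotential g u) x ≤ volRatio g (withPotential g f) x ∧
    volRatio g (withPotential g f) x ≤ (1 + ε) ^ n * volRatio g (withPotential g u) x := by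
  have he := isHolChart_chartAt (n := n) x
  have hz := KahlerCone.mem_regTarget (mem_chart_source (Cn n) x) hx
  obtain ⟨h1, h2⟩ := det_add_bounds (posDef_chartAt hgu hx)
    (isHermitian_hessIn (hf.sub hu) hD he hz) hε1 (h _ he _ hz)
  have h3 : withPotential g f (chartAt (Cn n) x) (chartAt (Cn n) x x) =
      withPotential g u (chartAt (Cn n) x) (chartAt (Cn n) x x) +
        hessIn (chartAt (Cn n) x) (fun x => f x - u x) (chartAt (Cn n) x x) := by
    rw [withPotential_apply, withPotential_apply, hessIn_add_sub hf hu hD he hz, add_assoc]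
  have hpos := det_re_pos (posDef_chartAt hg hx)
  rw [volRatio, volRatio, h3, ← mul_div_assoc, ← mul_div_assoc]
  exact ⟨div_le_div_of_nonneg_right h1 hpos.le, div_le_div_of_nonneg_right h2 hpos.le⟩

/-- The ratio is squeezed between (1-ε)ⁿ and (1+ε)ⁿ times its value at s, for every small ε. -/
theorem tendsto_volRatio [CompactSpace X] (hn : 0 < n) (hβ : 0 < β) (hβ1 : β ≤ 1)
    (hD : IsClosed D) (hg : IsKahlerConeMetric D β g) (hφ : IsContinuityPath D β α g φ) {s : ℝ}
    (hs : s ∈ Icc (0 : ℝ) 1) (hx : x ∉ D) :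
    Tendsto (fun t => volRatio g (withPotential g (φ t)) x) (𝓝[Icc 0 1] s)
      (𝓝 (volRatio g (withPotential g (φ s)) x)) := by
  set r := volRatio g (withPotential g (φ s)) x
  have hb : ∀ ε : ℝ, 0 < ε → ε ≤ 1 → ∀ᶠ t in 𝓝[Icc 0 1] s,
      (1 - ε) ^ n * r ≤ volRatio g (withPotential g (φ t)) x ∧
        volRatio g (withPotential g (φ t)) x ≤ (1 + ε) ^ n * r := fun ε hε hε1 => by
    filter_upwards [eventually_formLE_sub hn hβ hβ1 hD hφ hs hε, self_mem_nhdsWithin] with t ht htI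
    exact volRatio_bounds hD hg (hφ.memHolder t htI).1 (hφ.memHolder s hs).1 (hφ.isMetric s hs)
      hε1 ht hx
  have hc1 : Tendsto (fun ε : ℝ => (1 - ε) ^ n * r) (𝓝[>] 0) (𝓝 r) := by
    have : Continuous fun ε : ℝ => (1 - ε) ^ n * r := by fun_prop
    simpa using (this.tendsto 0).mono_left nhdsWithin_le_nhds
  have hc2 : Tendsto (fun ε : ℝ => (1 + ε) ^ n * r) (𝓝[>] 0) (𝓝 r) := by
    have : Continuous fun ε : ℝ => (1 + ε) ^ n * r := by fun_prop
    simpa using (this.tendsto 0).mono_left nhdsWithin_le_nhds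
  have hsmall : ∀ᶠ ε : ℝ in 𝓝[>] 0, 0 < ε ∧ ε ≤ 1 := by
    filter_upwards [self_mem_nhdsWithin, nhdsWithin_le_nhds (Iic_mem_nhds (zero_lt_one' ℝ))]
      with ε h1 h2
    exact ⟨h1, h2⟩
  refine tendsto_order.2 ⟨fun a ha => ?_, fun a ha => ?_⟩
  · obtain ⟨ε, h1, h2, h3⟩ := ((hc1.eventually (lt_mem_nhds ha)).and hsmall).exists
    exact (hb ε h2 h3).mono fun t ht => h1.trans_le ht.1
  · obtain ⟨ε, h1, h2, h3⟩ := ((hc2.eventually (gt_mem_nhds ha)).and hsmall).exists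
    exact (hb ε h2 h3).mono fun t ht => ht.2.trans_lt h1

variable [T2Space X] [CompactSpace X] [Nonempty X] [MeasurableSpace X] [BorelSpace X]

theorem tendsto_osc (hD : IsSmoothHypersurface n D) (hφ : IsContinuityPath D β α g φ) {s : ℝ}
    (hs : s ∈ Icc (0 : ℝ) 1) :
    Tendsto (fun t => osc D (φ t)) (𝓝[Icc 0 1] s) (𝓝 (osc D (φ s))) := by
  have hne := nonempty_compl_divisor (n := n) hD
  have hbd : ∀ t ∈ Icc (0 : ℝ) 1, ∃ C, ∀ x ∉ D, |φ t x| ≤ C := fun t ht => by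
    obtain ⟨C, -, hC⟩ := (hφ.memHolder t ht).isC2Cone.exists_bound
    exact ⟨C, hC⟩
  obtain ⟨Cs, hCs⟩ := hbd s hs
  rw [Metric.tendsto_nhds]
  intro ε hε
  filter_upwards [eventually_abs_sub_le hφ.continuous hs (by positivity : 0 < ε / 4),
    self_mem_nhdsWithin] with t ht htI
  obtain ⟨Ct, hCt⟩ := hbd t htI
  -- Each of the two points in the oscillation contributes an error ε/4.
  have h1 : osc D (φ t) ≤ osc D (φ s) + ε / 2 := osc_le_of_forall hne fun x hx y hy => by
    have := sub_le_osc hCs hx hy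
    linarith [(abs_le.1 (ht x hx)).2, (abs_le.1 (ht y hy)).1]
  have h2 : osc D (φ s) ≤ osc D (φ t) + ε / 2 := osc_le_of_forall hne fun x hx y hy => by
    have := sub_le_osc hCt hx hy
    linarith [(abs_le.1 (ht x hx)).1, (abs_le.1 (ht y hy)).2]
  rw [Real.dist_eq, abs_lt]
  constructor <;> linarith

/-- Both integrals are written for the fixed measure of ω and pass to the limit by dominated
convergence. Taking ε = 1 in `volRatio_bounds` gives the majorant 2ⁿ times the ratio at s. -/
theorem tendsto_aubinI (hn : 0 < n) (hβ : 0 < β) (hβ1 : β ≤ 1) (hD : IsSmoothHypersurface n D)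
    (hg : IsKahlerConeMetric D β g) (hφ : IsContinuityPath D β α g φ) {s : ℝ}
    (hs : s ∈ Icc (0 : ℝ) 1) :
    Tendsto (fun t => aubinI g (φ t)) (𝓝[Icc 0 1] s) (𝓝 (aubinI g (φ s))) := by
  have hcone : ∀ t ∈ Icc (0 : ℝ) 1, IsC2Cone n D β (φ t) := fun t ht =>
    (hφ.memHolder t ht).isC2Cone
  have hgs := hφ.isMetric s hs
  have hch := (hcone s hs).hasDivisorCharts
  have hfin := vol_univ_lt_top hβ hβ1 hD hch hg
  have : IsFiniteMeasure (vol g) := ⟨hfin⟩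
  have hae := ae_notMem_divisor hD hg.isForm
  obtain ⟨B, hB0, hB⟩ := (hcone s hs).exists_bound
  have hφc : ∀ t ∈ Icc (0 : ℝ) 1, ContinuousOn (φ t) Dᶜ := fun t ht =>
    continuousOn_of_inChart hD.1 (hcone t ht).c2
  have hpt : ∀ x ∉ D, Tendsto (fun t => φ t x) (𝓝[Icc 0 1] s) (𝓝 (φ s x)) := fun x hx => by
    rw [Metric.tendsto_nhds]
    intro ε hε
    filter_upwards [eventually_abs_sub_le hφ.continuous hs (half_pos hε)] with t ht
    rw [Real.dist_eq]
    exact (ht x hx).trans_lt (half_lt_self hε)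
  have hbd : ∀ᶠ t in 𝓝[Icc 0 1] s, ∀ x ∉ D, |φ t x| ≤ B + 1 := by
    filter_upwards [eventually_abs_sub_le hφ.continuous hs one_pos] with t ht x hx
    have h1 := abs_add_le (φ t x - φ s x) (φ s x)
    rw [sub_add_cancel] at h1
    linarith [ht x hx, hB x hx]
  have hint1 : Tendsto (fun t => ∫ x, φ t x ∂(vol g)) (𝓝[Icc 0 1] s)
      (𝓝 (∫ x, φ s x ∂(vol g))) := by
    refine tendsto_integral_filter_of_dominated_convergence (fun _ => B + 1) ?_ ?_
      (integrable_const _) (hae.mono fun x hx => hpt x hx)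
    · filter_upwards [self_mem_nhdsWithin] with t ht
      exact aestronglyMeasurable_of_continuousOn hD hg.isForm (hφc t ht)
    · filter_upwards [hbd] with t ht
      exact hae.mono fun x hx => ht x hx
  -- The integral of the ratio is the volume of ω_{φ_s}, which is finite.
  have hrint : Integrable (fun x => volRatio g (withPotential g (φ s)) x) (vol g) := by
    have hm := (aestronglyMeasurable_of_continuousOn hD hg.isForm
      (continuousOn_volRatio hD.1 hg hgs))
    refine (lintegral_ofReal_ne_top_iff_integrable hm ?_).1 ?_
    · filter_upwards [hae] with x hx
      exact volRatio_nonneg hg hgs hx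
    · have h1 := vol_univ_lt_top hβ hβ1 hD hch hgs
      rw [vol_eq_withDensity hD hg hgs, withDensity_apply _ MeasurableSet.univ,
        Measure.restrict_univ] at h1
      exact h1.ne
  have hint2 : Tendsto (fun t => ∫ x, volRatio g (withPotential g (φ t)) x * φ t x ∂(vol g))
      (𝓝[Icc 0 1] s) (𝓝 (∫ x, volRatio g (withPotential g (φ s)) x * φ s x ∂(vol g))) := by
    refine tendsto_integral_filter_of_dominated_convergence
      (fun x => 2 ^ n * volRatio g (withPotential g (φ s)) x * (B + 1)) ?_ ?_
      ((hrint.const_mul _).mul_const _)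
      (hae.mono fun x hx => (tendsto_volRatio hn hβ hβ1 hD.1 hg hφ hs hx).mul (hpt x hx))
    · filter_upwards [self_mem_nhdsWithin] with t ht
      exact aestronglyMeasurable_of_continuousOn hD hg.isForm
        ((continuousOn_volRatio hD.1 hg (hφ.isMetric t ht)).mul (hφc t ht))
    · filter_upwards [hbd, eventually_formLE_sub hn hβ hβ1 hD.1 hφ hs one_pos,
        self_mem_nhdsWithin] with t ht hF htI
      filter_upwards [hae] with x hx
      have h1 := (volRatio_bounds hD.1 hg (hφ.memHolder t htI).1 (hφ.memHolder s hs).1 hgs le_rfl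
        hF hx).2
      have h2 := volRatio_nonneg hg (hφ.isMetric t htI) hx
      norm_num at h1
      rw [norm_mul, Real.norm_of_nonneg h2]
      exact mul_le_mul h1 (ht x hx) (norm_nonneg _) (h2.trans h1)
  have h3 : ∀ t ∈ Icc (0 : ℝ) 1, aubinI g (φ t) = 1 / totalVol g * (∫ x, φ t x ∂(vol g) -
      ∫ x, volRatio g (withPotential g (φ t)) x * φ t x ∂(vol g)) := fun t ht => by
    rw [aubinI, integral_vol_eq hD hg (hφ.isMetric t ht)]
  rw [h3 s hs]
  refine ((hint1.sub hint2).const_mul _).congr' ?_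
  filter_upwards [self_mem_nhdsWithin] with t ht
  exact (h3 t ht).symm

end Continuity

end KahlerCone

/-! ### The estimate along the continuity path -/

theorem mainTheorem7 (n : ℕ) (hn : 2 ≤ n) :
    ∃ C : ℝ → ℝ → ℝ → ℝ → ℝ,
      ∀ (X : Type*) [TopologicalSpace X] [ChartedSpace (KahlerCone.Cn n) X]
        [IsManifold 𝓘(ℂ, KahlerCone.Cn n) ω X] [T2Space X] [CompactSpace X] [ConnectedSpace X]
        [MeasurableSpace X] [BorelSpace X]
        (D : Set X) (β α : ℝ) (g : KahlerCone.Coeffs11 n X) (φ : ℝ → X → ℝ),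
        KahlerCone.IsSmoothHypersurface n D → 0 < β → β ≤ 1 → 0 < α → α < 1 →
        KahlerCone.IsKahlerConeMetric D β g → KahlerCone.MetricHolder D β α g →
        KahlerCone.IsContinuityPath D β α g φ →
        ∃ τ₀ : ℝ, 0 < τ₀ ∧ τ₀ < 1 ∧
          ∀ τ A P S : ℝ, 0 < τ → τ < 1 →
            KahlerCone.HasSobolevConst D g A →
            KahlerCone.HasPoincareConst D g P →
            (∀ t ∈ Ioc τ 1,
              KahlerCone.HasSobolevConst D (KahlerCone.withPotential g (φ t)) S) →
            ∀ t ∈ Icc (0 : ℝ) 1, (τ ≤ t ∨ τ ≤ τ₀) →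
              KahlerCone.osc D (φ t) ≤
                C (KahlerCone.totalVol g) A P S * (KahlerCone.aubinI g (φ t) + 1) := by
  -- With c the constant for a single potential, c is what t ≥ τ needs; 2c + 1 leaves room for t <
  -- τ, where osc changes by at most 1 and I + 1 may be replaced by I + 2.
  refine ⟨fun _ A P S => 2 * KahlerCone.oscConst n A P S + 1, ?_⟩
  intro X _ _ _ _ _ _ _ _ D β α g φ hD hβ hβ1 _ _ hg _ hφ
  have hn0 : 0 < n := by omega
  have hcone : ∀ t ∈ Icc (0 : ℝ) 1, KahlerCone.IsC2Cone n D β (φ t) := fun t ht =>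
    (hφ.memHolder t ht).isC2Cone
  have h0 : (0 : ℝ) ∈ Icc (0 : ℝ) 1 := left_mem_Icc.2 zero_le_one
  have hnear := ((Metric.tendsto_nhds.1 (KahlerCone.tendsto_osc hD hφ h0)) (1 / 2)
    (by norm_num)).and ((Metric.tendsto_nhds.1
      (KahlerCone.tendsto_aubinI hn0 hβ hβ1 hD hg hφ h0)) (1 / 2) (by norm_num))
  rw [eventually_nhdsWithin_iff, Metric.eventually_nhds_iff] at hnear
  obtain ⟨δ, hδ, hnear⟩ := hnear
  -- Within δ of 0 both osc and I differ from their values at 0 by less than 1/2, so at any two such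
  -- times they differ by less than 1. Halving δ keeps τ₀ strictly inside, and 1/2 keeps it below 1.
  refine ⟨min (δ / 2) (1 / 2), by positivity, by linarith [min_le_right (δ / 2) (1 / 2)], ?_⟩
  intro τ A P S hτ0 hτ1 hA hP hS t ht hcase
  set c := KahlerCone.oscConst n A P S
  have hc : 0 ≤ c := KahlerCone.oscConst_nonneg n A P S
  have hI : ∀ r ∈ Icc (0 : ℝ) 1, 0 ≤ KahlerCone.aubinI g (φ r) := fun r hr =>
    KahlerCone.aubinI_nonneg hn0 hβ hβ1 hD hg (hcone r hr) (hφ.isMetric r hr)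
  have hτI : τ ∈ Icc (0 : ℝ) 1 := ⟨hτ0.le, hτ1.le⟩
  have h1 : ∀ r ∈ Ioc τ 1,
      KahlerCone.osc D (φ r) ≤ c * (KahlerCone.aubinI g (φ r) + 1) := fun r hr => by
    have hrI : r ∈ Icc (0 : ℝ) 1 := ⟨hτ0.le.trans hr.1.le, hr.2⟩
    exact KahlerCone.osc_le_aubinI hβ hβ1 hD hg hn (hcone r hrI) (hφ.isMetric r hrI) hA hP
      (hS r hr)
  -- The Sobolev constant is available only for t > τ. The estimate at τ is the limit from the
  -- right, which is a nontrivial filter because τ < 1.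
  have hτle : KahlerCone.osc D (φ τ) ≤ c * (KahlerCone.aubinI g (φ τ) + 1) := by
    have hle : 𝓝[Ioc τ 1] τ ≤ 𝓝[Icc 0 1] τ :=
      nhdsWithin_mono _ fun r hr => ⟨hτ0.le.trans hr.1.le, hr.2⟩
    have : (𝓝[Ioc τ 1] τ).NeBot := by
      rw [nhdsWithin_Ioc_eq_nhdsGT hτ1]
      infer_instance
    exact le_of_tendsto_of_tendsto ((KahlerCone.tendsto_osc hD hφ hτI).mono_left hle)
      ((((KahlerCone.tendsto_aubinI hn0 hβ hβ1 hD hg hφ hτI).mono_left hle).add_const 1).const_mul c)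
      (eventually_nhdsWithin_of_forall h1)
  have h2 : ∀ r ∈ Icc τ 1,
      KahlerCone.osc D (φ r) ≤ c * (KahlerCone.aubinI g (φ r) + 1) := fun r hr => by
    rcases eq_or_lt_of_le hr.1 with h | h
    · rw [← h]
      exact hτle
    · exact h1 r ⟨h, hr.2⟩
  have hIt := hI t ht
  by_cases htτ : τ ≤ t
  · have h3 := h2 t ⟨htτ, ht.2⟩
    have h4 := mul_nonneg hc (by linarith : 0 ≤ KahlerCone.aubinI g (φ t) + 1)
    linarith
  · have hτs := hcase.resolve_left htτ
    have hδ' : ∀ r ∈ Icc (0 : ℝ) τ, dist r 0 < δ := fun r hr => by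
      rw [Real.dist_eq, sub_zero, abs_of_nonneg hr.1]
      linarith [hr.2, min_le_left (δ / 2) (1 / 2)]
    obtain ⟨a1, a2⟩ := hnear (hδ' t ⟨ht.1, (not_le.1 htτ).le⟩) ht
    obtain ⟨b1, b2⟩ := hnear (hδ' τ ⟨hτ0.le, le_rfl⟩) hτI
    rw [Real.dist_eq, abs_lt] at a1 a2 b1 b2
    -- Both t and τ lie within δ of 0, so I at τ exceeds I at t by less than 1; the same comparison
    -- for osc transfers the estimate from τ to t.
    have h3 : c * (KahlerCone.aubinI g (φ τ) + 1) ≤ c * (KahlerCone.aubinI g (φ t) + 2) :=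
      mul_le_mul_of_nonneg_left (by linarith) hc
    have h4 := mul_nonneg hc hIt
    linarith
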